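/- Let $\omega_1,\omega_2,g,\lambda$ be complex numbers with $\operatorname{Re}\omega_1>0$, $\operatorname{Re}\omega_2>0$ and $0<\operatorname{Re} g<\operatorname{Re}\omega_2$, and put $g^*=\omega_1+\omega_2-g$. Let $S_2(z)=S_2(z|\omega_1,\omega_2)$ be the double sine function: the meromorphic function given for $0<\operatorname{Re} z<\operatorname{Re}(\omega_1+\omega_2)$ by $$\ln S_2(z)=\int_0^\infty \frac{dt}{2t}\left(\frac{\sinh[(2z-\omega_1-\omega_2)t]}{\sinh(\omega_1t)\sinh(\omega_2t)}-\frac{2z-\omega_1-\omega_2}{\omega_1\omega_2t}\right)$$ and continued to $\mathbb{C}$ by $S_2(z)=2\sin\frac{\pi z}{\omega_2}\,S_2(z+\omega_1)$. Put $$\mu(z)=S_2(iz)\,S_2(-iz+g^*),\quad \mu(\boldsymbol y_n)=\prod_{i\ne j}\mu(y_i-y_j),\quad K(z)=S_2^{-1}\!\left(iz+\tfrac{g^*}{2}\right)S_2^{-1}\!\left(-iz+\tfrac{g^*}{2}\right),\quad K(\boldsymbol z_n,\boldsymbol y_n)=\prod_{i,j=1}^nK(z_i-y_j).$$ The Baxter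 operator $Q_n(\lambda)$ maps a function $f$ on $\mathbb{R}^n$ to $$(Q_n(\lambda)f)(\boldsymbol z_n)=\int_{\mathbb{R}^n}e^{2\pi i\lambda\sum_j(z_j-y_j)}K(\boldsymbol z_n,\boldsymbol y_n)\,\mu(\boldsymbol y_n)\,f(\boldsymbol y_n)\,d\boldsymbol y_n,\qquad \boldsymbol z_n\in\mathbb{R}^n,$$ and the Macdonald operators are $$M_r(\boldsymbol z_n;g|\boldsymbol\omega)=\sum_{I\subset\{1,\dots,n\},\,|I|=r}\ \prod_{i\in I,\,j\notin I}\frac{\sinh\frac{\pi}{\omega_2}(z_i-z_j-ig)}{\sinh\frac{\pi}{\omega_2}(z_i-z_j)}\ \prod_{i\in I}T_{z_i}^{-i\omega_1},$$ where $T_{z_i}^{-i\omega_1}$ replaces $z_i$ by $z_i-i\omega_1$. Let $\Phi$ be a function holomorphic in a polystrip $|\operatorname{Im} z_i|<\operatorname{Re}\omega_1+\varepsilon$ $(i=1,\dots,n)$, $\varepsilon>0$, whose integrals against the kernel of $Q_n(\lambda)$ converge absolutely and locally uniformly along the planes $\mathbb{R}^n+i\boldsymbol\eta$ in the polystrip,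 in the following sense: for every $c<\operatorname{Re}\omega_1+\varepsilon$ there is a function $B$ on $\mathbb{R}^n$ with $|\Phi(\boldsymbol x+i\boldsymbol\eta)|\le B(\boldsymbol x)$ for all $\boldsymbol x\in\mathbb{R}^n$ and all $\boldsymbol\eta\in[-c,c]^n$, and with $$\int_{\mathbb{R}^n}\exp\Bigl(\pi\nu\Bigl[\sum_{i,j=1}^n|x_i-x_j|-n\sum_{i=1}^n|x_i|\Bigr]+2\pi\operatorname{Im}\lambda\sum_{i=1}^n x_i\Bigr)B(\boldsymbol x)\,d\boldsymbol x<\infty,\qquad \nu=\operatorname{Re}\frac{g}{\omega_1\omega_2}$$ (the exponential is the size of the kernel of $Q_n(\lambda)$ near infinity). Then the integral $Q_n(\lambda)\Phi$ converges absolutely at every point of $\mathbb{R}^n$ and defines a function that continues analytically to a polystrip $-\operatorname{Re}\omega_1-\delta<\operatorname{Im} z_i<\delta$ with some $\delta>0$, so that $M_r$ can be applied to it. For $r=1,\dots,n$ the integral $Q_n(\lambda)M_r\Phi$ converges absolutely at every point of $\mathbb{R}^n$ too, and $$M_r(\boldsymbol z_n;g|\boldsymbol\omega)\,Q_n(\lambda)\,\Phi=Q_n(\lambda)\,M_r(\boldsymbol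 z_n;g|\boldsymbol\omega)\,\Phi$$ at every $\boldsymbol z_n\in\mathbb{R}^n$ with pairwise distinct coordinates. That is, $Q_n(\lambda)$ commutes with all the Macdonald operators $M_r$, $r=1,\dots,n$. -/

import Mathlib

noncomputable section

namespace RuijsenaarsBaxter

open Complex MeasureTheory

/-- The integral representation of the double sine function `S₂(z | ω₁, ω₂)`, which converges for
`0 < Re z < Re (ω₁ + ω₂)` when `ω₁`, `ω₂` have positive real parts. -/
def doubleSineStrip (ω₁ ω₂ z : ℂ) : ℂ :=
  exp (∫ t in Set.Ioi (0 : ℝ), 1 / (2 * (t : ℂ)) *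
    (sinh ((2 * z - ω₁ - ω₂) * t) / (sinh (ω₁ * t) * sinh (ω₂ * t))
      - (2 * z - ω₁ - ω₂) / (ω₁ * ω₂ * t)))

/-- The number `m` of periods `ω₁` that have to be subtracted from `z` to land in the strip
`0 < Re z < Re (ω₁ + ω₂)`: `0` if `z` is in the strip, and otherwise the integer `m` with
`0 < Re (z - m ω₁) ≤ Re ω₁`. -/
def stripIndex (ω₁ ω₂ z : ℂ) : ℤ :=
  if 0 < z.re ∧ z.re < (ω₁ + ω₂).re then 0 else ⌈z.re / ω₁.re⌉ - 1

/-- The double sine function `S₂(z | ω₁, ω₂)`, for periods with positive real parts: the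
meromorphic function of `z ∈ ℂ` which is given by the integral representation in the strip
`0 < Re z < Re (ω₁ + ω₂)`, and is continued to the plane by
`S₂(z) = 2 sin (π z / ω₂) S₂(z + ω₁)`. (At a pole it takes the value `0`.) -/
def doubleSine (ω₁ ω₂ z : ℂ) : ℂ :=
  let m := stripIndex ω₁ ω₂ z
  doubleSineStrip ω₁ ω₂ (z - m * ω₁)
    * (∏ j ∈ Finset.range (-m).toNat, 2 * sin (Real.pi * (z + j * ω₁) / ω₂))
    / ∏ j ∈ Finset.range m.toNat, 2 * sin (Real.pi * (z - (j + 1) * ω₁) / ω₂)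

/-- The dual coupling constant `g* = ω₁ + ω₂ - g`. -/
def dualCoupling (ω₁ ω₂ g : ℂ) : ℂ := ω₁ + ω₂ - g

/-- The one-variable measure function `μ(z) = S₂(iz) S₂(-iz + g*)`. -/
def mu (ω₁ ω₂ g z : ℂ) : ℂ :=
  doubleSine ω₁ ω₂ (I * z) * doubleSine ω₁ ω₂ (-(I * z) + dualCoupling ω₁ ω₂ g)

/-- The measure function `μ(y₁, …, yₙ) = ∏_{i ≠ j} μ(yᵢ - yⱼ)`. -/
def muTuple (ω₁ ω₂ g : ℂ) {n : ℕ} (y : Fin n → ℂ) : ℂ :=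
  ∏ i, ∏ j ∈ Finset.univ.erase i, mu ω₁ ω₂ g (y i - y j)

/-- The one-variable kernel function `K(z) = S₂(iz + g*/2)⁻¹ S₂(-iz + g*/2)⁻¹`. -/
def kernelK (ω₁ ω₂ g z : ℂ) : ℂ :=
  (doubleSine ω₁ ω₂ (I * z + dualCoupling ω₁ ω₂ g / 2))⁻¹
    * (doubleSine ω₁ ω₂ (-(I * z) + dualCoupling ω₁ ω₂ g / 2))⁻¹

/-- The kernel function `K(z, y) = ∏_{i,j} K(zᵢ - yⱼ)` of two `n`-tuples. -/
def kernelTuple (ω₁ ω₂ g : ℂ) {n : ℕ} (z y : Fin n → ℂ) : ℂ :=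
  ∏ i, ∏ j, kernelK ω₁ ω₂ g (z i - y j)

/-- The kernel `exp (2πiλ (∑ zᵢ - ∑ yᵢ)) K(z, y) μ(y)` of the Baxter operator. -/
def baxterKernel (ω₁ ω₂ g lam : ℂ) {n : ℕ} (z y : Fin n → ℂ) : ℂ :=
  exp (2 * Real.pi * I * lam * ((∑ i, z i) - ∑ i, y i))
    * kernelTuple ω₁ ω₂ g z y * muTuple ω₁ ω₂ g y

/-- A tuple of real numbers as a tuple of complex numbers. -/
def toComplex {n : ℕ} (x : Fin n → ℝ) : Fin n → ℂ := fun i => (x i : ℂ)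

/-- The Baxter operator `Q_n(λ)`, from functions of `n` real variables to functions of `n` real
variables. -/
def baxterQ (ω₁ ω₂ g lam : ℂ) {n : ℕ} (f : (Fin n → ℝ) → ℂ) (x : Fin n → ℝ) : ℂ :=
  ∫ y : Fin n → ℝ, baxterKernel ω₁ ω₂ g lam (toComplex x) (toComplex y) * f y

/-- The point `z` with `zᵢ` replaced by `zᵢ - iω₁` for `i ∈ S`. -/
def shift (ω₁ : ℂ) {n : ℕ} (S : Finset (Fin n)) (z : Fin n → ℂ) : Fin n → ℂ :=
  fun k => if k ∈ S then z k - I * ω₁ else z k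

/-- The Macdonald difference operator `M_r(z; g | ω)`, on functions of `n` complex variables. Its
value at `z` is meaningful where no denominator `sinh (π (zᵢ - zⱼ) / ω₂)`, `i ≠ j`, vanishes. -/
def macdonald (ω₁ ω₂ g : ℂ) {n : ℕ} (r : ℕ) (Φ : (Fin n → ℂ) → ℂ) (z : Fin n → ℂ) : ℂ :=
  ∑ S ∈ Finset.powersetCard r (Finset.univ : Finset (Fin n)),
    (∏ i ∈ S, ∏ j ∈ Sᶜ,
      sinh (Real.pi / ω₂ * (z i - z j - I * g)) / sinh (Real.pi / ω₂ * (z i - z j)))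
    * Φ (shift ω₁ S z)

/-- The size
`exp (π ν (∑_{i ≠ j} |xᵢ - xⱼ| - n ∑ |xᵢ|) + 2π Im λ ∑ xᵢ)`, with `ν = Re (g / (ω₁ ω₂))`,
of the kernel of `Q_n(λ)` as a function of the integration variable `x ∈ ℝⁿ` near infinity. -/
def kernelSize (ω₁ ω₂ g lam : ℂ) {n : ℕ} (x : Fin n → ℝ) : ℝ :=
  Real.exp (Real.pi * (g / (ω₁ * ω₂)).re * ((∑ i, ∑ j, |x i - x j|) - n * ∑ i, |x i|)
    + 2 * Real.pi * lam.im * ∑ i, x i)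

/-- The functions on which the operators are compared: `Φ` is holomorphic in a polystrip
`|Im zᵢ| < Re ω₁ + ε`, and its integrals against the kernel of `Q_n(λ)` along the planes
`ℝⁿ + iη` converge absolutely and locally uniformly in `η`: on each smaller closed polystrip,
`|Φ (x + iη)|` has a majorant in `x` alone that is integrable against the size of the kernel. -/
def Admissible (ω₁ ω₂ g lam : ℂ) {n : ℕ} (Φ : (Fin n → ℂ) → ℂ) : Prop :=
  ∃ ε : ℝ, 0 < ε ∧
    DifferentiableOn ℂ Φ {z | ∀ i, |(z i).im| < ω₁.re + ε} ∧
    ∀ c : ℝ, c < ω₁.re + ε → ∃ B : (Fin n → ℝ) → ℝ,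
      Integrable (fun x => kernelSize ω₁ ω₂ g lam x * B x) ∧
      ∀ x η : Fin n → ℝ, (∀ i, |η i| ≤ c) → ‖Φ (fun i => (x i : ℂ) + I * (η i : ℂ))‖ ≤ B x

/-- `F` is an analytic continuation of the function `f` of `n` real variables to a polystrip
`-Re ω₁ - δ < Im zᵢ < δ` (`δ > 0`), so that the shifts `zᵢ ↦ zᵢ - iω₁` can be applied to it on
`ℝⁿ`. (The polystrip is connected and contains `ℝⁿ`, so the continuation is unique.) -/
def IsContinuation (ω₁ : ℂ) {n : ℕ} (f : (Fin n → ℝ) → ℂ) (F : (Fin n → ℂ) → ℂ) : Prop :=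
  ∃ δ : ℝ, 0 < δ ∧
    DifferentiableOn ℂ F {z | ∀ i, -ω₁.re - δ < (z i).im ∧ (z i).im < δ} ∧
    ∀ x : Fin n → ℝ, F (toComplex x) = f x

end RuijsenaarsBaxter

end

/-!
The terms of `M_r` are labelled by the sets `S ⊆ {1, …, n}` with `r` elements.

In `Q_n(λ) M_r Φ` the coefficient of the term of `S` combines with the measure function: since
`S₂(z) = 2 sin (π z / ω₂) S₂(z + ω₁)`, it replaces `μ(yᵢ - yⱼ)` by `μ(yᵢ - yⱼ - iω₁)` for `i ∈ S`,
`j ∉ S` (`mu_mul_sinh_div_sinh`), which removes the singularities at `yᵢ = yⱼ`. The result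
(`shiftedIntegrand`) is holomorphic while the variables in `S` move up and the other ones move down,
simultaneously, by at most `iω₁/2`: the arguments of `μ` stay in the strip `-Re ω₁ ≤ Im ≤ 0` where
`μ` is holomorphic, the arguments of `K` in `|Im| ≤ Re ω₁ / 2 < Re g* / 2`, and those of `Φ` in
its polystrip. Hence the integral can be taken over the moved contour
(`integral_shiftedIntegrand`), and all terms then contain the same value `Φ(u - iω₁/2)`, the same
`μ(u)` and the same values `K(x_a - u_j + iω₁/2)`, times elementary functions
(`shiftedIntegrand_contourDir`).

In `M_r Q_n(λ) Φ` the contour is moved to `ℝⁿ - iω₁/2` instead (`S = ∅`). This gives the analytic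
continuation of `Q_n(λ) Φ` (`isContinuation_baxterQ`), any other continuation having the same values
at the points `x - iω₁ 1_S` (`IsContinuation.eq_shift`). There the integrand is again the same
common factor times elementary functions (`shiftedIntegrand_empty_shift`). The two sums of elementary
functions agree by the kernel function identity (`kernel_identity_hyperbolic`).

The kernel function identity is a statement about rational functions in the exponentials of the
variables (`kernel_identity_rational`). Multiplied by the Cauchy determinant `det (1 / (xᵢ - yⱼ))`
and a power of the scaling parameter `s`, it says that the sum over `S` of the determinants with the rows in `S` replaced by those of the matrix
with `s xᵢ` instead of `xᵢ` equals the sum over `S` of the determinants with columns replaced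
(`sum_det_piecewise_rows_eq_columns`): both are the coefficient of `t ^ r` in `det (A + t B)`.

Holomorphy and growth of the double sine function come from its integral representation. The
difference equation reduces to the integral for `log (2 cos)` (`exp_logCos`), and the bounds
`|K(z)| ≤ C exp (-π ν |Re z|)`, `|μ(z)| ≤ C exp (π ν |Re z|)` to the asymptotics of products
`S₂(z₁) S₂(z₂)` with `z₁ + z₂` fixed (`exists_logDoubleSine_bound`).
-/

/-! ### The kernel function identity in rational form -/

open Finset Polynomial in
/-- Replacing `r` rows of `A` by those of `B` in all possible ways gives the same sum of
determinants as replacing `r` columns: both are the coefficient of `u ^ r` in `det (A + u B)`. -/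
theorem sum_det_piecewise_rows_eq_columns {R : Type*} [CommRing R] {n : ℕ}
    (A B : Matrix (Fin n) (Fin n) R) (r : ℕ) :
    ∑ S ∈ powersetCard r (univ : Finset (Fin n)),
        (Matrix.of fun i j => if i ∈ S then B i j else A i j).det =
      ∑ S ∈ powersetCard r (univ : Finset (Fin n)),
        (Matrix.of fun i j => if j ∈ S then B i j else A i j).det := by
  have rows : ∀ A B : Matrix (Fin n) (Fin n) R,
      ((A.map C + (X : R[X]) • B.map C).det).coeff r =
      ∑ S ∈ powersetCard r (univ : Finset (Fin n)),
        (Matrix.of fun i j => if i ∈ S then B i j else A i j).det := by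
    intro A B
    have h := (Matrix.detRowAlternating (n := Fin n) (R := R[X])).toMultilinearMap.map_add_univ
      (fun i j => (X : R[X]) * C (B i j)) (fun i j => C (A i j))
    have e : (A.map C + (X : R[X]) • B.map C).det =
        ∑ S : Finset (Fin n), X ^ S.card *
          C ((Matrix.of fun i j => if i ∈ S then B i j else A i j).det) := by
      rw [add_comm]
      refine h.trans (Finset.sum_congr rfl fun S _ => ?_)
      have e1 : (X : R[X]) ^ S.card = ∏ i : Fin n, if i ∈ S then X else 1 := by
        rw [Finset.prod_ite_mem, Finset.univ_inter, Finset.prod_const]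
      rw [e1, RingHom.map_det, ← Matrix.det_mul_column]
      change Matrix.det _ = _
      congr 1
      ext1 i j
      by_cases hi : i ∈ S <;> simp [hi, Finset.piecewise]
    rw [e, finsetSum_coeff]
    simp_rw [mul_comm (X ^ _), coeff_C_mul, coeff_X_pow]
    rw [← Finset.sum_filter_add_sum_filter_not univ (fun S : Finset (Fin n) => S.card = r)]
    rw [Finset.sum_eq_zero (s := filter (fun S : Finset (Fin n) => ¬ S.card = r) univ), add_zero]
    · refine Finset.sum_congr (by ext; simp [mem_powersetCard]) fun S hS => ?_
      rw [(mem_powersetCard.1 hS).2]; simp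
    · intro S hS
      rw [if_neg (fun h => (mem_filter.1 hS).2 h.symm), mul_zero]
  rw [← rows A B]
  have h2 := rows A.transpose B.transpose
  rw [← Matrix.det_transpose]
  refine Eq.trans ?_ (h2.trans (Finset.sum_congr rfl fun S _ => ?_))
  · congr 1
  · rw [← Matrix.det_transpose]
    rfl

open Polynomial in
/-- The dependence of the Cauchy determinant on its first set of variables: up to a factor which
depends on `y` only, it is the Vandermonde determinant divided by the product of the
denominators. -/
theorem exists_det_cauchy_eq_vandermonde {F : Type*} [Field F] {n : ℕ} {y : Fin n → F}
    (hy : Function.Injective y) :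
    ∃ c : F, c ≠ 0 ∧ ∀ x : Fin n → F, (∀ i j, x i ≠ y j) →
      (Matrix.of fun i j => 1 / (x i - y j)).det * (∏ i, ∏ j, (x i - y j)) =
        (Matrix.vandermonde x).det * c := by
  classical
  let p : Fin n → F[X] := fun j => ∏ k ∈ Finset.univ.erase j, (X - C (y k))
  have hdeg : ∀ j, (p j).natDegree < n := fun j => by
    rw [natDegree_prod_of_monic _ _ fun k _ => monic_X_sub_C _]
    simpa using Fin.pos j
  let A : Matrix (Fin n) (Fin n) F := Matrix.of fun k j => (p j).coeff k
  have hA : ∀ x : Fin n → F, (Matrix.of fun i j => (p j).eval (x i)) = Matrix.vandermonde x * A := by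
    intro x
    ext i j
    rw [Matrix.mul_apply, Matrix.of_apply, eval_eq_sum_range' (hdeg j), Finset.sum_range]
    simp [A, Matrix.vandermonde_apply, mul_comm]
  refine ⟨A.det, ?_, fun x hx => ?_⟩
  · have h := congrArg Matrix.det (hA y)
    have hd : (Matrix.of fun i j => (p j).eval (y i)) =
        Matrix.diagonal fun i => (p i).eval (y i) := by
      ext i j
      rcases eq_or_ne i j with rfl | hij
      · simp
      · rw [Matrix.diagonal_apply_ne _ hij, Matrix.of_apply, eval_prod]
        exact Finset.prod_eq_zero (i := i) (by simp [hij]) (by simp)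
    rw [hd, Matrix.det_diagonal, Matrix.det_mul] at h
    intro h0
    rw [h0, mul_zero] at h
    obtain ⟨i, -, hi⟩ := Finset.prod_eq_zero_iff.1 h
    rw [eval_prod] at hi
    obtain ⟨k, hk, hk'⟩ := Finset.prod_eq_zero_iff.1 hi
    simp only [eval_sub, eval_X, eval_C] at hk'
    exact (Finset.ne_of_mem_erase hk) (hy (sub_eq_zero.1 hk')).symm
  · rw [← Matrix.det_mul, ← hA x, mul_comm, ← Matrix.det_mul_column]
    congr 1
    ext i j
    simp only [Matrix.of_apply]
    rw [eval_prod, ← Finset.mul_prod_erase Finset.univ _ (Finset.mem_univ j)]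
    have : x i - y j ≠ 0 := sub_ne_zero.2 (hx i j)
    simp only [eval_sub, eval_X, eval_C]
    field_simp

/-- The product of `s` over the pairs `i < j` in `S`. -/
theorem prod_lt_pairs {F : Type*} [Field F] {n : ℕ} (S : Finset (Fin n)) (s : F) :
    (∏ i ∈ S, ∏ _j ∈ S.filter (i < ·), s) = s ^ (S.card.choose 2) := by
  induction S using Finset.induction_on_min with
  | empty => simp
  | insert a S ha ih =>
    have hn : a ∉ S := fun h => lt_irrefl _ (ha a h)
    rw [Finset.prod_insert hn, Finset.card_insert_of_notMem hn, Nat.choose_succ_succ' _ 1, pow_add,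
      Nat.choose_one_right]
    congr 1
    · rw [Finset.prod_const, Finset.filter_insert, if_neg (lt_irrefl _),
        Finset.filter_true_of_mem ha]
    · rw [← ih]
      refine Finset.prod_congr rfl fun i hi => ?_
      rw [Finset.filter_insert, if_neg (ha i hi).not_gt]

open Finset in
/-- Scaling the variables with indices in `S` by `s` in a Vandermonde determinant. -/
theorem det_vandermonde_scale {F : Type*} [Field F] {n : ℕ} {x : Fin n → F}
    (hx : Function.Injective x) (S : Finset (Fin n)) (s : F) :
    (Matrix.vandermonde fun i => if i ∈ S then s * x i else x i).det =
      (Matrix.vandermonde x).det * (s ^ (S.card.choose 2) *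
        ∏ i ∈ S, ∏ j ∈ Sᶜ, (s * x i - x j) / (x i - x j)) := by
  rw [Matrix.det_vandermonde, Matrix.det_vandermonde, ← prod_lt_pairs]
  let h : Fin n → Fin n → F := fun i j =>
    ((if j ∈ S then s * x j else x j) - (if i ∈ S then s * x i else x i)) / (x j - x i)
  have hne : ∀ i j, i ≠ j → x j - x i ≠ 0 := fun i j hij => sub_ne_zero.2 fun e => hij (hx e).symm
  have hsymm : ∀ i j, h i j = h j i := fun i j => by
    simp only [h]; rw [← neg_sub, ← neg_sub (x i), neg_div_neg_eq]
  have e1 : (∏ i, ∏ j ∈ Ioi i, ((if j ∈ S then s * x j else x j) -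
      (if i ∈ S then s * x i else x i))) = (∏ i, ∏ j ∈ Ioi i, (x j - x i)) *
      ∏ i, ∏ j ∈ Ioi i, h i j := by
    rw [← Finset.prod_mul_distrib]
    refine prod_congr rfl fun i _ => ?_
    rw [← Finset.prod_mul_distrib]
    refine prod_congr rfl fun j hj => ?_
    rw [mul_div_cancel₀ _ (hne i j (mem_Ioi.1 hj).ne)]
  rw [e1]
  congr 1
  have split : ∀ i, ∏ j ∈ Ioi i, h i j =
      (∏ j ∈ S.filter (i < ·), h i j) * ∏ j ∈ Sᶜ.filter (i < ·), h i j := fun i => by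
    rw [← prod_union (disjoint_filter_filter disjoint_compl_right)]
    congr 1
    ext j; by_cases hj : j ∈ S <;> simp [hj]
  simp_rw [split]
  rw [← prod_mul_prod_compl S]
  simp_rw [prod_mul_distrib]
  have a1 : ∏ i ∈ S, ∏ j ∈ S.filter (i < ·), h i j = ∏ i ∈ S, ∏ _j ∈ S.filter (i < ·), s := by
    refine prod_congr rfl fun i hi => prod_congr rfl fun j hj => ?_
    obtain ⟨hj, hij⟩ := mem_filter.1 hj
    simp only [h, if_pos hi, if_pos hj]
    rw [← mul_sub, mul_div_cancel_right₀ _ (hne i j hij.ne)]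
  have a2 : ∏ i ∈ Sᶜ, ∏ j ∈ Sᶜ.filter (i < ·), h i j = 1 := by
    refine prod_eq_one fun i hi => prod_eq_one fun j hj => ?_
    obtain ⟨hj, hij⟩ := mem_filter.1 hj
    simp only [h, if_neg (mem_compl.1 hi), if_neg (mem_compl.1 hj)]
    exact div_self (hne i j hij.ne)
  have a3 : ∏ i ∈ Sᶜ, ∏ j ∈ S.filter (i < ·), h i j =
      ∏ i ∈ S, ∏ j ∈ Sᶜ.filter (· < i), h i j := by
    simp_rw [prod_filter]
    rw [prod_comm]
    refine prod_congr rfl fun i _ => prod_congr rfl fun j _ => ?_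
    rw [hsymm]
  rw [a1, a2, a3, mul_one, mul_assoc]
  congr 1
  rw [← prod_mul_distrib]
  refine prod_congr rfl fun i hi => ?_
  rw [← prod_union]
  · have : Sᶜ.filter (i < ·) ∪ Sᶜ.filter (· < i) = Sᶜ := by
      ext j
      simp only [mem_union, mem_filter, mem_compl]
      constructor
      · rintro (h | h) <;> exact h.1
      · intro hj
        rcases lt_trichotomy i j with hl | rfl | hl
        · exact Or.inl ⟨hj, hl⟩
        · exact absurd hi hj
        · exact Or.inr ⟨hj, hl⟩
    rw [this]
    refine prod_congr rfl fun j hj => ?_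
    simp only [h, if_pos hi, if_neg (mem_compl.1 hj)]
    rw [← neg_sub, ← neg_sub (x i), neg_div_neg_eq]
  · rw [disjoint_filter]
    intro j _ h1 h2
    exact lt_asymm h1 h2

open Finset in
/-- Scaling the variables `xᵢ` with `i ∈ S` by `s` in a Cauchy determinant. -/
theorem det_cauchy_scale_rows {F : Type*} [Field F] {n : ℕ} {x y : Fin n → F} {s : F}
    (hx : Function.Injective x) (hy : Function.Injective y) (hxy : ∀ i j, x i ≠ y j)
    (hsxy : ∀ i j, s * x i ≠ y j) (S : Finset (Fin n)) :
    (Matrix.of fun i j => if i ∈ S then 1 / (s * x i - y j) else 1 / (x i - y j)).det =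
      (Matrix.of fun i j => 1 / (x i - y j)).det * (s ^ (S.card.choose 2) *
        ((∏ i ∈ S, ∏ j ∈ Sᶜ, (s * x i - x j) / (x i - x j)) *
          ∏ i ∈ S, ∏ a, (x i - y a) / (s * x i - y a))) := by
  obtain ⟨c, -, h⟩ := exists_det_cauchy_eq_vandermonde hy
  have h1 := h x hxy
  have h2 := h (fun i => if i ∈ S then s * x i else x i) (fun i j => by
    by_cases hi : i ∈ S
    · simpa [hi] using hsxy i j
    · simpa [hi] using hxy i j)
  have e : (Matrix.of fun i j => if i ∈ S then 1 / (s * x i - y j) else 1 / (x i - y j)) =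
      Matrix.of fun i j => 1 / ((if i ∈ S then s * x i else x i) - y j) := by
    ext i j; by_cases hi : i ∈ S <;> simp [hi]
  rw [e]
  rw [det_vandermonde_scale hx] at h2
  have p0 : ∏ i, ∏ j, (x i - y j) ≠ 0 :=
    prod_ne_zero_iff.2 fun i _ => prod_ne_zero_iff.2 fun j _ => sub_ne_zero.2 (hxy i j)
  have p1 : ∏ i, ∏ j, ((if i ∈ S then s * x i else x i) - y j) ≠ 0 := by
    refine prod_ne_zero_iff.2 fun i _ => prod_ne_zero_iff.2 fun j _ => sub_ne_zero.2 ?_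
    by_cases hi : i ∈ S
    · simpa [hi] using hsxy i j
    · simpa [hi] using hxy i j
  have p2 : (∏ i, ∏ j, (x i - y j)) = (∏ i, ∏ j, ((if i ∈ S then s * x i else x i) - y j)) *
      ∏ i ∈ S, ∏ a, (x i - y a) / (s * x i - y a) := by
    rw [← prod_mul_prod_compl S, ← prod_mul_prod_compl S (fun i =>
      ∏ j, ((if i ∈ S then s * x i else x i) - y j)), mul_right_comm, ← prod_mul_distrib]
    congr 1
    · refine prod_congr rfl fun i hi => ?_
      rw [← prod_mul_distrib]
      refine prod_congr rfl fun j _ => ?_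
      rw [if_pos hi, mul_div_cancel₀ _ (sub_ne_zero.2 (hsxy i j))]
    · refine prod_congr rfl fun i hi => prod_congr rfl fun j _ => ?_
      rw [if_neg (mem_compl.1 hi)]
  apply mul_right_cancel₀ p1
  rw [h2]
  calc _ = (Matrix.vandermonde x).det * c * (s ^ (S.card.choose 2) *
        ∏ i ∈ S, ∏ j ∈ Sᶜ, (s * x i - x j) / (x i - x j)) := by ring
    _ = _ := by rw [← h1, p2]; ring

theorem det_cauchy_ne_zero {F : Type*} [Field F] {n : ℕ} {x y : Fin n → F}
    (hx : Function.Injective x) (hy : Function.Injective y) (hxy : ∀ i j, x i ≠ y j) :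
    (Matrix.of fun i j => 1 / (x i - y j)).det ≠ 0 := by
  obtain ⟨c, hc, h⟩ := exists_det_cauchy_eq_vandermonde hy
  intro h0
  have h1 := h x hxy
  rw [h0, zero_mul] at h1
  exact mul_ne_zero (Matrix.det_vandermonde_ne_zero_iff.2 hx) hc h1.symm

open Finset in
/-- The kernel function identity for the Macdonald operators, in rational form. Both sides are the
coefficient of `u ^ r` in the expansion, along rows and along columns, of the determinant of
`1 / (xᵢ - yⱼ) + u / (s xᵢ - yⱼ)`, divided by the Cauchy determinant and by
`s ^ (r (r - 1) / 2)`. -/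
theorem kernel_identity_rational {F : Type*} [Field F] {n : ℕ} {x y : Fin n → F} {s : F} (hs : s ≠ 0)
    (hx : Function.Injective x) (hy : Function.Injective y) (hxy : ∀ i j, x i ≠ y j)
    (hsxy : ∀ i j, s * x i ≠ y j) (r : ℕ) :
    ∑ S ∈ powersetCard r (univ : Finset (Fin n)),
      (∏ i ∈ S, ∏ j ∈ Sᶜ, (s * x i - x j) / (x i - x j)) *
          ∏ i ∈ S, ∏ a, (x i - y a) / (s * x i - y a) =
    ∑ S ∈ powersetCard r (univ : Finset (Fin n)),
      (∏ i ∈ S, ∏ j ∈ Sᶜ, (y i - s * y j) / (y i - y j)) *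
          ∏ i ∈ S, ∏ a, (x a - y i) / (s * x a - y i) := by
  have key := sum_det_piecewise_rows_eq_columns (Matrix.of fun i j => 1 / (x i - y j))
    (Matrix.of fun i j => 1 / (s * x i - y j)) r
  simp only [Matrix.of_apply] at key
  have hrow : ∀ S ∈ powersetCard r (univ : Finset (Fin n)),
      (Matrix.of fun i j => if i ∈ S then 1 / (s * x i - y j) else 1 / (x i - y j)).det =
      ((Matrix.of fun i j => 1 / (x i - y j)).det * s ^ (r.choose 2)) *
        ((∏ i ∈ S, ∏ j ∈ Sᶜ, (s * x i - x j) / (x i - x j)) *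
          ∏ i ∈ S, ∏ a, (x i - y a) / (s * x i - y a)) := fun S hS => by
    rw [det_cauchy_scale_rows hx hy hxy hsxy, (mem_powersetCard.1 hS).2, mul_assoc]
  have hcol : ∀ S ∈ powersetCard r (univ : Finset (Fin n)),
      (Matrix.of fun i j => if j ∈ S then 1 / (s * x i - y j) else 1 / (x i - y j)).det =
      ((Matrix.of fun i j => 1 / (x i - y j)).det * s ^ (r.choose 2)) *
        ((∏ i ∈ S, ∏ j ∈ Sᶜ, (y i - s * y j) / (y i - y j)) *
          ∏ i ∈ S, ∏ a, (x a - y i) / (s * x a - y i)) := fun S hS => by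
    have hyx : ∀ i j, y i ≠ x j := fun i j h => hxy j i h.symm
    have hsyx : ∀ i j, s⁻¹ * y i ≠ x j := fun i j h =>
      hsxy j i (by rw [← h, mul_inv_cancel_left₀ hs])
    have h := det_cauchy_scale_rows hy hx hyx hsyx S
    have hneg : ∀ A : Matrix (Fin n) (Fin n) F, (-A).det = (-1) ^ n * A.det := fun A => by
      rw [Matrix.det_neg, Fintype.card_fin]
    have e1 : (Matrix.of fun i j => 1 / (x i - y j)).det =
        (-1) ^ n * (Matrix.of fun i j => 1 / (y i - x j)).det := by
      rw [← hneg, ← Matrix.det_transpose]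
      congr 1; ext i j
      simp only [Matrix.transpose_apply, Matrix.neg_apply, Matrix.of_apply]
      rw [← one_div_neg_eq_neg_one_div, neg_sub]
    have e2 : (Matrix.of fun i j => if j ∈ S then 1 / (s * x i - y j) else 1 / (x i - y j)).det =
        (-1) ^ n * (s⁻¹ ^ r * (Matrix.of fun i j =>
          if i ∈ S then 1 / (s⁻¹ * y i - x j) else 1 / (y i - x j)).det) := by
      have e3 : s⁻¹ ^ r = ∏ i : Fin n, if i ∈ S then s⁻¹ else 1 := by
        rw [prod_ite_mem, univ_inter, prod_const, (mem_powersetCard.1 hS).2]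
      rw [e3, ← Matrix.det_mul_column, ← hneg, ← Matrix.det_transpose]
      congr 1; ext i j
      simp only [Matrix.transpose_apply, Matrix.neg_apply, Matrix.of_apply]
      by_cases hi : i ∈ S
      · simp only [hi, if_true]
        have a1 : s * x j - y i ≠ 0 := sub_ne_zero.2 (hsxy j i)
        have a2 : s⁻¹ * y i - x j ≠ 0 := sub_ne_zero.2 (hsyx i j)
        have a3 : s * (s⁻¹ * y i - x j) = -(s * x j - y i) := by
          rw [mul_sub, mul_inv_cancel_left₀ hs]; ring
        rw [inv_mul_eq_div, div_div, mul_comm (s⁻¹ * y i - x j), a3, one_div_neg_eq_neg_one_div,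
          neg_neg]
      · simp only [hi, if_false, one_mul]
        rw [← one_div_neg_eq_neg_one_div, neg_sub]
    rw [e2, h, e1]
    have hc : S.card = r := (mem_powersetCard.1 hS).2
    have hcc : Sᶜ.card = n - r := by rw [card_compl, hc, Fintype.card_fin]
    have hrn : r ≤ n := by
      rw [← hc]; simpa using card_le_univ S
    have q1 : ∏ i ∈ S, ∏ j ∈ Sᶜ, (s⁻¹ * y i - y j) / (y i - y j) =
        s⁻¹ ^ (r * (n - r)) * ∏ i ∈ S, ∏ j ∈ Sᶜ, (y i - s * y j) / (y i - y j) := by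
      rw [mul_comm r, pow_mul, ← hcc, ← hc, ← prod_const, ← prod_mul_distrib]
      refine prod_congr rfl fun i _ => ?_
      rw [← prod_const, ← prod_mul_distrib]
      refine prod_congr rfl fun j _ => ?_
      rw [← mul_div_assoc, mul_sub, inv_mul_cancel_left₀ hs]
    have q2 : ∏ i ∈ S, ∏ a, (y i - x a) / (s⁻¹ * y i - x a) =
        s ^ (r * n) * ∏ i ∈ S, ∏ a, (x a - y i) / (s * x a - y i) := by
      rw [mul_comm r, pow_mul, ← hc, ← prod_const, ← prod_mul_distrib]
      refine prod_congr rfl fun i _ => ?_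
      have : s ^ n = ∏ _a : Fin n, s := by simp
      rw [this, ← prod_mul_distrib]
      refine prod_congr rfl fun j _ => ?_
      have a1 : s * x j - y i ≠ 0 := sub_ne_zero.2 (hsxy j i)
      have a2 : s⁻¹ * y i - x j ≠ 0 := sub_ne_zero.2 (hsyx i j)
      have a3 : s * (s⁻¹ * y i - x j) = -(s * x j - y i) := by
        rw [mul_sub, mul_inv_cancel_left₀ hs]; ring
      rw [← mul_div_assoc, div_eq_div_iff a2 a1]
      linear_combination (y i - x j) * a3
    rw [q1, q2, hc]
    -- the powers of `s` match because `r (r - 1) + r + r (n - r) = r n`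
    have hpow : s⁻¹ ^ r * s⁻¹ ^ (r.choose 2) * s⁻¹ ^ (r * (n - r)) * s ^ (r * n) =
        s ^ (r.choose 2) := by
      have hch : r.choose 2 + r.choose 2 + r + r * (n - r) = r * n := by
        have h2 : r.choose 2 + r.choose 2 + r = r * r := by
          have := Nat.triangle_succ r
          have h3 := Nat.choose_two_right r
          have h4 : r.choose 2 * 2 = r * (r - 1) := by
            rw [h3, Nat.div_mul_cancel (Nat.even_mul_pred_self r).two_dvd]
          rcases r with _ | k
          · simp
          · simp only [Nat.add_sub_cancel] at h4
            nlinarith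
        rw [h2, ← mul_add, Nat.add_sub_cancel' hrn]
      rw [← hch]
      simp only [pow_add, inv_pow]
      field_simp
    linear_combination ((-1) ^ n * (Matrix.of fun i j => 1 / (y i - x j)).det *
      (∏ i ∈ S, ∏ j ∈ Sᶜ, (y i - s * y j) / (y i - y j)) *
      ∏ i ∈ S, ∏ a, (x a - y i) / (s * x a - y i)) * hpow
  rw [sum_congr rfl hrow, sum_congr rfl hcol, ← mul_sum, ← mul_sum] at key
  exact mul_left_cancel₀ (mul_ne_zero (det_cauchy_ne_zero hx hy hxy) (pow_ne_zero _ hs)) key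

/-! ### Integrals of holomorphic functions that depend on parameters -/

open MeasureTheory Metric Filter Topology in
/-- Differentiation under the integral for holomorphic integrands: a locally uniform integrable
majorant of the integrand suffices, since the Cauchy estimate bounds the derivative. -/
theorem hasFDerivAt_integral_of_holomorphic {α E : Type*} [MeasurableSpace α] {μ : Measure α}
    [NormedAddCommGroup E] [NormedSpace ℂ E] [FiniteDimensional ℂ E] {k : E → α → ℂ} {z₀ : E}
    {r : ℝ} (hr : 0 < r) {b : α → ℝ} (hb : Integrable b μ)
    (hmeas : ∀ z ∈ ball z₀ r, AEStronglyMeasurable (k z) μ)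
    (hbound : ∀ᵐ y ∂μ, ∀ z ∈ ball z₀ r, ‖k z y‖ ≤ b y)
    (hdiff : ∀ᵐ y ∂μ, DifferentiableOn ℂ (fun z => k z y) (ball z₀ r)) :
    Integrable (fun y => fderiv ℂ (fun z => k z y) z₀) μ ∧
      HasFDerivAt (fun z => ∫ y, k z y ∂μ) (∫ y, fderiv ℂ (fun z => k z y) z₀ ∂μ) z₀ := by
  have h₀ : z₀ ∈ ball z₀ r := mem_ball_self hr
  have hd₀ : ∀ᵐ y ∂μ, HasFDerivAt (fun z => k z y) (fderiv ℂ (fun z => k z y) z₀) z₀ :=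
    hdiff.mono fun y hy => (hy.differentiableAt (isOpen_ball.mem_nhds h₀)).hasFDerivAt
  have hdir : ∀ v : E,
      AEStronglyMeasurable (fun y => fderiv ℂ (fun z => k z y) z₀ v) μ := by
    intro v
    have ht : Tendsto (fun m : ℕ => z₀ + ((m : ℝ) + 1)⁻¹ • v) atTop (𝓝 z₀) := by
      have h1 : Tendsto (fun m : ℕ => ((m : ℝ) + 1)⁻¹) atTop (𝓝 0) := by
        simpa using tendsto_one_div_add_atTop_nhds_zero_nat (𝕜 := ℝ)
      simpa using tendsto_const_nhds.add (h1.smul_const v)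
    obtain ⟨N, hN⟩ := eventually_atTop.1 (ht.eventually (isOpen_ball.mem_nhds h₀))
    refine aestronglyMeasurable_of_tendsto_ae atTop (f := fun m : ℕ => fun y =>
      (((m + N : ℕ) : ℂ) + 1) * (k (z₀ + (((m + N : ℕ) : ℝ) + 1)⁻¹ • v) y - k z₀ y)) (fun m => ?_) ?_
    · exact aestronglyMeasurable_const.mul ((hmeas _ (hN _ (by omega))).sub (hmeas _ h₀))
    · filter_upwards [hd₀] with y hy
      have hc : Tendsto (fun m : ℕ => ‖(((m + N : ℕ) : ℂ) + 1)‖) atTop atTop := by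
        have e : ∀ m : ℕ, ‖(((m + N : ℕ) : ℂ) + 1)‖ = (m + N : ℕ) + 1 := fun m => by
          rw [← Nat.cast_add_one, Complex.norm_natCast]; push_cast; ring
        simp_rw [e]
        exact tendsto_atTop_add_const_right _ _
          (tendsto_natCast_atTop_atTop.comp (tendsto_add_atTop_nat N))
      have h2 := hy.lim v hc
      refine h2.congr fun m => ?_
      rw [smul_eq_mul]
      congr 4
      have : ((((m + N : ℕ) : ℝ) + 1)⁻¹ • v : E) = (((((m + N : ℕ) : ℝ) + 1)⁻¹ : ℝ) : ℂ) • v := by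
        rw [Complex.coe_smul]
      rw [this]; push_cast; rfl
  have hF' : AEStronglyMeasurable (fun y => fderiv ℂ (fun z => k z y) z₀) μ := by
    let B := Module.finBasis ℂ E
    have e : (fun y => fderiv ℂ (fun z => k z y) z₀) = fun y => ∑ i,
        (fderiv ℂ (fun z => k z y) z₀ (B i)) • LinearMap.toContinuousLinearMap (B.coord i) := by
      ext y v
      conv_lhs => rw [← B.sum_repr v, map_sum]
      simp [mul_comm]
    rw [e]
    exact Finset.aestronglyMeasurable_fun_sum _ fun i _ => (hdir (B i)).smul_const _
  refine hasFDerivAt_integral_of_dominated_loc_of_lip' (bound := fun y => 2 * b y / r)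
    (ball_mem_nhds z₀ hr) hmeas (hb.mono' (hmeas _ h₀) (hbound.mono fun y hy => hy _ h₀)) hF' ?_
    ((hb.const_mul 2).div_const r) hd₀
  filter_upwards [hbound, hdiff] with y hy hy' z hz
  rw [← dist_eq_norm, ← dist_eq_norm]
  refine Complex.dist_le_div_mul_dist_of_mapsTo_ball hy' (fun w hw => ?_) hz
  rw [mem_closedBall, dist_eq_norm]
  linarith [norm_sub_le (k w y) (k z₀ y), hy w hw, hy z₀ h₀]

open MeasureTheory Metric in
theorem hasDerivAt_integral_of_holomorphic {α : Type*} [MeasurableSpace α] {μ : Measure α}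
    {k : ℂ → α → ℂ} {z₀ : ℂ}
    {r : ℝ} (hr : 0 < r) {b : α → ℝ} (hb : Integrable b μ)
    (hmeas : ∀ z ∈ ball z₀ r, AEStronglyMeasurable (k z) μ)
    (hbound : ∀ᵐ y ∂μ, ∀ z ∈ ball z₀ r, ‖k z y‖ ≤ b y)
    (hdiff : ∀ᵐ y ∂μ, DifferentiableOn ℂ (fun z => k z y) (ball z₀ r)) :
    HasDerivAt (fun z => ∫ y, k z y ∂μ) (∫ y, deriv (fun z => k z y) z₀ ∂μ) z₀ := by
  obtain ⟨h1, h2⟩ := hasFDerivAt_integral_of_holomorphic hr hb hmeas hbound hdiff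
  have := h2.hasDerivAt
  rwa [ContinuousLinearMap.integral_apply h1] at this

open MeasureTheory Complex Set in
/-- Shift of the contour `ℝⁿ` along a real direction `d`: if `J` is holomorphic along the planes
`ℝⁿ + s d`, `0 ≤ Im s ≤ η`, and has a common integrable majorant on them, then its integral over
these planes does not depend on `s`. The Cauchy theorem on the rectangle `[0, 1] × [0, η]` is
applied for every `u ∈ ℝⁿ` to `s ↦ J (u + s d)` and integrated over `u`: the contributions of the
vertical sides cancel, since they differ by the translation `u ↦ u + d`, while those of the
horizontal sides are the integrals over the planes. -/
theorem integral_shift_contour {n : ℕ} {J : (Fin n → ℂ) → ℂ} {d : Fin n → ℝ} {η : ℝ} (hη : 0 ≤ η)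
    (hJ : ∀ (u : Fin n → ℝ) (s : ℂ), 0 ≤ s.im → s.im ≤ η →
      DifferentiableAt ℂ J (fun i => (u i : ℂ) + s * d i))
    {b : (Fin n → ℝ) → ℝ} (hb : Integrable b)
    (hbd : ∀ (u : Fin n → ℝ) (t : ℝ), 0 ≤ t → t ≤ η →
      ‖J (fun i => (u i : ℂ) + (t * I : ℂ) * d i)‖ ≤ b u) {s : ℂ} (hs : s.im = η) :
    Integrable (fun u : Fin n → ℝ => J (fun i => (u i : ℂ) + s * d i)) ∧
    ∫ u : Fin n → ℝ, J (fun i => (u i : ℂ) + s * d i) = ∫ u : Fin n → ℝ, J (fun i => (u i : ℂ)) := by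
  set f : (Fin n → ℝ) → ℂ → ℂ := fun u s => J (fun i => (u i : ℂ) + s * d i) with hf
  have hcov : ∀ u (ξ : ℝ) (s : ℂ), f u (ξ + s) = f (u + ξ • d) s := fun u ξ s => by
    simp only [hf]; congr 1; ext i; simp; ring
  have hcts : ∀ p : (Fin n → ℝ) × ℂ, 0 ≤ p.2.im → p.2.im ≤ η →
      ContinuousAt (fun p : (Fin n → ℝ) × ℂ => f p.1 p.2) p := fun p h1 h2 => by
    have h := (hJ p.1 p.2 h1 h2).continuousAt
    exact ContinuousAt.comp (f := fun p : (Fin n → ℝ) × ℂ => fun i => (p.1 i : ℂ) + p.2 * d i)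
      (x := p) h (by fun_prop)
  have hcu : ∀ s : ℂ, 0 ≤ s.im → s.im ≤ η → Continuous fun u => f u s := fun s h1 h2 => by
    refine continuous_iff_continuousAt.2 fun u => ?_
    exact ContinuousAt.comp (f := fun u : Fin n → ℝ => (u, s)) (x := u) (hcts (u, s) h1 h2)
      (by fun_prop)
  have hint : ∀ t : ℝ, 0 ≤ t → t ≤ η → Integrable fun u => f u (t * I) := fun t h1 h2 =>
    hb.mono' (hcu _ (by simpa using h1) (by simpa using h2)).aestronglyMeasurable
      (ae_of_all _ fun u => hbd u t h1 h2)
  -- the average over the horizontal sides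
  have hhor : ∀ t : ℝ, 0 ≤ t → t ≤ η →
      Integrable (fun u => ∫ x : ℝ in (0 : ℝ)..1, f u (x + t * I)) ∧
      ∫ u, ∫ x : ℝ in (0 : ℝ)..1, f u (x + t * I) = ∫ u, f u (t * I) := by
    intro t h1 h2
    have hI : Integrable (fun p : (Fin n → ℝ) × ℝ => f p.1 (p.2 + t * I))
        ((volume : Measure (Fin n → ℝ)).prod (volume.restrict (Ioc (0 : ℝ) 1))) := by
      have hm : Continuous fun p : (Fin n → ℝ) × ℝ => f p.1 (p.2 + t * I) := by
        refine continuous_iff_continuousAt.2 fun p => ?_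
        exact ContinuousAt.comp (f := fun p : (Fin n → ℝ) × ℝ => (p.1, (p.2 : ℂ) + t * I)) (x := p)
          (hcts (p.1, p.2 + t * I) (by simpa using h1) (by simpa using h2)) (by fun_prop)
      rw [integrable_prod_iff' hm.aestronglyMeasurable]
      simp_rw [hcov]
      refine ⟨ae_of_all _ fun x => (hint t h1 h2).comp_add_right (x • d), ?_⟩
      have : ∀ x : ℝ, ∫ u, ‖f (u + x • d) (t * I)‖ = ∫ u, ‖f u (t * I)‖ := fun x =>
        integral_add_right_eq_self (fun u => ‖f u (t * I)‖) (x • d)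
      simp_rw [this]
      exact integrable_const _
    constructor
    · simpa only [intervalIntegral.integral_of_le zero_le_one] using hI.integral_prod_left
    · simp_rw [intervalIntegral.integral_of_le zero_le_one]
      rw [integral_integral_swap hI]
      simp_rw [hcov]
      have : ∀ x : ℝ, ∫ u, f (u + x • d) (t * I) = ∫ u, f u (t * I) := fun x =>
        integral_add_right_eq_self (fun u => f u (t * I)) (x • d)
      simp_rw [this]
      simp
  -- the vertical sides
  set H : (Fin n → ℝ) → ℂ := fun u => ∫ y : ℝ in (0 : ℝ)..η, f u (y * I) with hH
  have hHi : Integrable H := by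
    have hI : Integrable (fun p : (Fin n → ℝ) × ℝ => f p.1 (p.2 * I))
        ((volume : Measure (Fin n → ℝ)).prod (volume.restrict (Ioc (0 : ℝ) η))) := by
      have hm : ContinuousOn (fun p : (Fin n → ℝ) × ℝ => f p.1 (p.2 * I))
          (univ ×ˢ Ioc (0 : ℝ) η) := fun p hp => by
        refine ContinuousAt.continuousWithinAt ?_
        exact ContinuousAt.comp (f := fun p : (Fin n → ℝ) × ℝ => (p.1, (p.2 : ℂ) * I)) (x := p)
          (hcts (p.1, p.2 * I) (by simpa using hp.2.1.le) (by simpa using hp.2.2)) (by fun_prop)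
      have hm' := hm.aestronglyMeasurable (μ := volume.prod volume)
        (MeasurableSet.univ.prod measurableSet_Ioc)
      rw [← Measure.prod_restrict, Measure.restrict_univ] at hm'
      refine (hb.comp_fst (volume.restrict (Ioc (0 : ℝ) η))).mono' hm' ?_
      have : ∀ᵐ p ∂((volume : Measure (Fin n → ℝ)).prod (volume.restrict (Ioc (0 : ℝ) η))),
          p.2 ∈ Ioc (0 : ℝ) η :=
        Measure.quasiMeasurePreserving_snd.ae (ae_restrict_mem measurableSet_Ioc)
      filter_upwards [this] with p hp
      exact hbd p.1 p.2 hp.1.le hp.2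
    simpa only [hH, intervalIntegral.integral_of_le hη] using hI.integral_prod_left
  have hrect : ∀ u, (∫ x : ℝ in (0 : ℝ)..1, f u (x + (0 : ℝ) * I)) -
      (∫ x : ℝ in (0 : ℝ)..1, f u (x + η * I)) + I * H (u + d) - I * H u = 0 := by
    intro u
    have h := integral_boundary_rect_eq_zero_of_differentiableOn (f u) 0 (1 + η * I) (by
      intro s hs
      have h2 := hs.2
      simp [uIcc_of_le hη] at h2
      have h := hJ u s h2.1 h2.2
      exact (DifferentiableAt.comp (f := fun s : ℂ => fun i => (u i : ℂ) + s * d i) s h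
        (by fun_prop)).differentiableWithinAt)
    have e : H (u + d) = ∫ y : ℝ in (0 : ℝ)..η, f u (1 + y * I) := by
      simp only [hH]
      congr 1; ext y
      have := hcov u 1 (y * I)
      rw [one_smul] at this
      rw [← this]; simp
    rw [e, hH]
    simpa using h
  have h0 := hhor 0 le_rfl hη
  have h1 := hhor η hη le_rfl
  have key : ∫ u, ((∫ x : ℝ in (0 : ℝ)..1, f u (x + (0 : ℝ) * I)) -
      (∫ x : ℝ in (0 : ℝ)..1, f u (x + η * I)) + I * H (u + d) - I * H u) = 0 := by
    simp_rw [hrect]; simp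
  have hHd : Integrable fun u => I * H (u + d) := (hHi.comp_add_right d).const_mul I
  have i1 : Integrable fun u => (∫ x : ℝ in (0 : ℝ)..1, f u (x + (0 : ℝ) * I)) -
      ∫ x : ℝ in (0 : ℝ)..1, f u (x + η * I) := h0.1.sub h1.1
  have i2 : Integrable fun u => (∫ x : ℝ in (0 : ℝ)..1, f u (x + (0 : ℝ) * I)) -
      (∫ x : ℝ in (0 : ℝ)..1, f u (x + η * I)) + I * H (u + d) := i1.add hHd
  rw [integral_sub i2 (hHi.const_mul I), integral_add i1 hHd, integral_sub h0.1 h1.1,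
    h0.2, h1.2, integral_const_mul, integral_const_mul, integral_add_right_eq_self H d] at key
  have hs' : s = (s.re : ℂ) + η * I := by rw [← hs, re_add_im]
  have e1 : (fun u => f u s) = fun u => f (u + s.re • d) (η * I) := by
    ext u; rw [← hcov, ← hs']
  have e2 : ∀ u : Fin n → ℝ, J (fun i => (u i : ℂ)) = f u (((0 : ℝ) : ℂ) * I) := fun u => by
    simp [hf]
  constructor
  · rw [e1]
    exact (hint η hη le_rfl).comp_add_right (s.re • d)
  · simp_rw [e2]
    rw [e1, integral_add_right_eq_self (fun u => f u (η * I)) (s.re • d)]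
    linear_combination -key

/-! ### Hyperbolic functions and an integral for the logarithm of the cosine -/

open Complex in
theorem sinh_re_le_norm_sinh (z : ℂ) : Real.sinh z.re ≤ ‖sinh z‖ := by
  rw [Real.sinh_eq, sinh, norm_div]
  have h := norm_sub_norm_le (exp z) (exp (-z))
  rw [norm_exp, norm_exp, neg_re] at h
  simpa using div_le_div_of_nonneg_right h zero_le_two

open Complex in
theorem norm_cosh_le_exp (z : ℂ) : ‖cosh z‖ ≤ Real.exp |z.re| := by
  rw [cosh, norm_div]
  have h := norm_add_le (exp z) (exp (-z))
  rw [norm_exp, norm_exp, neg_re] at h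
  have h1 : Real.exp z.re ≤ Real.exp |z.re| := Real.exp_le_exp.2 (le_abs_self _)
  have h2 : Real.exp (-z.re) ≤ Real.exp |z.re| := Real.exp_le_exp.2 (neg_le_abs _)
  have : ‖(2 : ℂ)‖ = 2 := by simp
  rw [this, div_le_iff₀ zero_lt_two]
  linarith

open Complex in
theorem norm_sinh_le_exp (z : ℂ) : ‖sinh z‖ ≤ Real.exp |z.re| := by
  rw [sinh, norm_div]
  have h := norm_sub_le (exp z) (exp (-z))
  rw [norm_exp, norm_exp, neg_re] at h
  have h1 : Real.exp z.re ≤ Real.exp |z.re| := Real.exp_le_exp.2 (le_abs_self _)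
  have h2 : Real.exp (-z.re) ≤ Real.exp |z.re| := Real.exp_le_exp.2 (neg_le_abs _)
  have : ‖(2 : ℂ)‖ = 2 := by simp
  rw [this, div_le_iff₀ zero_lt_two]
  linarith

open Complex in
theorem norm_sinh_le_mul_exp (z : ℂ) : ‖sinh z‖ ≤ ‖z‖ * Real.exp |z.re| := by
  have hconv : Convex ℝ (re ⁻¹' Set.Icc (-|z.re|) |z.re|) :=
    (convex_Icc _ _).is_linear_preimage ⟨add_re, by simp⟩
  have h := hconv.norm_image_sub_le_of_norm_hasDerivWithin_le (f := sinh) (f' := cosh)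
    (C := Real.exp |z.re|) (x := 0) (y := z) (fun w _ => (hasDerivAt_sinh w).hasDerivWithinAt)
    (fun w hw => (norm_cosh_le_exp w).trans (Real.exp_le_exp.2 (abs_le.2 hw))) ⟨by simp, by simp⟩
    ⟨neg_abs_le _, le_abs_self _⟩
  simpa [mul_comm] using h

open Complex in
theorem norm_cosh_sub_one_le (z : ℂ) : ‖cosh z - 1‖ ≤ ‖z‖ ^ 2 * Real.exp ‖z‖ := by
  have h := (convex_closedBall (0 : ℂ) ‖z‖).norm_image_sub_le_of_norm_hasDerivWithin_le
    (f := cosh) (f' := sinh)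
    (C := ‖z‖ * Real.exp ‖z‖) (x := 0) (y := z) (fun w _ => (hasDerivAt_cosh w).hasDerivWithinAt)
    (fun w hw => ?_) (by simp) (by simp)
  · rw [cosh_zero, sub_zero] at h
    linarith
  · have hw' : ‖w‖ ≤ ‖z‖ := by simpa using hw
    exact (norm_sinh_le_mul_exp w).trans (mul_le_mul hw'
      (Real.exp_le_exp.2 ((abs_re_le_norm w).trans hw')) (Real.exp_pos _).le (norm_nonneg _))

open Complex in
theorem norm_sinh_sub_self_le (z : ℂ) : ‖sinh z - z‖ ≤ ‖z‖ ^ 3 * Real.exp ‖z‖ := by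
  have h := (convex_closedBall (0 : ℂ) ‖z‖).norm_image_sub_le_of_norm_hasDerivWithin_le
    (f := fun w => sinh w - w) (f' := fun w => cosh w - 1)
    (C := ‖z‖ ^ 2 * Real.exp ‖z‖) (x := 0) (y := z)
    (fun w _ => ((hasDerivAt_sinh w).sub (hasDerivAt_id w)).hasDerivWithinAt)
    (fun w hw => ?_) (by simp) (by simp)
  · simp only [sinh_zero, sub_zero] at h
    linarith
  · have hw' : ‖w‖ ≤ ‖z‖ := by simpa using hw
    refine (norm_cosh_sub_one_le w).trans ?_
    gcongr

theorem mul_exp_le_sinh {β x : ℝ} (hx : β ≤ x) :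
    (1 - Real.exp (-2 * β)) / 2 * Real.exp x ≤ Real.sinh x := by
  rw [Real.sinh_eq]
  have : Real.exp (-x) ≤ Real.exp (-2 * β) * Real.exp x := by
    rw [← Real.exp_add]; exact Real.exp_le_exp.2 (by linarith)
  linarith

theorem sinh_mul_ne_zero {ω : ℂ} (hω : 0 < ω.re) {t : ℝ} (ht : 0 < t) :
    Complex.sinh (ω * t) ≠ 0 := by
  rw [← norm_pos_iff]
  refine lt_of_lt_of_le ?_ (sinh_re_le_norm_sinh _)
  simpa using mul_pos hω ht

/-- For `Re ω > 0`, `sinh (ω t)` grows at least like `t` near `0`. -/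
theorem mul_le_norm_sinh {ω : ℂ} (hω : 0 < ω.re) {t : ℝ} (ht : 0 < t) :
    ω.re * t ≤ ‖Complex.sinh (ω * t)‖ := by
  refine le_trans ?_ (sinh_re_le_norm_sinh _)
  have : (ω * t).re = ω.re * t := by simp
  rw [this]
  exact Real.self_le_sinh_iff.2 (mul_pos hω ht).le

/-- For `Re ω > 0`, `sinh (ω t)` grows at least like `exp (t Re ω)` for `t ≥ 1`. -/
theorem exp_le_norm_sinh {ω : ℂ} (hω : 0 < ω.re) {t : ℝ} (ht : 1 ≤ t) :
    (1 - Real.exp (-2 * ω.re)) / 2 * Real.exp (ω.re * t) ≤ ‖Complex.sinh (ω * t)‖ := by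
  refine le_trans ?_ (sinh_re_le_norm_sinh _)
  have : (ω * t).re = ω.re * t := by simp
  rw [this]
  exact mul_exp_le_sinh (le_mul_of_one_le_right hω.le ht)

theorem one_sub_exp_pos {β : ℝ} (hβ : 0 < β) : 0 < (1 - Real.exp (-2 * β)) / 2 := by
  have : Real.exp (-2 * β) < 1 := by
    simpa using Real.exp_lt_exp.2 (show -2 * β < 0 by linarith)
  linarith

/-- The majorant of the integrands on `(0, ∞)` considered below: they are bounded near `0`, and
the sum of an exponentially decreasing term and a multiple of `1 / t ^ 2` near infinity. -/
noncomputable def decay (ε t : ℝ) : ℝ := if t ≤ 1 then 1 else Real.exp (-ε * t) + 1 / t ^ 2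

open MeasureTheory Set in
theorem integrableOn_decay {ε : ℝ} (hε : 0 < ε) : IntegrableOn (decay ε) (Ioi 0) := by
  rw [← Ioc_union_Ioi_eq_Ioi (zero_le_one (α := ℝ))]
  refine IntegrableOn.union ?_ ?_
  · exact (integrableOn_const (C := (1 : ℝ)) (by simp)).congr_fun
      (fun t ht => by simp [decay, ht.2]) measurableSet_Ioc
  · have h1 : IntegrableOn (fun t : ℝ => Real.exp (-ε * t)) (Ioi 1) := exp_neg_integrableOn_Ioi 1 hε
    have h2 : IntegrableOn (fun t : ℝ => t ^ (-2 : ℝ)) (Ioi 1) :=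
      integrableOn_Ioi_rpow_of_lt (by norm_num) one_pos
    refine (h1.add h2).congr_fun (fun t ht => ?_) measurableSet_Ioi
    simp [decay, not_le.2 (mem_Ioi.1 ht)]

/-- The integrand whose integral over `(0, ∞)` is `-log (2 cos (π a / 2b))`. -/
noncomputable def coshIntegrand (b a : ℂ) (t : ℝ) : ℂ :=
  1 / (t : ℂ) * (Complex.cosh (a * t) / Complex.sinh (b * t) - 1 / (b * t))

open Complex in
theorem norm_coshIntegrand_le {b : ℂ} (hb : 0 < b.re) (ρ A : ℝ) :
    ∃ C : ℝ, ∀ a : ℂ, ‖a‖ ≤ A → |a.re| ≤ ρ → ∀ t : ℝ, 0 < t →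
      ‖coshIntegrand b a t‖ ≤ C * decay (b.re - ρ) t := by
  have hb0 : b ≠ 0 := fun h => by simp [h] at hb
  have hbn : 0 < ‖b‖ := norm_pos_iff.2 hb0
  set k := (1 - Real.exp (-2 * b.re)) / 2 with hk
  have hk0 : 0 < k := one_sub_exp_pos hb
  refine ⟨(A ^ 2 * Real.exp A + ‖b‖ ^ 2 * Real.exp ‖b‖) / b.re + (1 / k + 1 / ‖b‖), ?_⟩
  intro a ha har t ht
  have hA : 0 ≤ A := (norm_nonneg a).trans ha
  have ht0 : (t : ℂ) ≠ 0 := ofReal_ne_zero.2 ht.ne'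
  have hs := sinh_mul_ne_zero hb ht
  have hC1 : 0 ≤ (A ^ 2 * Real.exp A + ‖b‖ ^ 2 * Real.exp ‖b‖) / b.re := by positivity
  have hC2 : 0 ≤ 1 / k + 1 / ‖b‖ := by positivity
  rcases le_or_gt t 1 with h1 | h1
  · have e : coshIntegrand b a t = ((b * t) * (cosh (a * t) - 1) - (sinh (b * t) - b * t)) /
        (b * t * t * sinh (b * t)) := by
      unfold coshIntegrand
      generalize sinh (b * t) = S at hs ⊢
      field_simp
      ring
    have hat : ‖a * t‖ ≤ A * t := by
      rw [norm_mul, norm_real, Real.norm_of_nonneg ht.le]; gcongr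
    have hbt : ‖b * t‖ = ‖b‖ * t := by rw [norm_mul, norm_real, Real.norm_of_nonneg ht.le]
    have n1 : ‖cosh (a * t) - 1‖ ≤ (A * t) ^ 2 * Real.exp A := by
      refine (norm_cosh_sub_one_le _).trans ?_
      gcongr
      exact hat.trans (mul_le_of_le_one_right hA h1)
    have n2 : ‖sinh (b * t) - b * t‖ ≤ (‖b‖ * t) ^ 3 * Real.exp ‖b‖ := by
      refine (norm_sinh_sub_self_le _).trans ?_
      rw [hbt]
      gcongr
      exact mul_le_of_le_one_right hbn.le h1
    have d : ‖b‖ * t * t * (b.re * t) ≤ ‖b * t * t * sinh (b * t)‖ := by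
      rw [norm_mul, norm_mul, hbt, norm_real, Real.norm_of_nonneg ht.le]
      gcongr
      exact mul_le_norm_sinh hb ht
    rw [decay, if_pos h1, mul_one, e, norm_div]
    refine le_trans ?_ (le_add_of_nonneg_right hC2)
    calc _ ≤ ((‖b‖ * t) * ((A * t) ^ 2 * Real.exp A) + (‖b‖ * t) ^ 3 * Real.exp ‖b‖) /
          (‖b‖ * t * t * (b.re * t)) := by
          refine div_le_div₀ (by positivity) ?_ (by positivity) d
          refine (norm_sub_le _ _).trans (add_le_add ?_ n2)
          rw [norm_mul, hbt]
          gcongr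
      _ = _ := by field_simp
  · have ht1 : 1 ≤ t := h1.le
    rw [decay, if_neg (not_le.2 h1)]
    have n1 : ‖cosh (a * t)‖ ≤ Real.exp (ρ * t) := by
      refine (norm_cosh_le_exp _).trans (Real.exp_le_exp.2 ?_)
      have : (a * t).re = a.re * t := by simp
      rw [this, abs_mul, abs_of_pos ht]; gcongr
    have n2 := exp_le_norm_sinh hb ht1
    rw [← hk] at n2
    have n3 : ‖cosh (a * t) / sinh (b * t)‖ ≤ 1 / k * Real.exp (-(b.re - ρ) * t) := by
      rw [norm_div]
      calc _ ≤ Real.exp (ρ * t) / (k * Real.exp (b.re * t)) :=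
            div_le_div₀ (Real.exp_pos _).le n1 (by positivity) n2
        _ = _ := by
          have : -(b.re - ρ) * t = ρ * t - b.re * t := by ring
          rw [this, Real.exp_sub]; field_simp
    have n4 : ‖1 / (b * (t : ℂ))‖ = 1 / (‖b‖ * t) := by
      rw [norm_div, norm_one, norm_mul, norm_real, Real.norm_of_nonneg ht.le]
    have n5 : ‖1 / (t : ℂ)‖ = 1 / t := by
      rw [norm_div, norm_one, norm_real, Real.norm_of_nonneg ht.le]
    have n6 : 1 / t ≤ 1 := by rw [div_le_one ht]; exact ht1
    calc ‖coshIntegrand b a t‖ ≤ 1 / t * (1 / k * Real.exp (-(b.re - ρ) * t) + 1 / (‖b‖ * t)) := by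
          unfold coshIntegrand
          rw [norm_mul, n5]
          gcongr
          exact (norm_sub_le _ _).trans (add_le_add n3 n4.le)
      _ ≤ 1 / k * Real.exp (-(b.re - ρ) * t) + 1 / ‖b‖ * (1 / t ^ 2) := by
          rw [mul_add]
          refine add_le_add (mul_le_of_le_one_left (by positivity) n6) (le_of_eq ?_)
          field_simp
      _ ≤ (1 / k + 1 / ‖b‖) * (Real.exp (-(b.re - ρ) * t) + 1 / t ^ 2) := by
          have p1 : 0 ≤ 1 / ‖b‖ * Real.exp (-(b.re - ρ) * t) := by positivity
          have p2 : 0 ≤ 1 / k * (1 / t ^ 2) := by positivity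
          nlinarith
      _ ≤ _ := by
          have : 0 ≤ Real.exp (-(b.re - ρ) * t) + 1 / t ^ 2 := by positivity
          exact mul_le_mul_of_nonneg_right (le_add_of_nonneg_left hC1) this

open MeasureTheory Set in
theorem continuousOn_coshIntegrand {b : ℂ} (hb : 0 < b.re) (a : ℂ) :
    ContinuousOn (coshIntegrand b a) (Ioi 0) := by
  have hb0 : b ≠ 0 := fun h => by simp [h] at hb
  unfold coshIntegrand
  intro t ht
  have h1 : (t : ℂ) ≠ 0 := Complex.ofReal_ne_zero.2 (ne_of_gt ht)
  have h2 := sinh_mul_ne_zero hb ht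
  have h3 : b * (t : ℂ) ≠ 0 := mul_ne_zero hb0 h1
  apply ContinuousAt.continuousWithinAt
  fun_prop (disch := assumption)

open MeasureTheory Set in
theorem integrableOn_coshIntegrand {b a : ℂ} (hb : 0 < b.re) (ha : |a.re| < b.re) :
    IntegrableOn (coshIntegrand b a) (Ioi 0) := by
  obtain ⟨C, hC⟩ := norm_coshIntegrand_le hb |a.re| ‖a‖
  exact ((integrableOn_decay (sub_pos.2 ha)).const_mul C).mono'
    ((continuousOn_coshIntegrand hb a).aestronglyMeasurable measurableSet_Ioi)
    ((ae_restrict_mem measurableSet_Ioi).mono fun t ht => hC a le_rfl le_rfl t ht)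

/-- The integral representation of `log (2 cos (π a / 2b))`, for `|Re a| < Re b`. -/
noncomputable def logCos (b a : ℂ) : ℂ := -∫ t in Set.Ioi (0 : ℝ), coshIntegrand b a t

open MeasureTheory Set Metric in
theorem hasDerivAt_logCos_integral {b a : ℂ} (hb : 0 < b.re) (ha : |a.re| < b.re) :
    HasDerivAt (logCos b)
      (-∫ t in Ioi (0 : ℝ), Complex.sinh (a * t) / Complex.sinh (b * t)) a := by
  set r := (b.re - |a.re|) / 2 with hr
  have hr0 : 0 < r := by rw [hr]; linarith
  obtain ⟨C, hC⟩ := norm_coshIntegrand_le hb (|a.re| + r) (‖a‖ + r)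
  have hball : ∀ z ∈ ball a r, ‖z‖ ≤ ‖a‖ + r ∧ |z.re| ≤ |a.re| + r := by
    intro z hz
    have hz' : ‖z - a‖ < r := by rwa [mem_ball, dist_eq_norm] at hz
    constructor
    · have := norm_add_le a (z - a)
      rw [add_sub_cancel] at this; linarith
    · have h1 := Complex.abs_re_le_norm (z - a)
      rw [Complex.sub_re] at h1
      have h2 := abs_add_le a.re (z.re - a.re)
      rw [add_sub_cancel] at h2; linarith
  have h := hasDerivAt_integral_of_holomorphic (μ := volume.restrict (Ioi (0 : ℝ)))
    (k := fun a t => coshIntegrand b a t) (z₀ := a) hr0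
    (b := fun t => C * decay (b.re - (|a.re| + r)) t)
    ((integrableOn_decay (by rw [hr]; linarith)).const_mul C)
    (fun z _ => (continuousOn_coshIntegrand hb z).aestronglyMeasurable measurableSet_Ioi)
    ((ae_restrict_mem measurableSet_Ioi).mono fun t ht z hz =>
      hC z (hball z hz).1 (hball z hz).2 t ht)
    (ae_of_all _ fun t => by unfold coshIntegrand; fun_prop)
  have e : ∫ t in Ioi (0 : ℝ), deriv (fun z => coshIntegrand b z t) a =
      ∫ t in Ioi (0 : ℝ), Complex.sinh (a * t) / Complex.sinh (b * t) := by
    refine setIntegral_congr_fun measurableSet_Ioi fun t ht => ?_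
    have ht0 : (t : ℂ) ≠ 0 := Complex.ofReal_ne_zero.2 (ne_of_gt ht)
    have hs := sinh_mul_ne_zero hb ht
    have h1 : HasDerivAt (fun z : ℂ => Complex.cosh (z * t)) (Complex.sinh (a * t) * (1 * t)) a :=
      ((hasDerivAt_id a).mul_const (t : ℂ)).ccosh
    have h2 := ((h1.div_const (Complex.sinh (b * t))).sub_const (1 / (b * t))).const_mul (1 / (t : ℂ))
    refine h2.deriv.trans ?_
    field_simp
  rw [e] at h
  exact h.neg

/-! ### The logarithm of the cosine in closed form -/

open Complex in
/-- `|Re a| < Re b` excludes the poles of `tan (π a / 2b)`. -/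
theorem cos_pi_mul_div_ne_zero {b a : ℂ} (ha : |a.re| < b.re) :
    cos (Real.pi * a / (2 * b)) ≠ 0 := by
  have hb : 0 < b.re := (abs_nonneg _).trans_lt ha
  have hb0 : b ≠ 0 := fun h => by simp [h] at hb
  intro h
  obtain ⟨k, hk⟩ := cos_eq_zero_iff.1 h
  have hpi : (Real.pi : ℂ) ≠ 0 := ofReal_ne_zero.2 Real.pi_ne_zero
  have e : a = ((2 * k + 1 : ℤ) : ℂ) * b := by
    field_simp at hk
    push_cast
    linear_combination hk
  have e2 : a.re = ((2 * k + 1 : ℤ) : ℝ) * b.re := by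
    rw [e]; simp
  rw [e2, abs_mul, abs_of_pos hb] at ha
  have h1 : |((2 * k + 1 : ℤ) : ℝ)| < 1 := by
    by_contra h1
    exact absurd ha (not_lt.2 (le_mul_of_one_le_left hb.le (not_lt.1 h1)))
  rw [← Int.cast_abs] at h1
  have h2 : |2 * k + 1| < 1 := by exact_mod_cast h1
  have := Int.abs_lt_one_iff.1 h2
  omega

open MeasureTheory Set Complex Filter Topology in
/-- Expansion of `1 / sinh (b t)` in a geometric series, integration term by term, and the partial
fraction expansion of the cotangent. -/
theorem integral_sinh_div_sinh {b a : ℂ} (ha : |a.re| < b.re) :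
    ∫ t in Ioi (0 : ℝ), sinh (a * t) / sinh (b * t) =
      Real.pi / (2 * b) * (sin (Real.pi * a / (2 * b)) / cos (Real.pi * a / (2 * b))) := by
  have hb : 0 < b.re := (abs_nonneg _).trans_lt ha
  have hb0 : b ≠ 0 := fun h => by simp [h] at hb
  set F : ℕ → ℝ → ℂ := fun k t => exp ((a - (2 * k + 1) * b) * t) - exp ((-a - (2 * k + 1) * b) * t)
    with hF
  have hFe : ∀ k t, F k t = 2 * sinh (a * t) * exp (-((2 * k + 1) * b * t)) := fun k t => by
    have p1 : (a - (2 * k + 1) * b) * t = a * t + -((2 * k + 1) * b * t) := by ring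
    have p2 : (-a - (2 * k + 1) * b) * t = -(a * t) + -((2 * k + 1) * b * t) := by ring
    simp only [hF]
    rw [p1, p2, exp_add, exp_add, sinh]
    ring
  have hre : ∀ k : ℕ, ((2 * k + 1) * b : ℂ).re = (2 * k + 1) * b.re := fun k => by
    have : ((2 * k + 1 : ℂ)) = ((2 * k + 1 : ℝ) : ℂ) := by push_cast; ring
    rw [this, re_ofReal_mul]
  have hlow : ∀ k : ℕ, (k + 1) * (b.re - |a.re|) ≤ (2 * k + 1) * b.re - |a.re| := fun k => by
    have : (0 : ℝ) ≤ k := Nat.cast_nonneg k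
    nlinarith [abs_nonneg a.re]
  have hpos : ∀ k : ℕ, 0 < (2 * k + 1) * b.re - |a.re| := fun k =>
    lt_of_lt_of_le (mul_pos (by positivity) (sub_pos.2 ha)) (hlow k)
  have hr1 : ∀ k : ℕ, (a - (2 * k + 1) * b).re < 0 := fun k => by
    rw [sub_re, hre]; linarith [hpos k, le_abs_self a.re]
  have hr2 : ∀ k : ℕ, (-a - (2 * k + 1) * b).re < 0 := fun k => by
    rw [sub_re, hre, neg_re]; linarith [hpos k, neg_abs_le a.re]
  have hi1 := fun k : ℕ => integrableOn_exp_mul_complex_Ioi (hr1 k) 0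
  have hi2 := fun k : ℕ => integrableOn_exp_mul_complex_Ioi (hr2 k) 0
  have hFi : ∀ k, IntegrableOn (F k) (Ioi 0) := fun k => (hi1 k).sub (hi2 k)
  have hFint : ∀ k, ∫ t in Ioi (0 : ℝ), F k t =
      -1 / (a - (2 * k + 1) * b) - -1 / (-a - (2 * k + 1) * b) := fun k => by
    simp only [hF]
    rw [integral_sub (hi1 k) (hi2 k), integral_exp_mul_complex_Ioi (hr1 k),
      integral_exp_mul_complex_Ioi (hr2 k)]
    simp
  have hFn : ∀ k : ℕ, ∫ t in Ioi (0 : ℝ), ‖F k t‖ ≤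
      2 * ‖a‖ / (b.re - |a.re|) ^ 2 * (1 / ((k : ℝ) + 1) ^ 2) := by
    intro k
    have h1 : ∀ t ∈ Ioi (0 : ℝ), ‖F k t‖ ≤
        2 * ‖a‖ * (t ^ ((2 : ℝ) - 1) * Real.exp (-(((2 * k + 1) * b.re - |a.re|) * t))) := by
      intro t ht
      have ht' : (0 : ℝ) < t := ht
      rw [hFe, norm_mul, norm_mul, norm_exp, neg_re]
      have e1 : ((2 * k + 1) * b * (t : ℂ)).re = (2 * k + 1) * b.re * t := by
        rw [re_mul_ofReal, hre]
      have e2 := norm_sinh_le_mul_exp (a * t)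
      have e3 : (a * (t : ℂ)).re = a.re * t := by simp
      rw [e3, abs_mul, abs_of_pos ht', norm_mul, norm_real, Real.norm_of_nonneg ht'.le] at e2
      have e4 : Real.exp (-(((2 * k + 1) * b.re - |a.re|) * t)) =
          Real.exp (|a.re| * t) * Real.exp (-((2 * k + 1) * b.re * t)) := by
        rw [← Real.exp_add]; congr 1; ring
      have e5 : t ^ ((2 : ℝ) - 1) = t := by norm_num
      have e6 : ‖(2 : ℂ)‖ = 2 := by simp
      rw [e1, e4, e5, e6]
      calc _ ≤ 2 * (‖a‖ * t * Real.exp (|a.re| * t)) * Real.exp (-((2 * k + 1) * b.re * t)) := by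
            gcongr
        _ = _ := by ring
    have hI : IntegrableOn (fun t : ℝ => t ^ ((2 : ℝ) - 1) *
        Real.exp (-(((2 * k + 1) * b.re - |a.re|) * t))) (Ioi 0) := by
      have := integrableOn_rpow_mul_exp_neg_mul_rpow (s := 2 - 1) (p := 1) (by norm_num) one_pos
        (hpos k)
      simpa only [Real.rpow_one, neg_mul] using this
    refine (setIntegral_mono_on (hFi k).norm (hI.const_mul _) measurableSet_Ioi h1).trans ?_
    rw [integral_const_mul, Real.integral_rpow_mul_exp_neg_mul_Ioi two_pos (hpos k)]
    rw [Real.Gamma_two, mul_one, Real.rpow_two]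
    have h0 : 0 < ((k : ℝ) + 1) * (b.re - |a.re|) := mul_pos (by positivity) (sub_pos.2 ha)
    calc _ ≤ 2 * ‖a‖ * (1 / (((k : ℝ) + 1) * (b.re - |a.re|))) ^ 2 := by
          have := hlow k
          have := hpos k
          gcongr
      _ = _ := by
          have := (sub_pos.2 ha).ne'
          field_simp
  have hsum : Summable fun k : ℕ => ∫ t in Ioi (0 : ℝ), ‖F k t‖ := by
    refine Summable.of_nonneg_of_le (fun k => integral_nonneg fun t => norm_nonneg _) hFn ?_
    refine Summable.mul_left _ ?_
    have := (summable_nat_add_iff 1).2 (Real.summable_one_div_nat_pow.2 one_lt_two)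
    simpa using this
  have hS := hasSum_integral_of_summable_integral_norm (fun k => hFi k) hsum
  have hlim : ∫ t in Ioi (0 : ℝ), (∑' k, F k t) =
      ∫ t in Ioi (0 : ℝ), sinh (a * t) / sinh (b * t) := by
    refine setIntegral_congr_fun measurableSet_Ioi fun t ht => ?_
    have ht' : (0 : ℝ) < t := ht
    have hq : ‖exp (-(2 * (b * t)))‖ < 1 := by
      rw [norm_exp, Real.exp_lt_one_iff]
      have : (-(2 * (b * (t : ℂ)))).re = -(2 * (b.re * t)) := by simp
      rw [this]
      have := mul_pos hb ht'
      linarith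
    have hg := (hasSum_geometric_of_norm_lt_one hq).mul_left (2 * sinh (a * t) * exp (-(b * t)))
    have e : (fun k : ℕ => 2 * sinh (a * t) * exp (-(b * t)) * exp (-(2 * (b * t))) ^ k) =
        fun k => F k t := by
      ext k
      rw [hFe, ← exp_nat_mul, mul_assoc, ← exp_add]
      congr 2; ring
    rw [e] at hg
    change ∑' k, F k t = _
    rw [hg.tsum_eq]
    have h1 : 1 - exp (-(2 * (b * t))) = 2 * exp (-(b * t)) * sinh (b * t) := by
      have e1 : exp (-(2 * (b * (t : ℂ)))) = exp (-(b * t)) * exp (-(b * t)) := by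
        rw [← exp_add]; congr 1; ring
      have e2 : (1 : ℂ) = exp (-(b * t)) * exp (b * t) := by rw [← exp_add]; simp
      rw [sinh, e1]; linear_combination e2
    have h2 := sinh_mul_ne_zero hb ht'
    have h3 := exp_ne_zero (-(b * t))
    rw [h1]
    field_simp
  rw [hlim] at hS
  -- comparison with the expansion of the cotangent at `x = (a / b + 1) / 2`
  set x : ℂ := (a / b + 1) / 2 with hx
  have hxre : ∀ m : ℤ, x ≠ m := by
    intro m hm
    have e : a = ((2 * m - 1 : ℤ) : ℂ) * b := by
      rw [hx] at hm; field_simp at hm; push_cast; linear_combination hm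
    refine cos_pi_mul_div_ne_zero ha ?_
    rw [e, cos_eq_zero_iff]
    refine ⟨m - 1, ?_⟩
    field_simp
    push_cast; ring
  have hxI : x ∈ integerComplement := by
    rw [mem_integerComplement_iff]
    rintro ⟨m, hm⟩
    exact hxre m hm.symm
  have hx0 : ∀ k : ℕ, x + k ≠ 0 := fun k h => hxre (-k) (by push_cast; linear_combination h)
  have hx1 : ∀ k : ℕ, x - (k + 1) ≠ 0 := fun k h => hxre (k + 1) (by push_cast; linear_combination h)
  have hpart : ∀ N : ℕ, ∑ k ∈ Finset.range N, (∫ t in Ioi (0 : ℝ), F k t) =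
      -(1 / (2 * b)) * ((∑ k ∈ Finset.range N, (1 / (x - (k + 1)) + 1 / (x + (k + 1)))) + 1 / x -
        1 / (x + N)) := by
    intro N
    induction N with
    | zero => simp
    | succ N ih =>
      rw [Finset.sum_range_succ, Finset.sum_range_succ, ih, hFint]
      have q1 : a - (2 * N + 1) * b = 2 * b * (x - (N + 1)) := by
        rw [hx]; field_simp; ring
      have q2 : -a - (2 * N + 1) * b = -(2 * b * (x + N)) := by
        rw [hx]; field_simp; ring
      rw [q1, q2]
      have q3 := hx0 N
      have q4 := hx1 N
      have q5 := hx0 (N + 1)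
      push_cast at q5 ⊢
      rw [← add_assoc] at q5 ⊢
      rw [div_neg]
      field_simp
      ring
  have hT := hS.tendsto_sum_nat
  simp_rw [hpart] at hT
  have hcot := tendsto_logDeriv_euler_cot_sub hxI
  have hinv : Tendsto (fun N : ℕ => 1 / (x + N)) atTop (𝓝 0) := by
    have h1 : Tendsto (fun N : ℕ => ‖x + N‖) atTop atTop := by
      refine tendsto_atTop_mono (fun N => ?_)
        (tendsto_atTop_add_const_right _ (-‖x‖) tendsto_natCast_atTop_atTop)
      have h := norm_sub_norm_le (N : ℂ) (-x)
      rw [norm_neg, Complex.norm_natCast, sub_neg_eq_add, add_comm (N : ℂ)] at h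
      linarith
    simpa [one_div, Function.comp_def] using (tendsto_inv₀_cobounded.comp (tendsto_norm_atTop_iff_cobounded.1 h1))
  have hT2 := ((hcot.add_const (1 / x)).sub hinv).const_mul (-(1 / (2 * b)))
  rw [tendsto_nhds_unique hT hT2]
  have e1 : (Real.pi : ℂ) * x = Real.pi * a / (2 * b) + Real.pi / 2 := by
    rw [hx]; field_simp
  rw [cot_eq_cos_div_sin, e1, sin_add_pi_div_two, cos_add_pi_div_two]
  have := cos_pi_mul_div_ne_zero ha
  field_simp
  ring

open Complex in
theorem hasDerivAt_logCos {b a : ℂ} (ha : |a.re| < b.re) :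
    HasDerivAt (logCos b)
      (-(Real.pi / (2 * b) * (sin (Real.pi * a / (2 * b)) / cos (Real.pi * a / (2 * b))))) a := by
  rw [← integral_sinh_div_sinh ha]
  exact hasDerivAt_logCos_integral ((abs_nonneg _).trans_lt ha) ha

theorem isOpen_abs_re_lt (r : ℝ) : IsOpen {a : ℂ | |a.re| < r} :=
  isOpen_lt (by fun_prop) continuous_const

theorem isPreconnected_abs_re_lt (r : ℝ) : IsPreconnected {a : ℂ | |a.re| < r} := by
  have e : {a : ℂ | |a.re| < r} = Complex.re ⁻¹' Set.Ioo (-r) r := by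
    ext a; exact abs_lt (a := a.re) (b := r)
  rw [e]
  exact ((convex_Ioo (-r) r).is_linear_preimage ⟨Complex.add_re, by simp⟩).isPreconnected

open Complex in
theorem hasDerivAt_cos_pi_mul_div (b a : ℂ) :
    HasDerivAt (fun a => cos (Real.pi * a / (2 * b)))
      (-sin (Real.pi * a / (2 * b)) * (Real.pi / (2 * b))) a := by
  have h : HasDerivAt (fun a : ℂ => Real.pi * a / (2 * b)) (Real.pi * 1 / (2 * b)) a :=
    ((hasDerivAt_id a).const_mul (Real.pi : ℂ)).div_const (2 * b)
  rw [mul_one] at h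
  exact h.ccos

open MeasureTheory Set Complex in
/-- The doubling relation, a consequence of `2 cosh (b t / 2) / sinh (b t) = 1 / sinh (b t / 2)`. -/
theorem logCos_zero_eq {b : ℂ} (hb : 0 < b.re) : logCos b 0 = 2 * logCos b (b / 2) := by
  have h := integral_comp_mul_left_Ioi (coshIntegrand b 0) 0 (b := 1 / 2) (by norm_num)
  rw [mul_zero] at h
  have e : ∫ x in Ioi (0 : ℝ), coshIntegrand b 0 (1 / 2 * x) =
      ∫ x in Ioi (0 : ℝ), 4 * coshIntegrand b (b / 2) x := by
    refine setIntegral_congr_fun measurableSet_Ioi fun t ht => ?_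
    have ht' : (0 : ℝ) < t := ht
    have hb0 : b ≠ 0 := fun h => by simp [h] at hb
    have ht0 : (t : ℂ) ≠ 0 := ofReal_ne_zero.2 ht'.ne'
    have hs2 : sinh (b * t) = 2 * sinh (b * t / 2) * cosh (b * t / 2) := by
      rw [← sinh_two_mul]; congr 1; ring
    have hs := sinh_mul_ne_zero hb ht'
    have hs1 : sinh (b * t / 2) ≠ 0 := fun h0 => hs (by rw [hs2, h0]; ring)
    have hs3 : cosh (b * t / 2) ≠ 0 := fun h0 => hs (by rw [hs2, h0]; ring)
    have a1 : b * ((1 / 2 * t : ℝ) : ℂ) = b * t / 2 := by push_cast; ring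
    have a2 : b / 2 * (t : ℂ) = b * t / 2 := by ring
    simp only [coshIntegrand]
    rw [hs2, a1, a2, zero_mul, cosh_zero]
    push_cast
    generalize sinh (b * t / 2) = S at *
    generalize cosh (b * t / 2) = T at *
    field_simp
    ring
  rw [e, integral_const_mul] at h
  unfold logCos
  have h2 : (4 : ℂ) * ∫ x in Ioi (0 : ℝ), coshIntegrand b (b / 2) x =
      2 * ∫ x in Ioi (0 : ℝ), coshIntegrand b 0 x := by
    rw [h]
    rw [Complex.real_smul]
    norm_num
  linear_combination (1 / 2 : ℂ) * h2

open Complex in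
/-- `logCos b a` is a logarithm of `2 cos (π a / 2b)`. -/
theorem exp_logCos {b a : ℂ} (ha : |a.re| < b.re) :
    exp (logCos b a) = 2 * cos (Real.pi * a / (2 * b)) := by
  have hb : 0 < b.re := (abs_nonneg _).trans_lt ha
  have hb0 : b ≠ 0 := fun h => by simp [h] at hb
  let H : ℂ → ℂ := fun a => exp (logCos b a) / cos (Real.pi * a / (2 * b))
  have hd : ∀ a ∈ {a : ℂ | |a.re| < b.re}, HasDerivAt H 0 a := by
    intro a ha
    have h := (hasDerivAt_logCos ha).cexp.div (hasDerivAt_cos_pi_mul_div b a)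
      (cos_pi_mul_div_ne_zero ha)
    have h0 := cos_pi_mul_div_ne_zero ha
    refine HasDerivAt.congr_deriv (f := H) h ?_
    rw [div_eq_zero_iff]
    left
    generalize cos (Real.pi * a / (2 * b)) = c at *
    field_simp
    ring
  have hconst : ∀ a ∈ {a : ℂ | |a.re| < b.re}, H a = H 0 := by
    intro a ha
    exact (isOpen_abs_re_lt b.re).is_const_of_deriv_eq_zero (isPreconnected_abs_re_lt b.re)
      (fun z hz => (hd z hz).differentiableAt.differentiableWithinAt)
      (fun z hz => (hd z hz).deriv) ha (by simpa using hb)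
  have hE : ∀ a : ℂ, |a.re| < b.re → exp (logCos b a) = H 0 * cos (Real.pi * a / (2 * b)) := by
    intro a ha
    rw [← hconst a ha]
    simp only [H]
    rw [div_mul_cancel₀ _ (cos_pi_mul_div_ne_zero ha)]
  -- the constant is determined by the doubling relation
  have hC0 : H 0 ≠ 0 := by simp [H, exp_ne_zero]
  have h1 := hE 0 (by simpa using hb)
  have hb2 : |(b / 2).re| < b.re := by
    have : (b / 2).re = b.re / 2 := by simp
    rw [this, abs_of_pos (by linarith)]; linarith
  have h2 := hE (b / 2) hb2
  rw [logCos_zero_eq hb, two_mul, exp_add, h2] at h1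
  have h3 : cos (Real.pi * (b / 2) / (2 * b)) ^ 2 = 1 / 2 := by
    have : (Real.pi * (b / 2) / (2 * b) : ℂ) = ((Real.pi / 4 : ℝ) : ℂ) := by
      push_cast; field_simp; ring
    rw [this, ← ofReal_cos, Real.cos_pi_div_four, ← ofReal_pow, div_pow, Real.sq_sqrt zero_le_two]
    push_cast; norm_num
  rw [mul_zero, zero_div, cos_zero, mul_one] at h1
  have h4 : H 0 = 2 := by
    apply mul_left_cancel₀ hC0
    linear_combination 2 * h1 - 2 * (H 0) ^ 2 * h3
  rw [hE a ha, h4]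

theorem re_cosh_ge {z : ℂ} {y₀ : ℝ} (hy : |z.im| ≤ y₀) (hy₀ : y₀ < Real.pi / 2) :
    Real.cos y₀ / 2 * Real.exp |z.re| ≤ (Complex.cosh z).re := by
  have e : (Complex.cosh z).re = Real.cosh z.re * Real.cos z.im := by
    conv_lhs => rw [← Complex.re_add_im z, Complex.cosh_add, Complex.cosh_mul_I, Complex.sinh_mul_I]
    simp [Complex.cos_ofReal_re]
  have h0 : 0 ≤ Real.cos y₀ := Real.cos_nonneg_of_mem_Icc
    ⟨by linarith [abs_nonneg z.im, Real.pi_pos], hy₀.le⟩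
  have h1 : Real.cos y₀ ≤ Real.cos z.im := by
    rw [← Real.cos_abs z.im]
    exact Real.cos_le_cos_of_nonneg_of_le_pi (abs_nonneg _) (by linarith [Real.pi_pos]) hy
  have h2 : Real.exp |z.re| / 2 ≤ Real.cosh z.re := by
    rw [← Real.cosh_abs, Real.cosh_eq]
    have := Real.exp_pos (-|z.re|)
    linarith
  rw [e]
  calc _ = Real.exp |z.re| / 2 * Real.cos y₀ := by ring
    _ ≤ _ := mul_le_mul h2 h1 h0 (Real.cosh_pos _).le

open Complex in
/-- For real `b`, the logarithm `logCos b (2iw)` of `2 cosh (π w / b)` is `π |Re w| / b` up to a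
bounded function, on the strips `|Im w| ≤ c < b / 2`. -/
theorem exists_logCos_bound {b c : ℝ} (hb : 0 < b) (hc : 2 * c < b) :
    ∃ C : ℝ, ∀ w : ℂ, |w.im| ≤ c → |(logCos b (2 * I * w)).im| ≤ C ∧
      |(logCos b (2 * I * w)).re - Real.pi / b * (|w.re|)| ≤ C := by
  have hre : ∀ a : ℂ, (Real.pi * a / (2 * b) : ℂ) = ((Real.pi / (2 * b) : ℝ) : ℂ) * a := fun a => by
    push_cast; ring
  have hy : ∀ c' : ℝ, 2 * c' < b → Real.pi / b * c' < Real.pi / 2 := fun c' h => by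
    rw [div_mul_eq_mul_div, div_lt_div_iff₀ hb two_pos]
    nlinarith [Real.pi_pos]
  have hcosh : ∀ w : ℂ, cos (Real.pi * (2 * I * w) / (2 * b)) = cosh ((Real.pi / b : ℝ) * w) := by
    intro w
    have hb0 : (b : ℂ) ≠ 0 := ofReal_ne_zero.2 hb.ne'
    rw [← cos_mul_I]
    congr 1
    push_cast
    field_simp
  have him : ∀ w : ℂ, (((Real.pi / b : ℝ) : ℂ) * w).im = Real.pi / b * w.im := fun w => by simp
  have hre' : ∀ w : ℂ, (((Real.pi / b : ℝ) : ℂ) * w).re = Real.pi / b * w.re := fun w => by simp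
  have hpb : 0 < Real.pi / b := div_pos Real.pi_pos hb
  have hslit : ∀ w : ℂ, 2 * |w.im| < b → 0 < (cosh ((Real.pi / b : ℝ) * w)).re := by
    intro w hw
    have h := re_cosh_ge (z := (Real.pi / b : ℝ) * w) (y₀ := Real.pi / b * |w.im|)
      (by rw [him, abs_mul, abs_of_pos hpb]) (hy _ hw)
    refine lt_of_lt_of_le (mul_pos (half_pos (Real.cos_pos_of_mem_Ioo ⟨?_, hy _ hw⟩))
      (Real.exp_pos _)) h
    have : 0 ≤ Real.pi / b * |w.im| := by positivity
    linarith [Real.pi_pos]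
  -- `logCos b` and the principal logarithm of the cosine differ by a constant
  have hconst : ∀ a ∈ {a : ℂ | |a.re| < b}, logCos b a - log (cos (Real.pi * a / (2 * b))) =
      logCos b 0 - log (cos (Real.pi * 0 / (2 * b))) := by
    have hd : ∀ a ∈ {a : ℂ | |a.re| < b},
        HasDerivAt (fun a => logCos b a - log (cos (Real.pi * a / (2 * b)))) 0 a := by
      intro a ha
      have ha' : |a.re| < (b : ℂ).re := by simpa using ha
      have hsl : cos (Real.pi * a / (2 * b)) ∈ slitPlane := by
        have e : a = 2 * I * (-I / 2 * a) := by
          have := I_mul_I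
          linear_combination a * this
        rw [e, hcosh]
        refine Or.inl (hslit _ ?_)
        have : (-I / 2 * a).im = -(a.re / 2) := by simp; ring
        rw [this, abs_neg, abs_div, abs_two]
        have := ha
        simp only [Set.mem_ofPred_eq] at this
        linarith
      have h := (hasDerivAt_logCos ha').sub ((hasDerivAt_cos_pi_mul_div b a).clog hsl)
      have h0 := cos_pi_mul_div_ne_zero ha'
      refine HasDerivAt.congr_deriv
        (f := fun a => logCos b a - log (cos (Real.pi * a / (2 * b)))) h ?_
      generalize cos (Real.pi * a / (2 * b)) = c at *
      field_simp
      ring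
    intro a ha
    exact (isOpen_abs_re_lt b).is_const_of_deriv_eq_zero (isPreconnected_abs_re_lt b)
      (fun z hz => (hd z hz).differentiableAt.differentiableWithinAt)
      (fun z hz => (hd z hz).deriv) ha (by simpa using hb)
  set c₀ := logCos b 0 - log (cos (Real.pi * 0 / (2 * b))) with hc₀
  have hcosc : 0 < Real.cos (Real.pi / b * c) / 2 ∨ c < 0 := by
    rcases le_or_gt 0 c with h | h
    · refine Or.inl (half_pos (Real.cos_pos_of_mem_Ioo ⟨?_, hy c hc⟩))
      have : 0 ≤ Real.pi / b * c := by positivity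
      linarith [Real.pi_pos]
    · exact Or.inr h
  refine ⟨‖c₀‖ + Real.pi + |Real.log (Real.cos (Real.pi / b * c) / 2)|, fun w hw => ?_⟩
  have hw2 : 2 * |w.im| < b := by linarith
  have hcos : 0 < Real.cos (Real.pi / b * c) / 2 :=
    hcosc.resolve_right (not_lt.2 ((abs_nonneg _).trans hw))
  have e : logCos b (2 * I * w) = c₀ + log (cosh ((Real.pi / b : ℝ) * w)) := by
    have h := hconst (2 * I * w) (by simpa [abs_mul] using hw2)
    rw [hcosh] at h
    linear_combination h
  have hL : 0 ≤ |Real.log (Real.cos (Real.pi / b * c) / 2)| := abs_nonneg _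
  rw [e, add_im, add_re, log_im, log_re]
  constructor
  · have h1 := abs_add_le c₀.im (arg (cosh ((Real.pi / b : ℝ) * w)))
    have h2 := abs_im_le_norm c₀
    have h3 := abs_arg_le_pi (cosh ((Real.pi / b : ℝ) * w))
    linarith
  · have h1 := re_cosh_ge (z := (Real.pi / b : ℝ) * w) (y₀ := Real.pi / b * c)
      (by rw [him, abs_mul, abs_of_pos hpb]; gcongr) (hy c hc)
    have h2 := h1.trans ((le_abs_self _).trans (abs_re_le_norm _))
    have h3 := norm_cosh_le_exp ((Real.pi / b : ℝ) * w)
    rw [hre', abs_mul, abs_of_pos hpb] at h2 h3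
    have hn : 0 < ‖cosh ((Real.pi / b : ℝ) * w)‖ := lt_of_lt_of_le (by positivity) h2
    have h4 := Real.log_le_log (by positivity) h2
    have h5 := Real.log_le_log hn h3
    rw [Real.log_exp] at h5
    rw [Real.log_mul hcos.ne' (Real.exp_pos _).ne', Real.log_exp] at h4
    have h6 := abs_re_le_norm c₀
    have h7 := abs_le.1 h6
    have h8 := neg_abs_le (Real.log (Real.cos (Real.pi / b * c) / 2))
    rw [abs_le]
    constructor <;> linarith [Real.pi_pos]

/-! ### The logarithm of the double sine function -/

/-- The integrand of the integral representation of the logarithm of the double sine function, as a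
function of `a = 2 z - ω₁ - ω₂`. -/
noncomputable def doubleSineIntegrand (ω₁ ω₂ a : ℂ) (t : ℝ) : ℂ :=
  1 / (2 * (t : ℂ)) *
    (Complex.sinh (a * t) / (Complex.sinh (ω₁ * t) * Complex.sinh (ω₂ * t)) - a / (ω₁ * ω₂ * t))

/-- The integral representation of `log S₂(z)` in the strip `|Re a| < Re (ω₁ + ω₂)`, as a
function of `a = 2 z - ω₁ - ω₂`. -/
noncomputable def logDoubleSine (ω₁ ω₂ a : ℂ) : ℂ :=
  ∫ t in Set.Ioi (0 : ℝ), doubleSineIntegrand ω₁ ω₂ a t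

open Complex in
theorem norm_sinh_mul_sinh_sub_le (ω₁ ω₂ : ℂ) :
    ∃ C : ℝ, 0 ≤ C ∧ ∀ t : ℝ, 0 < t → t ≤ 1 →
      ‖sinh (ω₁ * t) * sinh (ω₂ * t) - ω₁ * t * (ω₂ * t)‖ ≤ C * t ^ 4 := by
  refine ⟨‖ω₁‖ ^ 3 * Real.exp ‖ω₁‖ * (‖ω₂‖ * Real.exp ‖ω₂‖) +
    ‖ω₁‖ * (‖ω₂‖ ^ 3 * Real.exp ‖ω₂‖), by positivity, fun t ht h1 => ?_⟩
  have hn : ∀ ω : ℂ, ‖ω * t‖ = ‖ω‖ * t := fun ω => by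
    rw [norm_mul, norm_real, Real.norm_of_nonneg ht.le]
  have hle : ∀ ω : ℂ, ‖ω‖ * t ≤ ‖ω‖ := fun ω => mul_le_of_le_one_right (norm_nonneg _) h1
  have n1 : ∀ ω : ℂ, ‖sinh (ω * t) - ω * t‖ ≤ (‖ω‖ * t) ^ 3 * Real.exp ‖ω‖ := fun ω => by
    refine (norm_sinh_sub_self_le _).trans ?_
    rw [hn]; gcongr; exact hle ω
  have n2 : ∀ ω : ℂ, ‖sinh (ω * t)‖ ≤ ‖ω‖ * t * Real.exp ‖ω‖ := fun ω => by
    refine (norm_sinh_le_mul_exp _).trans ?_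
    rw [hn]; gcongr
    exact ((abs_re_le_norm _).trans (hn ω).le).trans (hle ω)
  have e : sinh (ω₁ * t) * sinh (ω₂ * t) - ω₁ * t * (ω₂ * t) =
      (sinh (ω₁ * t) - ω₁ * t) * sinh (ω₂ * t) + ω₁ * t * (sinh (ω₂ * t) - ω₂ * t) := by ring
  rw [e]
  calc _ ≤ (‖ω₁‖ * t) ^ 3 * Real.exp ‖ω₁‖ * (‖ω₂‖ * t * Real.exp ‖ω₂‖) +
        ‖ω₁‖ * t * ((‖ω₂‖ * t) ^ 3 * Real.exp ‖ω₂‖) := by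
        refine (norm_add_le _ _).trans (add_le_add ?_ ?_)
        · rw [norm_mul]
          exact mul_le_mul (n1 ω₁) (n2 ω₂) (norm_nonneg _) (by positivity)
        · rw [norm_mul, hn]
          exact mul_le_mul_of_nonneg_left (n1 ω₂) (by positivity)
    _ = _ := by ring

open Complex in
theorem norm_doubleSineIntegrand_le_of_le_one {ω₁ ω₂ : ℂ} (hω₁ : 0 < ω₁.re) (hω₂ : 0 < ω₂.re)
    (A : ℝ) : ∃ C : ℝ, 0 ≤ C ∧ ∀ a : ℂ, ‖a‖ ≤ A → ∀ t : ℝ, 0 < t → t ≤ 1 →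
      ‖doubleSineIntegrand ω₁ ω₂ a t‖ ≤ C := by
  obtain ⟨D, hD0, hD⟩ := norm_sinh_mul_sinh_sub_le ω₁ ω₂
  have h₁ := Complex.ne_zero_of_re_pos hω₁
  have h₂ := Complex.ne_zero_of_re_pos hω₂
  have hn₁ := norm_pos_iff.2 h₁
  have hn₂ := norm_pos_iff.2 h₂
  rcases lt_or_ge A 0 with hA | hA
  · exact ⟨0, le_rfl, fun a ha => absurd (ha.trans_lt hA) (norm_nonneg a).not_gt⟩
  refine ⟨(‖ω₁‖ * ‖ω₂‖ * (A ^ 3 * Real.exp A) + A * D) /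
    (2 * (‖ω₁‖ * ‖ω₂‖ * (ω₁.re * ω₂.re))), by positivity, fun a ha t ht h1 => ?_⟩
  have ht0 : (t : ℂ) ≠ 0 := ofReal_ne_zero.2 ht.ne'
  have s₁ := sinh_mul_ne_zero hω₁ ht
  have s₂ := sinh_mul_ne_zero hω₂ ht
  have nt : ‖(t : ℂ)‖ = t := by rw [norm_real, Real.norm_of_nonneg ht.le]
  have hat : ‖a * t‖ ≤ A * t := by
    rw [norm_mul, nt]; gcongr
  have n1 : ‖sinh (a * t) - a * t‖ ≤ (A * t) ^ 3 * Real.exp A := by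
    refine (norm_sinh_sub_self_le _).trans ?_
    gcongr
    exact hat.trans (mul_le_of_le_one_right hA h1)
  have e : doubleSineIntegrand ω₁ ω₂ a t =
      (ω₁ * ω₂ * t * (sinh (a * t) - a * t) -
        a * (sinh (ω₁ * t) * sinh (ω₂ * t) - ω₁ * t * (ω₂ * t))) /
      (2 * (ω₁ * ω₂ * t * t * (sinh (ω₁ * t) * sinh (ω₂ * t)))) := by
    unfold doubleSineIntegrand
    generalize sinh (ω₁ * t) = S at *
    generalize sinh (ω₂ * t) = T at *
    field_simp
    ring
  have d : 2 * (‖ω₁‖ * ‖ω₂‖ * t * t * ((ω₁.re * t) * (ω₂.re * t))) ≤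
      ‖2 * (ω₁ * ω₂ * t * t * (sinh (ω₁ * t) * sinh (ω₂ * t)))‖ := by
    have e2 : ‖(2 : ℂ)‖ = 2 := by simp
    simp only [norm_mul, nt, e2]
    gcongr
    · exact mul_le_norm_sinh hω₁ ht
    · exact mul_le_norm_sinh hω₂ ht
  rw [e, norm_div]
  calc _ ≤ (‖ω₁‖ * ‖ω₂‖ * t * ((A * t) ^ 3 * Real.exp A) + A * (D * t ^ 4)) /
        (2 * (‖ω₁‖ * ‖ω₂‖ * t * t * ((ω₁.re * t) * (ω₂.re * t)))) := by
        refine div_le_div₀ (by positivity) ?_ (by positivity) d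
        refine (norm_sub_le _ _).trans (add_le_add ?_ ?_)
        · rw [norm_mul, norm_mul, norm_mul, nt]; gcongr
        · rw [norm_mul]
          exact mul_le_mul ha (hD t ht h1) (norm_nonneg _) hA
    _ = _ := by field_simp

open Complex in
theorem norm_sinh_div_sinh_mul_sinh_le {ω₁ ω₂ : ℂ} (hω₁ : 0 < ω₁.re) (hω₂ : 0 < ω₂.re) :
    ∃ k : ℝ, 0 < k ∧ ∀ a : ℂ, ∀ t : ℝ, 1 ≤ t →
      ‖sinh (a * t) / (sinh (ω₁ * t) * sinh (ω₂ * t))‖ ≤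
        1 / k * Real.exp (-((ω₁ + ω₂).re - |a.re|) * t) := by
  set k₁ := (1 - Real.exp (-2 * ω₁.re)) / 2 with hk₁
  set k₂ := (1 - Real.exp (-2 * ω₂.re)) / 2 with hk₂
  have hk₁0 : 0 < k₁ := one_sub_exp_pos hω₁
  have hk₂0 : 0 < k₂ := one_sub_exp_pos hω₂
  refine ⟨k₁ * k₂, by positivity, fun a t ht => ?_⟩
  have ht0 : 0 < t := one_pos.trans_le ht
  have n1 : ‖sinh (a * t)‖ ≤ Real.exp (|a.re| * t) := by
    refine (norm_sinh_le_exp _).trans (Real.exp_le_exp.2 (le_of_eq ?_))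
    have : (a * t).re = a.re * t := by simp
    rw [this, abs_mul, abs_of_pos ht0]
  have n2 := exp_le_norm_sinh hω₁ ht
  have n3 := exp_le_norm_sinh hω₂ ht
  rw [← hk₁] at n2
  rw [← hk₂] at n3
  rw [norm_div, norm_mul]
  calc _ ≤ Real.exp (|a.re| * t) / (k₁ * Real.exp (ω₁.re * t) * (k₂ * Real.exp (ω₂.re * t))) := by
        refine div_le_div₀ (Real.exp_pos _).le n1 (by positivity) ?_
        exact mul_le_mul n2 n3 (by positivity) (norm_nonneg _)
    _ = _ := by
        have : -((ω₁ + ω₂).re - |a.re|) * t = |a.re| * t - (ω₁.re * t + ω₂.re * t) := by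
          rw [add_re]; ring
        rw [this, Real.exp_sub, Real.exp_add]; field_simp

open Complex in
theorem norm_doubleSineIntegrand_le {ω₁ ω₂ : ℂ} (hω₁ : 0 < ω₁.re) (hω₂ : 0 < ω₂.re)
    (ρ A : ℝ) : ∃ C : ℝ, ∀ a : ℂ, ‖a‖ ≤ A → |a.re| ≤ ρ → ∀ t : ℝ, 0 < t →
      ‖doubleSineIntegrand ω₁ ω₂ a t‖ ≤ C * decay ((ω₁ + ω₂).re - ρ) t := by
  obtain ⟨C, hC0, hC⟩ := norm_doubleSineIntegrand_le_of_le_one hω₁ hω₂ A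
  obtain ⟨k, hk0, hk⟩ := norm_sinh_div_sinh_mul_sinh_le hω₁ hω₂
  have hn : 0 < ‖ω₁ * ω₂‖ :=
    norm_pos_iff.2 (mul_ne_zero (Complex.ne_zero_of_re_pos hω₁) (Complex.ne_zero_of_re_pos hω₂))
  rcases lt_or_ge A 0 with hA | hA
  · exact ⟨0, fun a ha => absurd (ha.trans_lt hA) (norm_nonneg a).not_gt⟩
  refine ⟨C + (1 / k + A / ‖ω₁ * ω₂‖), fun a ha har t ht => ?_⟩
  have hC2 : 0 ≤ 1 / k + A / ‖ω₁ * ω₂‖ := by positivity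
  have nt : ‖(t : ℂ)‖ = t := by rw [norm_real, Real.norm_of_nonneg ht.le]
  rcases le_or_gt t 1 with h1 | h1
  · rw [decay, if_pos h1, mul_one]
    exact (hC a ha t ht h1).trans (le_add_of_nonneg_right hC2)
  · rw [decay, if_neg (not_le.2 h1)]
    have n3 : ‖sinh (a * t) / (sinh (ω₁ * t) * sinh (ω₂ * t))‖ ≤
        1 / k * Real.exp (-((ω₁ + ω₂).re - ρ) * t) := by
      refine (hk a t h1.le).trans ?_
      gcongr
    have n4 : ‖a / (ω₁ * ω₂ * (t : ℂ))‖ ≤ A / (‖ω₁ * ω₂‖ * t) := by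
      rw [norm_div, norm_mul _ (t : ℂ), nt]
      gcongr
    have n5 : ‖1 / (2 * (t : ℂ))‖ = 1 / (2 * t) := by
      rw [norm_div, norm_one, norm_mul, nt]; simp
    have n6 : 1 / (2 * t) ≤ 1 / t := by
      apply one_div_le_one_div_of_le ht; linarith
    have n7 : 1 / t ≤ 1 := by rw [div_le_one ht]; exact h1.le
    calc ‖doubleSineIntegrand ω₁ ω₂ a t‖ ≤
          1 / t * (1 / k * Real.exp (-((ω₁ + ω₂).re - ρ) * t) + A / (‖ω₁ * ω₂‖ * t)) := by
          unfold doubleSineIntegrand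
          rw [norm_mul, n5]
          exact mul_le_mul n6 ((norm_sub_le _ _).trans (add_le_add n3 n4)) (norm_nonneg _)
            (by positivity)
      _ ≤ 1 / k * Real.exp (-((ω₁ + ω₂).re - ρ) * t) + A / ‖ω₁ * ω₂‖ * (1 / t ^ 2) := by
          rw [mul_add]
          refine add_le_add (mul_le_of_le_one_left (by positivity) n7) (le_of_eq ?_)
          field_simp
      _ ≤ (1 / k + A / ‖ω₁ * ω₂‖) * (Real.exp (-((ω₁ + ω₂).re - ρ) * t) + 1 / t ^ 2) := by
          have p1 : 0 ≤ A / ‖ω₁ * ω₂‖ * Real.exp (-((ω₁ + ω₂).re - ρ) * t) := by positivity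
          have p2 : 0 ≤ 1 / k * (1 / t ^ 2) := by positivity
          nlinarith
      _ ≤ _ := by
          have : 0 ≤ Real.exp (-((ω₁ + ω₂).re - ρ) * t) + 1 / t ^ 2 := by positivity
          exact mul_le_mul_of_nonneg_right (le_add_of_nonneg_left hC0) this

open Set in
theorem continuousOn_doubleSineIntegrand {ω₁ ω₂ : ℂ} (hω₁ : 0 < ω₁.re) (hω₂ : 0 < ω₂.re) (a : ℂ) :
    ContinuousOn (doubleSineIntegrand ω₁ ω₂ a) (Ioi 0) := by
  have h₁ := Complex.ne_zero_of_re_pos hω₁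
  have h₂ := Complex.ne_zero_of_re_pos hω₂
  unfold doubleSineIntegrand
  intro t ht
  have ht0 : (t : ℂ) ≠ 0 := Complex.ofReal_ne_zero.2 (ne_of_gt ht)
  have d1 : 2 * (t : ℂ) ≠ 0 := mul_ne_zero two_ne_zero ht0
  have d2 := mul_ne_zero (sinh_mul_ne_zero hω₁ ht) (sinh_mul_ne_zero hω₂ ht)
  have d3 : ω₁ * ω₂ * (t : ℂ) ≠ 0 := mul_ne_zero (mul_ne_zero h₁ h₂) ht0
  apply ContinuousAt.continuousWithinAt
  fun_prop (disch := assumption)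

open MeasureTheory Set in
theorem integrableOn_doubleSineIntegrand {ω₁ ω₂ a : ℂ} (hω₁ : 0 < ω₁.re) (hω₂ : 0 < ω₂.re)
    (ha : |a.re| < (ω₁ + ω₂).re) : IntegrableOn (doubleSineIntegrand ω₁ ω₂ a) (Ioi 0) := by
  obtain ⟨C, hC⟩ := norm_doubleSineIntegrand_le hω₁ hω₂ |a.re| ‖a‖
  exact ((integrableOn_decay (sub_pos.2 ha)).const_mul C).mono'
    ((continuousOn_doubleSineIntegrand hω₁ hω₂ a).aestronglyMeasurable measurableSet_Ioi)
    ((ae_restrict_mem measurableSet_Ioi).mono fun t ht => hC a le_rfl le_rfl t ht)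

open MeasureTheory Set Metric in
theorem differentiableAt_logDoubleSine {ω₁ ω₂ a : ℂ} (hω₁ : 0 < ω₁.re) (hω₂ : 0 < ω₂.re)
    (ha : |a.re| < (ω₁ + ω₂).re) : DifferentiableAt ℂ (logDoubleSine ω₁ ω₂) a := by
  set r := ((ω₁ + ω₂).re - |a.re|) / 2 with hr
  have hr0 : 0 < r := by rw [hr]; linarith
  obtain ⟨C, hC⟩ := norm_doubleSineIntegrand_le hω₁ hω₂ (|a.re| + r) (‖a‖ + r)
  have hball : ∀ z ∈ ball a r, ‖z‖ ≤ ‖a‖ + r ∧ |z.re| ≤ |a.re| + r := by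
    intro z hz
    have hz' : ‖z - a‖ < r := by rwa [mem_ball, dist_eq_norm] at hz
    constructor
    · have := norm_add_le a (z - a)
      rw [add_sub_cancel] at this; linarith
    · have h1 := Complex.abs_re_le_norm (z - a)
      rw [Complex.sub_re] at h1
      have h2 := abs_add_le a.re (z.re - a.re)
      rw [add_sub_cancel] at h2; linarith
  exact (hasDerivAt_integral_of_holomorphic (μ := volume.restrict (Ioi (0 : ℝ)))
    (k := fun a t => doubleSineIntegrand ω₁ ω₂ a t) (z₀ := a) hr0
    (b := fun t => C * decay ((ω₁ + ω₂).re - (|a.re| + r)) t)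
    ((integrableOn_decay (by rw [hr]; linarith)).const_mul C)
    (fun z _ => (continuousOn_doubleSineIntegrand hω₁ hω₂ z).aestronglyMeasurable
      measurableSet_Ioi)
    ((ae_restrict_mem measurableSet_Ioi).mono fun t ht z hz =>
      hC z (hball z hz).1 (hball z hz).2 t ht)
    (ae_of_all _ fun t => by unfold doubleSineIntegrand; fun_prop)).differentiableAt

open MeasureTheory Set Complex in
/-- The difference equation of the double sine function, in logarithmic form. -/
theorem logDoubleSine_sub_eq_logCos {ω₁ ω₂ a : ℂ} (hω₁ : 0 < ω₁.re) (ha : |a.re| < ω₂.re) :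
    logDoubleSine ω₁ ω₂ (a - ω₁) - logDoubleSine ω₁ ω₂ (a + ω₁) = logCos ω₂ a := by
  have hω₂ : 0 < ω₂.re := (abs_nonneg _).trans_lt ha
  have h₁ := Complex.ne_zero_of_re_pos hω₁
  have h₂ := Complex.ne_zero_of_re_pos hω₂
  have b1 : |(a - ω₁).re| < (ω₁ + ω₂).re := by
    rw [abs_lt] at ha ⊢
    simp only [sub_re, add_re]; constructor <;> linarith
  have b2 : |(a + ω₁).re| < (ω₁ + ω₂).re := by
    rw [abs_lt] at ha ⊢
    simp only [add_re]; constructor <;> linarith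
  unfold logDoubleSine logCos
  rw [← integral_sub (integrableOn_doubleSineIntegrand hω₁ hω₂ b1)
    (integrableOn_doubleSineIntegrand hω₁ hω₂ b2), ← integral_neg]
  refine setIntegral_congr_fun measurableSet_Ioi fun t ht => ?_
  have ht0 : (t : ℂ) ≠ 0 := ofReal_ne_zero.2 (ne_of_gt ht)
  have s₁ := sinh_mul_ne_zero hω₁ ht
  have s₂ := sinh_mul_ne_zero hω₂ ht
  simp only [doubleSineIntegrand, coshIntegrand]
  rw [sub_mul, add_mul, sinh_sub, sinh_add]
  generalize sinh (ω₁ * t) = S at *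
  generalize sinh (ω₂ * t) = T at *
  field_simp
  ring

open MeasureTheory Set Complex in
/-- The growth of a product `S₂(z₁) S₂(z₂)` when `z₁ + z₂` is fixed, in terms of
`a = z₁ + z₂ - ω₁ - ω₂` and of the difference `2iw = z₁ - z₂`: the logarithm of its modulus is
`-π Re (a / (ω₁ ω₂)) |Re w|` up to a bounded function. The integrand
`t⁻¹ (sinh (at) cos (2wt) / (sinh (ω₁t) sinh (ω₂t)) - a / (ω₁ω₂t))` is compared with a multiple of
the one for `log (2 cosh (π w / b))`, `b = Re (ω₁ + ω₂)`, with the same behaviour at `t = 0`. -/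
theorem exists_logDoubleSine_bound {ω₁ ω₂ a : ℂ} (hω₁ : 0 < ω₁.re) (hω₂ : 0 < ω₂.re) {c : ℝ}
    (hac : |a.re| + 2 * c < (ω₁ + ω₂).re) :
    ∃ C : ℝ, ∀ w : ℂ, |w.im| ≤ c →
      |(logDoubleSine ω₁ ω₂ (a + 2 * I * w) + logDoubleSine ω₁ ω₂ (a - 2 * I * w)).re +
        Real.pi * (a / (ω₁ * ω₂)).re * (|w.re|)| ≤ C := by
  have h₁ := Complex.ne_zero_of_re_pos hω₁
  have h₂ := Complex.ne_zero_of_re_pos hω₂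
  set b : ℝ := (ω₁ + ω₂).re with hb
  have hb0 : 0 < b := by rw [hb, add_re]; linarith
  have hbc : (b : ℂ) ≠ 0 := ofReal_ne_zero.2 hb0.ne'
  have hbre : 0 < (b : ℂ).re := by simpa using hb0
  set γ : ℂ := a / (ω₁ * ω₂) with hγ
  set T : ℝ → ℂ := fun t => 2 * doubleSineIntegrand ω₁ ω₂ a t - γ * b * coshIntegrand b 0 t with hT
  have hTc : ContinuousOn T (Ioi 0) :=
    (continuousOn_const.mul (continuousOn_doubleSineIntegrand hω₁ hω₂ a)).sub
      (continuousOn_const.mul (continuousOn_coshIntegrand hbre 0))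
  have hTe : ∀ t : ℝ, 0 < t → T t = 1 / (t : ℂ) *
      (sinh (a * t) / (sinh (ω₁ * t) * sinh (ω₂ * t)) - γ * b * (1 / sinh (b * t))) := by
    intro t ht
    have ht0 : (t : ℂ) ≠ 0 := ofReal_ne_zero.2 ht.ne'
    have s₁ := sinh_mul_ne_zero hω₁ ht
    have s₂ := sinh_mul_ne_zero hω₂ ht
    have s₃ := sinh_mul_ne_zero hbre ht
    simp only [hT, doubleSineIntegrand, coshIntegrand, zero_mul, cosh_zero]
    rw [hγ]
    generalize sinh (ω₁ * t) = S at *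
    generalize sinh (ω₂ * t) = S' at *
    generalize sinh (b * t) = S'' at *
    field_simp
    ring
  -- the difference of the integrands decreases fast enough to be multiplied by `exp (2 c t)`
  have hTb : IntegrableOn (fun t => Real.exp (2 * c * t) * ‖T t‖) (Ioi 0) := by
    obtain ⟨C₁, hC₁0, hC₁⟩ := norm_doubleSineIntegrand_le_of_le_one hω₁ hω₂ ‖a‖
    obtain ⟨C₂, hC₂⟩ := norm_coshIntegrand_le hbre 0 0
    obtain ⟨k, hk0, hk⟩ := norm_sinh_div_sinh_mul_sinh_le hω₁ hω₂
    set k' := (1 - Real.exp (-2 * b)) / 2 with hk'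
    have hk'0 : 0 < k' := one_sub_exp_pos hb0
    set ε := b - |a.re| - 2 * c with hε
    have hε0 : 0 < ε := by rw [hε]; linarith
    have hd : ∀ t : ℝ, 0 < t → Real.exp (2 * c * t) * ‖T t‖ ≤
        (Real.exp (2 * |c|) * (2 * C₁ + ‖γ * b‖ * |C₂|) + (1 / k + ‖γ * b‖ / k')) * decay ε t := by
      intro t ht
      have p1 : 0 ≤ Real.exp (2 * |c|) * (2 * C₁ + ‖γ * b‖ * |C₂|) := by positivity
      have p2 : 0 ≤ 1 / k + ‖γ * b‖ / k' := by positivity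
      rcases le_or_gt t 1 with h1 | h1
      · rw [decay, if_pos h1, mul_one]
        refine le_trans ?_ (le_add_of_nonneg_right p2)
        have q1 : 2 * c * t ≤ 2 * |c| := by
          have : c * t ≤ |c| * 1 := mul_le_mul (le_abs_self c) h1 ht.le (abs_nonneg c)
          linarith
        have q2 := hC₂ 0 (by simp) (by simp) t ht
        rw [decay, if_pos h1, mul_one] at q2
        have q3 : ‖T t‖ ≤ 2 * C₁ + ‖γ * b‖ * |C₂| := by
          refine (norm_sub_le _ _).trans (add_le_add ?_ ?_)
          · rw [norm_mul]
            have : ‖(2 : ℂ)‖ = 2 := by simp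
            rw [this]
            linarith [hC₁ a le_rfl t ht h1]
          · rw [norm_mul]
            exact mul_le_mul_of_nonneg_left (q2.trans (le_abs_self _)) (norm_nonneg _)
        exact mul_le_mul (Real.exp_le_exp.2 q1) q3 (norm_nonneg _) (Real.exp_pos _).le
      · rw [decay, if_neg (not_le.2 h1)]
        have q1 := hk a t h1.le
        have q2 := exp_le_norm_sinh hbre h1.le
        rw [ofReal_re, ← hk'] at q2
        have q3 : ‖γ * b * (1 / sinh (b * t))‖ ≤ ‖γ * b‖ / k' * Real.exp (-(b - |a.re|) * t) := by
          rw [norm_mul, norm_div, norm_one]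
          calc _ ≤ ‖γ * b‖ * (1 / (k' * Real.exp (b * t))) := by gcongr
            _ = ‖γ * b‖ / k' * Real.exp (-(b * t)) := by rw [Real.exp_neg]; field_simp
            _ ≤ _ := by
              gcongr
              nlinarith [abs_nonneg a.re]
        have q4 : ‖T t‖ ≤ (1 / k + ‖γ * b‖ / k') * Real.exp (-(b - |a.re|) * t) := by
          rw [hTe t ht, norm_mul]
          have : ‖1 / (t : ℂ)‖ ≤ 1 := by
            rw [norm_div, norm_one, norm_real, Real.norm_of_nonneg ht.le, div_le_one ht]
            exact h1.le
          refine (mul_le_of_le_one_left (norm_nonneg _) this).trans ?_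
          rw [add_mul]
          exact (norm_sub_le _ _).trans (add_le_add q1 q3)
        calc _ ≤ Real.exp (2 * c * t) *
              ((1 / k + ‖γ * b‖ / k') * Real.exp (-(b - |a.re|) * t)) := by gcongr
          _ = (1 / k + ‖γ * b‖ / k') * Real.exp (-ε * t) := by
              have : -ε * t = 2 * c * t + -(b - |a.re|) * t := by rw [hε]; ring
              rw [this, Real.exp_add]; ring
          _ ≤ _ := by
              apply mul_le_mul (le_add_of_nonneg_left p1) _ (Real.exp_pos _).le (by positivity)
              exact le_add_of_nonneg_right (by positivity)
    refine ((integrableOn_decay hε0).const_mul (Real.exp (2 * |c|) * (2 * C₁ + ‖γ * b‖ * |C₂|) +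
      (1 / k + ‖γ * b‖ / k'))).mono'
      (((Continuous.continuousOn (by fun_prop)).mul hTc.norm).aestronglyMeasurable
        measurableSet_Ioi)
      ((ae_restrict_mem measurableSet_Ioi).mono fun t ht => ?_)
    rw [Real.norm_of_nonneg (by positivity)]
    exact hd t ht
  have hcb : 2 * c < b := by linarith [abs_nonneg a.re]
  obtain ⟨C, hC⟩ := exists_logCos_bound hb0 hcb
  refine ⟨(∫ t in Ioi (0 : ℝ), Real.exp (2 * c * t) * ‖T t‖) + b * |γ.re| * C + b * |γ.im| * C,
    fun w hw => ?_⟩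
  have hre : (2 * I * w).re = -2 * w.im := by simp
  have b1 : |(a + 2 * I * w).re| < (ω₁ + ω₂).re := by
    rw [add_re, hre]
    refine lt_of_le_of_lt (abs_add_le _ _) ?_
    rw [abs_mul, abs_neg, abs_two]; linarith
  have b2 : |(a - 2 * I * w).re| < (ω₁ + ω₂).re := by
    rw [sub_re, hre]
    refine lt_of_le_of_lt (abs_sub _ _) ?_
    rw [abs_mul, abs_neg, abs_two]; linarith
  have b3 : |(2 * I * w).re| < (b : ℂ).re := by
    rw [hre, abs_mul, ofReal_re]; norm_num; linarith
  have i1 := integrableOn_doubleSineIntegrand hω₁ hω₂ b1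
  have i2 := integrableOn_doubleSineIntegrand hω₁ hω₂ b2
  have i3 := integrableOn_coshIntegrand hbre b3
  have hpt : ∀ t ∈ Ioi (0 : ℝ), cosh (2 * I * w * t) * T t =
      doubleSineIntegrand ω₁ ω₂ (a + 2 * I * w) t + doubleSineIntegrand ω₁ ω₂ (a - 2 * I * w) t -
        γ * b * coshIntegrand b (2 * I * w) t := by
    intro t ht
    have ht' : (0 : ℝ) < t := ht
    have ht0 : (t : ℂ) ≠ 0 := ofReal_ne_zero.2 ht'.ne'
    have s₁ := sinh_mul_ne_zero hω₁ ht
    have s₂ := sinh_mul_ne_zero hω₂ ht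
    have s₃ := sinh_mul_ne_zero hbre ht
    rw [hTe t ht]
    simp only [doubleSineIntegrand, coshIntegrand]
    rw [add_mul, sub_mul, sinh_add, sinh_sub, hγ]
    generalize sinh (ω₁ * t) = S at *
    generalize sinh (ω₂ * t) = S' at *
    generalize sinh (b * t) = S'' at *
    field_simp
    ring
  have hI : ∫ t in Ioi (0 : ℝ), cosh (2 * I * w * t) * T t =
      logDoubleSine ω₁ ω₂ (a + 2 * I * w) + logDoubleSine ω₁ ω₂ (a - 2 * I * w) +
        γ * b * logCos b (2 * I * w) := by
    have i12 : IntegrableOn (fun t => doubleSineIntegrand ω₁ ω₂ (a + 2 * I * w) t +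
      doubleSineIntegrand ω₁ ω₂ (a - 2 * I * w) t) (Ioi 0) := i1.add i2
    rw [setIntegral_congr_fun measurableSet_Ioi hpt, integral_sub i12 (i3.const_mul _),
      integral_add i1 i2, integral_const_mul]
    unfold logDoubleSine logCos
    ring
  have hB : ‖∫ t in Ioi (0 : ℝ), cosh (2 * I * w * t) * T t‖ ≤
      ∫ t in Ioi (0 : ℝ), Real.exp (2 * c * t) * ‖T t‖ := by
    refine norm_integral_le_of_norm_le hTb ((ae_restrict_mem measurableSet_Ioi).mono fun t ht => ?_)
    have ht' : (0 : ℝ) < t := ht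
    rw [norm_mul]
    gcongr
    refine (norm_cosh_le_exp _).trans (Real.exp_le_exp.2 ?_)
    rw [re_mul_ofReal, hre, abs_mul, abs_of_pos ht', abs_mul]
    norm_num
    nlinarith
  have hsum : (logDoubleSine ω₁ ω₂ (a + 2 * I * w) + logDoubleSine ω₁ ω₂ (a - 2 * I * w)).re =
      (∫ t in Ioi (0 : ℝ), cosh (2 * I * w * t) * T t).re -
        b * (γ.re * (logCos b (2 * I * w)).re - γ.im * (logCos b (2 * I * w)).im) := by
    rw [hI, add_re (_ + _)]
    have : γ * b * logCos b (2 * I * w) = ((b : ℝ) : ℂ) * (γ * logCos b (2 * I * w)) := by ring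
    rw [this, re_ofReal_mul, mul_re]
    ring
  obtain ⟨hC1, hC2⟩ := hC w hw
  rw [hsum]
  set N := logCos b (2 * I * w)
  have e : (∫ t in Ioi (0 : ℝ), cosh (2 * I * w * t) * T t).re -
      b * (γ.re * N.re - γ.im * N.im) + Real.pi * γ.re * |w.re| =
      (∫ t in Ioi (0 : ℝ), cosh (2 * I * w * t) * T t).re +
        (-(b * γ.re * (N.re - Real.pi / b * |w.re|)) + b * γ.im * N.im) := by
    field_simp
    ring
  rw [e]
  have r1 := (abs_re_le_norm (∫ t in Ioi (0 : ℝ), cosh (2 * I * w * t) * T t)).trans hB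
  have r2 : |-(b * γ.re * (N.re - Real.pi / b * |w.re|))| ≤ b * |γ.re| * C := by
    rw [abs_neg, abs_mul, abs_mul, abs_of_pos hb0]
    gcongr
  have r3 : |b * γ.im * N.im| ≤ b * |γ.im| * C := by
    rw [abs_mul, abs_mul, abs_of_pos hb0]
    gcongr
  have r4 := abs_add_le (∫ t in Ioi (0 : ℝ), cosh (2 * I * w * t) * T t).re
    (-(b * γ.re * (N.re - Real.pi / b * |w.re|)) + b * γ.im * N.im)
  have r5 := abs_add_le (-(b * γ.re * (N.re - Real.pi / b * |w.re|))) (b * γ.im * N.im)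
  linarith

/-! ### The double sine function and the functions `μ` and `K` -/

namespace RuijsenaarsBaxter

open Complex

theorem doubleSineStrip_eq_exp (ω₁ ω₂ z : ℂ) :
    doubleSineStrip ω₁ ω₂ z = exp (logDoubleSine ω₁ ω₂ (2 * z - ω₁ - ω₂)) := rfl

theorem doubleSine_of_mem_strip {ω₁ ω₂ z : ℂ} (h0 : 0 < z.re) (h1 : z.re < (ω₁ + ω₂).re) :
    doubleSine ω₁ ω₂ z = doubleSineStrip ω₁ ω₂ z := by
  have : stripIndex ω₁ ω₂ z = 0 := if_pos ⟨h0, h1⟩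
  simp [doubleSine, this]

theorem abs_re_lt_of_mem_strip {ω₁ ω₂ z : ℂ} (h0 : 0 < z.re) (h1 : z.re < (ω₁ + ω₂).re) :
    |(2 * z - ω₁ - ω₂).re| < (ω₁ + ω₂).re := by
  have : (2 * z - ω₁ - ω₂).re = 2 * z.re - ω₁.re - ω₂.re := by simp
  rw [add_re] at *
  rw [this, abs_lt]; constructor <;> linarith

/-- The double sine function in the strip `-Re ω₁ < Re z < Re ω₂`, which extends beyond the strip
of the integral representation. -/
theorem doubleSine_eq_sin_mul_strip {ω₁ ω₂ z : ℂ} (hω₁ : 0 < ω₁.re) (hω₂ : 0 < ω₂.re)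
    (h0 : -ω₁.re < z.re) (h1 : z.re < ω₂.re) :
    doubleSine ω₁ ω₂ z = 2 * sin (Real.pi * z / ω₂) * doubleSineStrip ω₁ ω₂ (z + ω₁) := by
  rcases le_or_gt z.re 0 with hz | hz
  · have hm : stripIndex ω₁ ω₂ z = -1 := by
      rw [stripIndex, if_neg (fun h => absurd h.1 (not_lt.2 hz))]
      have : ⌈z.re / ω₁.re⌉ = 0 := by
        rw [Int.ceil_eq_zero_iff]
        refine ⟨?_, div_nonpos_of_nonpos_of_nonneg hz hω₁.le⟩
        rw [lt_div_iff₀ hω₁]; linarith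
      rw [this]; norm_num
    simp [doubleSine, hm, mul_comm]
  · have hz' : z.re < (ω₁ + ω₂).re := by rw [add_re]; linarith
    rw [doubleSine_of_mem_strip hz hz', doubleSineStrip_eq_exp, doubleSineStrip_eq_exp]
    have ha : |(2 * z - ω₂).re| < ω₂.re := by
      have : (2 * z - ω₂).re = 2 * z.re - ω₂.re := by simp
      rw [this, abs_lt]; constructor <;> linarith
    have h := logDoubleSine_sub_eq_logCos hω₁ ha
    have e1 : 2 * z - ω₁ - ω₂ = 2 * z - ω₂ - ω₁ := by ring
    have e2 : 2 * (z + ω₁) - ω₁ - ω₂ = 2 * z - ω₂ + ω₁ := by ring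
    have e3 : Real.pi * (2 * z - ω₂) / (2 * ω₂) = Real.pi * z / ω₂ - Real.pi / 2 := by
      have := Complex.ne_zero_of_re_pos hω₂
      field_simp
    rw [e1, e2, sub_eq_iff_eq_add.1 h, exp_add, exp_logCos ha, e3, cos_sub_pi_div_two]

/-- The difference equation of the double sine function. -/
theorem doubleSine_eq_sin_mul {ω₁ ω₂ z : ℂ} (hω₁ : 0 < ω₁.re) (hω₂ : 0 < ω₂.re)
    (h0 : -ω₁.re < z.re) (h1 : z.re < ω₂.re) :
    doubleSine ω₁ ω₂ z = 2 * sin (Real.pi * z / ω₂) * doubleSine ω₁ ω₂ (z + ω₁) := by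
  rw [doubleSine_eq_sin_mul_strip hω₁ hω₂ h0 h1, doubleSine_of_mem_strip (z := z + ω₁)]
  · rw [add_re]; linarith
  · rw [add_re, add_re]; linarith

theorem doubleSine_ne_zero {ω₁ ω₂ z : ℂ} (h0 : 0 < z.re) (h1 : z.re < (ω₁ + ω₂).re) :
    doubleSine ω₁ ω₂ z ≠ 0 := by
  rw [doubleSine_of_mem_strip h0 h1]; exact exp_ne_zero _

theorem differentiableAt_doubleSineStrip {ω₁ ω₂ z : ℂ} (hω₁ : 0 < ω₁.re) (hω₂ : 0 < ω₂.re)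
    (h0 : 0 < z.re) (h1 : z.re < (ω₁ + ω₂).re) : DifferentiableAt ℂ (doubleSineStrip ω₁ ω₂) z := by
  have h := differentiableAt_logDoubleSine hω₁ hω₂ (abs_re_lt_of_mem_strip h0 h1)
  exact (DifferentiableAt.comp (f := fun z => 2 * z - ω₁ - ω₂) z h (by fun_prop)).cexp

theorem differentiableAt_doubleSine {ω₁ ω₂ z : ℂ} (hω₁ : 0 < ω₁.re) (hω₂ : 0 < ω₂.re)
    (h0 : -ω₁.re < z.re) (h1 : z.re < (ω₁ + ω₂).re) : DifferentiableAt ℂ (doubleSine ω₁ ω₂) z := by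
  rcases lt_or_ge 0 z.re with hz | hz
  · refine (differentiableAt_doubleSineStrip hω₁ hω₂ hz h1).congr_of_eventuallyEq ?_
    filter_upwards [(isOpen_lt continuous_const continuous_re).mem_nhds hz,
      (isOpen_lt continuous_re continuous_const).mem_nhds h1] with w hw1 hw2
    exact doubleSine_of_mem_strip hw1 hw2
  · have hd : DifferentiableAt ℂ (fun z => 2 * sin (Real.pi * z / ω₂) *
        doubleSineStrip ω₁ ω₂ (z + ω₁)) z := by
      refine DifferentiableAt.mul (by fun_prop) ?_
      refine DifferentiableAt.comp (f := fun z => z + ω₁) z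
        (differentiableAt_doubleSineStrip hω₁ hω₂ ?_ ?_) (by fun_prop)
      · rw [add_re]; linarith
      · rw [add_re, add_re]; linarith
    refine hd.congr_of_eventuallyEq ?_
    filter_upwards [(isOpen_lt continuous_const continuous_re).mem_nhds h0,
      (isOpen_lt continuous_re continuous_const).mem_nhds (hz.trans_lt hω₂)] with w hw1 hw2
    exact doubleSine_eq_sin_mul_strip hω₁ hω₂ hw1 hw2

theorem exp_mul_abs_le {κ R a b : ℝ} (h : |a - b| ≤ R) :
    Real.exp (κ * |a|) ≤ Real.exp (|κ| * R) * Real.exp (κ * |b|) := by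
  rw [← Real.exp_add]
  refine Real.exp_le_exp.2 ?_
  have h1 : |(|a| - |b|)| ≤ R := (abs_abs_sub_abs_le a b).trans h
  have h2 : κ * (|a| - |b|) ≤ |κ| * R := by
    refine (le_abs_self _).trans ?_
    rw [abs_mul]; gcongr
  linarith

theorem kernelK_re_pos {ω₁ ω₂ g z : ℂ} (hz : 2 * |z.im| < (ω₁ + ω₂ - g).re) :
    0 < (I * z + dualCoupling ω₁ ω₂ g / 2).re ∧ 0 < (-(I * z) + dualCoupling ω₁ ω₂ g / 2).re := by
  have e1 : (I * z + dualCoupling ω₁ ω₂ g / 2).re = -z.im + (ω₁ + ω₂ - g).re / 2 := by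
    simp [dualCoupling]
  have e2 : (-(I * z) + dualCoupling ω₁ ω₂ g / 2).re = z.im + (ω₁ + ω₂ - g).re / 2 := by
    simp [dualCoupling]
  rw [e1, e2]
  constructor
  · linarith [le_abs_self z.im]
  · linarith [neg_abs_le z.im]

theorem kernelK_re_lt {ω₁ ω₂ g z : ℂ} (hg : 0 < g.re) (hz : 2 * |z.im| < (ω₁ + ω₂ - g).re) :
    (I * z + dualCoupling ω₁ ω₂ g / 2).re < (ω₁ + ω₂).re ∧
      (-(I * z) + dualCoupling ω₁ ω₂ g / 2).re < (ω₁ + ω₂).re := by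
  have e1 : (I * z + dualCoupling ω₁ ω₂ g / 2).re = -z.im + (ω₁ + ω₂ - g).re / 2 := by
    simp [dualCoupling]
  have e2 : (-(I * z) + dualCoupling ω₁ ω₂ g / 2).re = z.im + (ω₁ + ω₂ - g).re / 2 := by
    simp [dualCoupling]
  rw [e1, e2]
  rw [sub_re] at *
  constructor
  · linarith [neg_abs_le z.im]
  · linarith [le_abs_self z.im]

theorem differentiableAt_kernelK {ω₁ ω₂ g z : ℂ} (hω₁ : 0 < ω₁.re) (hω₂ : 0 < ω₂.re)
    (hg : 0 < g.re) (hz : 2 * |z.im| < (ω₁ + ω₂ - g).re) :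
    DifferentiableAt ℂ (kernelK ω₁ ω₂ g) z := by
  obtain ⟨p1, p2⟩ := kernelK_re_pos hz
  obtain ⟨q1, q2⟩ := kernelK_re_lt hg hz
  refine DifferentiableAt.mul (DifferentiableAt.inv ?_ (doubleSine_ne_zero p1 q1))
    (DifferentiableAt.inv ?_ (doubleSine_ne_zero p2 q2))
  · exact DifferentiableAt.comp (f := fun z => I * z + dualCoupling ω₁ ω₂ g / 2) z
      (differentiableAt_doubleSine hω₁ hω₂ (by linarith) q1) (by fun_prop)
  · exact DifferentiableAt.comp (f := fun z => -(I * z) + dualCoupling ω₁ ω₂ g / 2) z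
      (differentiableAt_doubleSine hω₁ hω₂ (by linarith) q2) (by fun_prop)

theorem exists_norm_kernelK_le {ω₁ ω₂ g : ℂ} (hω₁ : 0 < ω₁.re) (hω₂ : 0 < ω₂.re)
    (hg : 0 < g.re) {c : ℝ} (hc : 2 * c < (ω₁ + ω₂ - g).re) :
    ∃ C : ℝ, 0 < C ∧ ∀ z : ℂ, |z.im| ≤ c →
      ‖kernelK ω₁ ω₂ g z‖ ≤ C * Real.exp (-(Real.pi * (g / (ω₁ * ω₂)).re) * |z.re|) := by
  obtain ⟨C, hC⟩ := exists_logDoubleSine_bound (a := -g) hω₁ hω₂ (c := c)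
    (by rw [neg_re, abs_neg, abs_of_pos hg]; rw [sub_re] at hc; linarith)
  refine ⟨Real.exp C, Real.exp_pos _, fun z hz => ?_⟩
  have hz' : 2 * |z.im| < (ω₁ + ω₂ - g).re := by linarith
  obtain ⟨p1, p2⟩ := kernelK_re_pos hz'
  obtain ⟨q1, q2⟩ := kernelK_re_lt hg hz'
  have e1 : 2 * (I * z + dualCoupling ω₁ ω₂ g / 2) - ω₁ - ω₂ = -g + 2 * I * z := by
    rw [dualCoupling]; ring
  have e2 : 2 * (-(I * z) + dualCoupling ω₁ ω₂ g / 2) - ω₁ - ω₂ = -g - 2 * I * z := by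
    rw [dualCoupling]; ring
  have h := hC z hz
  rw [neg_div, neg_re, abs_le] at h
  rw [kernelK, doubleSine_of_mem_strip p1 q1, doubleSine_of_mem_strip p2 q2,
    doubleSineStrip_eq_exp, doubleSineStrip_eq_exp, e1, e2, ← mul_inv, ← exp_add, ← exp_neg,
    norm_exp, neg_re, ← Real.exp_add]
  refine Real.exp_le_exp.2 ?_
  linarith [h.1]

theorem differentiableAt_mu {ω₁ ω₂ g v : ℂ} (hω₁ : 0 < ω₁.re) (hω₂ : 0 < ω₂.re)
    (hg : 0 < g.re) (hgω : g.re < ω₂.re) (h0 : -ω₁.re ≤ v.im) (h1 : v.im ≤ 0) :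
    DifferentiableAt ℂ (mu ω₁ ω₂ g) v := by
  have e1 : (I * v).re = -v.im := by simp
  have e2 : (-(I * v) + dualCoupling ω₁ ω₂ g).re = v.im + (ω₁.re + ω₂.re - g.re) := by
    simp [dualCoupling]
  refine DifferentiableAt.mul ?_ ?_
  · exact DifferentiableAt.comp (f := fun z => I * z) v
      (differentiableAt_doubleSine hω₁ hω₂ (by rw [e1]; linarith) (by rw [e1, add_re]; linarith))
      (by fun_prop)
  · exact DifferentiableAt.comp (f := fun z => -(I * z) + dualCoupling ω₁ ω₂ g) v
      (differentiableAt_doubleSine hω₁ hω₂ (by rw [e2]; linarith) (by rw [e2, add_re]; linarith))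
      (by fun_prop)

/-- The bound of `μ` on the closed strip `-Re ω₁ ≤ Im v ≤ 0`. Near the real axis, where the
argument `iv` of the first double sine function leaves the strip of the integral representation,
the difference equation is used. -/
theorem exists_norm_mu_le {ω₁ ω₂ g : ℂ} (hω₁ : 0 < ω₁.re) (hω₂ : 0 < ω₂.re)
    (hg : 0 < g.re) (hgω : g.re < ω₂.re) :
    ∃ C : ℝ, 0 < C ∧ ∀ v : ℂ, -ω₁.re ≤ v.im → v.im ≤ 0 →
      ‖mu ω₁ ω₂ g v‖ ≤ C * Real.exp (Real.pi * (g / (ω₁ * ω₂)).re * |v.re|) := by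
  have hn₁ := Complex.ne_zero_of_re_pos hω₁
  have hn₂ := Complex.ne_zero_of_re_pos hω₂
  set ν := (g / (ω₁ * ω₂)).re with hν
  set τ := (1 / ω₂).re with hτ
  have hτ0 : 0 < τ := by
    rw [hτ, one_div, inv_re]
    exact div_pos hω₂ (normSq_pos.2 hn₂)
  have hs : (ω₁ + ω₂).re = ω₁.re + ω₂.re := add_re _ _
  obtain ⟨C₁, hC₁⟩ := exists_logDoubleSine_bound (a := -g) hω₁ hω₂ (c := ω₁.re / 2)
    (by rw [neg_re, abs_neg, abs_of_pos hg]; linarith)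
  obtain ⟨C₂, hC₂⟩ := exists_logDoubleSine_bound (a := ω₁ - g) hω₁ hω₂ (c := (ω₂.re - g.re) / 2)
    (by
      rw [sub_re, hs]
      rcases abs_cases (ω₁.re - g.re) with ⟨h, _⟩ | ⟨h, _⟩ <;> rw [h] <;> linarith)
  set R₁ := |(ω₁ + ω₂ - g).im| / 2 with hR₁
  set R₂ := |(ω₂ - g).im| / 2 with hR₂
  set D₁ := Real.exp C₁ * Real.exp (|Real.pi * ν| * R₁) with hD₁
  set D₂ := 2 * Real.exp (Real.pi * (ω₂.re * |(1 / ω₂).im|)) *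
    (Real.exp C₂ * Real.exp (|-(Real.pi * (τ - ν))| * R₂)) with hD₂
  have hD₁0 : 0 < D₁ := by positivity
  have hD₂0 : 0 < D₂ := by positivity
  refine ⟨D₁ + D₂, by positivity, fun v h0 h1 => ?_⟩
  have e1 : (I * v).re = -v.im := by simp
  have e2 : (-(I * v) + dualCoupling ω₁ ω₂ g).re = v.im + (ω₁.re + ω₂.re - g.re) := by
    simp [dualCoupling]
  have hS2 : doubleSine ω₁ ω₂ (-(I * v) + dualCoupling ω₁ ω₂ g) =
      exp (logDoubleSine ω₁ ω₂ (2 * (-(I * v) + dualCoupling ω₁ ω₂ g) - ω₁ - ω₂)) := by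
    rw [doubleSine_of_mem_strip (by rw [e2]; linarith) (by rw [e2, hs]; linarith),
      doubleSineStrip_eq_exp]
  rcases le_or_gt v.im (-((ω₂.re - g.re) / 2)) with hv | hv
  · set w := v + I * (ω₁ + ω₂ - g) / 2 with hw
    have wim : w.im = v.im + (ω₁.re + ω₂.re - g.re) / 2 := by rw [hw]; simp
    have wre : w.re = v.re - (ω₁ + ω₂ - g).im / 2 := by rw [hw]; simp; ring
    have hII := I_mul_I
    have a1 : 2 * (I * v) - ω₁ - ω₂ = -g + 2 * I * w := by
      rw [hw]; linear_combination (-(ω₁ + ω₂ - g)) * hII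
    have a2 : 2 * (-(I * v) + dualCoupling ω₁ ω₂ g) - ω₁ - ω₂ = -g - 2 * I * w := by
      rw [hw, dualCoupling]; linear_combination (ω₁ + ω₂ - g) * hII
    have h := hC₁ w (by rw [wim, abs_le]; constructor <;> linarith)
    rw [neg_div, neg_re, abs_le] at h
    rw [mu, hS2, doubleSine_of_mem_strip (by rw [e1]; linarith) (by rw [e1, hs]; linarith),
      doubleSineStrip_eq_exp, a1, a2, ← exp_add, norm_exp]
    have hd : |w.re - v.re| ≤ R₁ := by
      rw [wre, hR₁, sub_sub_cancel_left, abs_neg, abs_div, abs_two]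
    calc _ ≤ Real.exp (C₁ + Real.pi * ν * |w.re|) := Real.exp_le_exp.2 (by linarith [h.2])
      _ ≤ D₁ * Real.exp (Real.pi * ν * |v.re|) := by
          rw [Real.exp_add, hD₁, mul_assoc (Real.exp C₁)]
          exact mul_le_mul_of_nonneg_left (exp_mul_abs_le hd) (Real.exp_pos _).le
      _ ≤ _ := by gcongr; linarith
  · set w := v + I * (ω₂ - g) / 2 with hw
    have wim : w.im = v.im + (ω₂.re - g.re) / 2 := by rw [hw]; simp
    have wre : w.re = v.re - (ω₂ - g).im / 2 := by rw [hw]; simp; ring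
    have hII := I_mul_I
    have a1 : 2 * (I * v + ω₁) - ω₁ - ω₂ = ω₁ - g + 2 * I * w := by
      rw [hw]; linear_combination (-(ω₂ - g)) * hII
    have a2 : 2 * (-(I * v) + dualCoupling ω₁ ω₂ g) - ω₁ - ω₂ = ω₁ - g - 2 * I * w := by
      rw [hw, dualCoupling]; linear_combination (ω₂ - g) * hII
    have h := hC₂ w (by rw [wim, abs_le]; constructor <;> linarith)
    have hre : ((ω₁ - g) / (ω₁ * ω₂)).re = τ - ν := by
      rw [hτ, hν, ← sub_re]; congr 1; field_simp
    rw [hre, abs_le] at h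
    rw [mu, hS2, doubleSine_eq_sin_mul_strip hω₁ hω₂ (by rw [e1]; linarith) (by rw [e1]; linarith),
      doubleSineStrip_eq_exp, a1, a2, mul_assoc, ← exp_add, norm_mul, norm_exp]
    have hd : |w.re - v.re| ≤ R₂ := by
      rw [wre, hR₂, sub_sub_cancel_left, abs_neg, abs_div, abs_two]
    have hsin : ‖2 * sin (Real.pi * (I * v) / ω₂)‖ ≤
        2 * Real.exp (Real.pi * (ω₂.re * |(1 / ω₂).im|)) * Real.exp (Real.pi * τ * |v.re|) := by
      have q1 : (Real.pi * (I * v) / ω₂ : ℂ) = (Real.pi * (v * (1 / ω₂))) * I := by ring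
      have q2 : (Real.pi * (v * (1 / ω₂)) : ℂ).re = Real.pi * (v.re * τ - v.im * (1 / ω₂).im) := by
        rw [re_ofReal_mul, mul_re]
      rw [q1, sin_mul_I, norm_mul, norm_mul, norm_I, mul_one, mul_assoc, ← Real.exp_add]
      have : ‖(2 : ℂ)‖ = 2 := by simp
      rw [this]
      gcongr
      refine (norm_sinh_le_exp _).trans (Real.exp_le_exp.2 ?_)
      rw [q2, abs_mul, abs_of_pos Real.pi_pos]
      have q3 : |v.re * τ - v.im * (1 / ω₂).im| ≤ |v.re| * τ + ω₂.re * |(1 / ω₂).im| := by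
        refine (abs_sub _ _).trans ?_
        rw [abs_mul, abs_mul, abs_of_pos hτ0]
        have : |v.im| ≤ ω₂.re := by rw [abs_le]; constructor <;> linarith
        gcongr
      nlinarith [Real.pi_pos]
    calc _ ≤ (2 * Real.exp (Real.pi * (ω₂.re * |(1 / ω₂).im|)) *
          Real.exp (Real.pi * τ * |v.re|)) *
          Real.exp (C₂ + -(Real.pi * (τ - ν)) * |w.re|) := by
          refine mul_le_mul hsin (Real.exp_le_exp.2 ?_) (Real.exp_pos _).le (by positivity)
          linarith [h.2]
      _ ≤ (2 * Real.exp (Real.pi * (ω₂.re * |(1 / ω₂).im|)) * Real.exp (Real.pi * τ * |v.re|)) *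
          (Real.exp C₂ * (Real.exp (|-(Real.pi * (τ - ν))| * R₂) *
            Real.exp (-(Real.pi * (τ - ν)) * |v.re|))) := by
          rw [Real.exp_add]
          gcongr
          exact exp_mul_abs_le hd
      _ = D₂ * (Real.exp (Real.pi * τ * |v.re|) * Real.exp (-(Real.pi * (τ - ν)) * |v.re|)) := by
          rw [hD₂]; ring
      _ = D₂ * Real.exp (Real.pi * ν * |v.re|) := by
          rw [← Real.exp_add]; congr 2; ring
      _ ≤ _ := by gcongr; linarith

theorem sinh_ne_zero_of_re_ne_zero {z : ℂ} (hz : z.re ≠ 0) : sinh z ≠ 0 := by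
  rcases lt_or_gt_of_ne hz with h | h
  · have h1 := sinh_re_le_norm_sinh (-z)
    rw [sinh_neg, norm_neg] at h1
    have h2 : 0 < Real.sinh (-z).re := Real.sinh_pos_iff.2 (by simpa using h)
    exact norm_pos_iff.1 (h2.trans_le h1)
  · have h2 : 0 < Real.sinh z.re := Real.sinh_pos_iff.2 h
    exact norm_pos_iff.1 (h2.trans_le (sinh_re_le_norm_sinh z))

theorem sinh_pi_div_mul_ne_zero {ω₂ : ℂ} (hω₂ : 0 < ω₂.re) {v : ℝ} (hv : v ≠ 0) :
    sinh (Real.pi / ω₂ * v) ≠ 0 := by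
  apply sinh_ne_zero_of_re_ne_zero
  have e : (Real.pi / ω₂ * v : ℂ) = ((Real.pi * v : ℝ) : ℂ) * ω₂⁻¹ := by push_cast; ring
  rw [e, re_ofReal_mul, inv_re]
  have := normSq_pos.2 (Complex.ne_zero_of_re_pos hω₂)
  have := Real.pi_pos
  positivity

/-- The ratio of hyperbolic sines in the Macdonald operators turns `μ (v)` into its translate by
`-iω₁`. -/
theorem mu_mul_sinh_div_sinh {ω₁ ω₂ g : ℂ} (hω₁ : 0 < ω₁.re) (hω₂ : 0 < ω₂.re)
    (hg : 0 < g.re) (hgω : g.re < ω₂.re) {v : ℝ} (hv : v ≠ 0) :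
    mu ω₁ ω₂ g v * (sinh (Real.pi / ω₂ * (v - I * g)) / sinh (Real.pi / ω₂ * v)) =
      mu ω₁ ω₂ g (v - I * ω₁) := by
  have hn₂ := Complex.ne_zero_of_re_pos hω₂
  have hsv := sinh_pi_div_mul_ne_zero hω₂ hv
  have hII := I_mul_I
  have e1 : (I * (v : ℂ)).re = 0 := by simp
  have a1 : I * (v - I * ω₁) = I * v + ω₁ := by linear_combination (-ω₁) * hII
  have a2 : -(I * (v - I * ω₁)) + dualCoupling ω₁ ω₂ g = -(I * v) + (ω₂ - g) := by
    rw [a1, dualCoupling]; ring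
  have a3 : -(I * (v : ℂ)) + (ω₂ - g) + ω₁ = -(I * v) + dualCoupling ω₁ ω₂ g := by
    rw [dualCoupling]; ring
  have e2 : (-(I * (v : ℂ)) + (ω₂ - g)).re = ω₂.re - g.re := by simp
  have s1 : sin (Real.pi * (I * v) / ω₂) = sinh (Real.pi / ω₂ * v) * I := by
    rw [← sin_mul_I]; congr 1; ring
  have s2 : sin (Real.pi * (-(I * v) + (ω₂ - g)) / ω₂) =
      sinh (Real.pi / ω₂ * (v - I * g)) * I := by
    rw [← sin_mul_I, ← sin_pi_sub]
    congr 1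
    field_simp
    linear_combination g * hII
  rw [mu, mu, a1, ← a1, a2, a1, doubleSine_eq_sin_mul hω₁ hω₂ (z := I * v) (by rw [e1]; linarith)
    (by rw [e1]; exact hω₂), doubleSine_eq_sin_mul hω₁ hω₂ (z := -(I * v) + (ω₂ - g))
    (by rw [e2]; linarith) (by rw [e2]; linarith), a3, s1, s2]
  generalize sinh (Real.pi / ω₂ * (v : ℂ)) = T at hsv ⊢
  field_simp

/-- The difference equation of the kernel function. -/
theorem kernelK_sub_eq {ω₁ ω₂ g : ℂ} (hω₁ : 0 < ω₁.re) (hω₂ : 0 < ω₂.re)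
    (hg : 0 < g.re) (hgω : g.re < ω₂.re) (w : ℝ) :
    cosh (Real.pi / ω₂ * (w + I * g / 2)) ≠ 0 ∧ cosh (Real.pi / ω₂ * (w - I * g / 2)) ≠ 0 ∧
    kernelK ω₁ ω₂ g (w - I * ω₁ / 2) = kernelK ω₁ ω₂ g (w + I * ω₁ / 2) *
      (cosh (Real.pi / ω₂ * (w + I * g / 2)) / cosh (Real.pi / ω₂ * (w - I * g / 2))) := by
  have hn₂ := Complex.ne_zero_of_re_pos hω₂
  have hII := I_mul_I
  have a1 : I * (w - I * ω₁ / 2) + dualCoupling ω₁ ω₂ g / 2 = I * w + (ω₂ - g) / 2 + ω₁ := by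
    rw [dualCoupling]; linear_combination (-ω₁ / 2) * hII
  have a2 : -(I * (w - I * ω₁ / 2)) + dualCoupling ω₁ ω₂ g / 2 = -(I * w) + (ω₂ - g) / 2 := by
    rw [dualCoupling]; linear_combination (ω₁ / 2) * hII
  have a3 : I * (w + I * ω₁ / 2) + dualCoupling ω₁ ω₂ g / 2 = I * w + (ω₂ - g) / 2 := by
    rw [dualCoupling]; linear_combination (ω₁ / 2) * hII
  have a4 : -(I * (w + I * ω₁ / 2)) + dualCoupling ω₁ ω₂ g / 2 =
      -(I * w) + (ω₂ - g) / 2 + ω₁ := by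
    rw [dualCoupling]; linear_combination (-ω₁ / 2) * hII
  have e1 : (I * (w : ℂ) + (ω₂ - g) / 2).re = (ω₂.re - g.re) / 2 := by simp
  have e2 : (-(I * (w : ℂ)) + (ω₂ - g) / 2).re = (ω₂.re - g.re) / 2 := by simp
  have s1 : sin (Real.pi * (I * w + (ω₂ - g) / 2) / ω₂) =
      cosh (Real.pi / ω₂ * (w + I * g / 2)) := by
    rw [← cos_mul_I, ← sin_add_pi_div_two]
    congr 1
    field_simp
    linear_combination (-g) * hII
  have s2 : sin (Real.pi * (-(I * w) + (ω₂ - g) / 2) / ω₂) =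
      cosh (Real.pi / ω₂ * (w - I * g / 2)) := by
    rw [← cos_mul_I, ← cos_neg, ← sin_add_pi_div_two]
    congr 1
    field_simp
    linear_combination (-g) * hII
  have f1 := doubleSine_eq_sin_mul hω₁ hω₂ (z := I * w + (ω₂ - g) / 2)
    (by rw [e1]; linarith) (by rw [e1]; linarith)
  have f2 := doubleSine_eq_sin_mul hω₁ hω₂ (z := -(I * w) + (ω₂ - g) / 2)
    (by rw [e2]; linarith) (by rw [e2]; linarith)
  have n1 := doubleSine_ne_zero (ω₁ := ω₁) (ω₂ := ω₂) (z := I * w + (ω₂ - g) / 2)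
    (by rw [e1]; linarith) (by rw [e1, add_re]; linarith)
  have n2 := doubleSine_ne_zero (ω₁ := ω₁) (ω₂ := ω₂) (z := -(I * w) + (ω₂ - g) / 2)
    (by rw [e2]; linarith) (by rw [e2, add_re]; linarith)
  rw [s1] at f1
  rw [s2] at f2
  have c1 : cosh (Real.pi / ω₂ * (w + I * g / 2)) ≠ 0 := fun h => n1 (by rw [f1, h]; ring)
  have c2 : cosh (Real.pi / ω₂ * (w - I * g / 2)) ≠ 0 := fun h => n2 (by rw [f2, h]; ring)
  refine ⟨c1, c2, ?_⟩
  rw [kernelK, kernelK, a1, a2, a3, a4, f1, f2]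
  generalize cosh (Real.pi / ω₂ * (w + I * g / 2)) = T at c1 ⊢
  field_simp

/-! ### The hyperbolic kernel function identity and the size of the kernel -/

open MeasureTheory

/-- The kernel function identity for the Macdonald operators, in hyperbolic form. -/
theorem kernel_identity_hyperbolic {ω₁ ω₂ g : ℂ} (hω₁ : 0 < ω₁.re) (hω₂ : 0 < ω₂.re)
    (hg : 0 < g.re) (hgω : g.re < ω₂.re) {n : ℕ} {x u : Fin n → ℝ} (hx : Function.Injective x)
    (hu : Function.Injective u) (r : ℕ) :
    ∑ S ∈ Finset.powersetCard r (Finset.univ : Finset (Fin n)),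
      (∏ i ∈ S, ∏ j ∈ Sᶜ, sinh (Real.pi / ω₂ * (x i - x j - I * g)) /
        sinh (Real.pi / ω₂ * (x i - x j))) *
      ∏ i ∈ S, ∏ a, cosh (Real.pi / ω₂ * ((x i - u a : ℝ) + I * g / 2)) /
        cosh (Real.pi / ω₂ * ((x i - u a : ℝ) - I * g / 2)) =
    ∑ S ∈ Finset.powersetCard r (Finset.univ : Finset (Fin n)),
      (∏ i ∈ S, ∏ j ∈ Sᶜ, sinh (Real.pi / ω₂ * (u j - u i - I * g)) /
        sinh (Real.pi / ω₂ * (u j - u i))) *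
      ∏ i ∈ S, ∏ a, cosh (Real.pi / ω₂ * ((x a - u i : ℝ) + I * g / 2)) /
        cosh (Real.pi / ω₂ * ((x a - u i : ℝ) - I * g / 2)) := by
  set k : ℂ := Real.pi / ω₂ with hk
  set p : ℂ := exp (k * (I * g)) with hp
  set q : ℂ := exp (k * (I * g / 2)) with hq
  have hpq : p = q * q := by rw [hp, hq, ← exp_add]; congr 1; ring
  have hp0 : p ≠ 0 := exp_ne_zero _
  have hq0 : q ≠ 0 := exp_ne_zero _
  let e : ℝ → ℂ := fun t => exp (k * t)
  have he0 : ∀ t, e t ≠ 0 := fun t => exp_ne_zero _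
  set X : Fin n → ℂ := fun i => e (x i) * e (x i) with hX
  set Y : Fin n → ℂ := fun i => -(e (u i) * e (u i)) * p⁻¹ with hY
  set s : ℂ := (p * p)⁻¹ with hs
  -- hyperbolic functions of differences in terms of exponentials
  have sub_exp : ∀ a b : ℝ, e a * e a - e b * e b = 2 * (e a * e b) * sinh (k * (a - b)) := by
    intro a b
    have h1 : k * ((a : ℂ) - b) = k * a - k * b := by ring
    have := he0 a
    have := he0 b
    rw [h1, sinh, neg_sub, exp_sub, exp_sub]
    change _ = 2 * (e a * e b) * ((e a / e b - e b / e a) / 2)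
    field_simp
  have sub_exp' : ∀ a b : ℝ, e a * e a * p⁻¹ - e b * e b * p =
      2 * (e a * e b) * sinh (k * (a - b - I * g)) := by
    intro a b
    have h1 : k * ((a : ℂ) - b - I * g) = k * a - k * b - k * (I * g) := by ring
    have h2 : -(k * (a : ℂ) - k * b - k * (I * g)) = k * b - k * a + k * (I * g) := by ring
    have := he0 a
    have := he0 b
    rw [h1, sinh, h2, exp_sub, exp_sub, exp_add, exp_sub]
    change _ = 2 * (e a * e b) * ((e a / e b / p - e b / e a * p) / 2)
    field_simp
  have add_exp : ∀ a b : ℝ, e a * e a * q + e b * e b * q⁻¹ =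
      2 * (e a * e b) * cosh (k * ((a - b : ℝ) + I * g / 2)) := by
    intro a b
    have h1 : k * (((a - b : ℝ) : ℂ) + I * g / 2) = k * a - k * b + k * (I * g / 2) := by
      push_cast; ring
    have h2 : -(k * (a : ℂ) - k * b + k * (I * g / 2)) = k * b - k * a - k * (I * g / 2) := by ring
    have := he0 a
    have := he0 b
    rw [h1, cosh, h2, exp_sub, exp_sub, exp_add, exp_sub]
    change _ = 2 * (e a * e b) * ((e a / e b * q + e b / e a / q) / 2)
    field_simp
  have add_exp' : ∀ a b : ℝ, e a * e a * q⁻¹ + e b * e b * q =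
      2 * (e a * e b) * cosh (k * ((a - b : ℝ) - I * g / 2)) := by
    intro a b
    have h1 : k * (((a - b : ℝ) : ℂ) - I * g / 2) = k * a - k * b - k * (I * g / 2) := by
      push_cast; ring
    have h2 : -(k * (a : ℂ) - k * b - k * (I * g / 2)) = k * b - k * a + k * (I * g / 2) := by ring
    have := he0 a
    have := he0 b
    rw [h1, cosh, h2, exp_sub, exp_sub, exp_add, exp_sub]
    change _ = 2 * (e a * e b) * ((e a / e b / q + e b / e a * q) / 2)
    field_simp
  have h2e : ∀ a b : ℝ, 2 * (e a * e b) ≠ 0 := fun a b =>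
    mul_ne_zero two_ne_zero (mul_ne_zero (he0 a) (he0 b))
  have hsinh : ∀ a b : ℝ, a ≠ b → sinh (k * (a - b)) ≠ 0 := fun a b hab => by
    have := sinh_pi_div_mul_ne_zero hω₂ (sub_ne_zero.2 hab)
    rwa [ofReal_sub] at this
  have hcosh := fun w : ℝ => kernelK_sub_eq hω₁ hω₂ hg hgω w
  have hXinj : Function.Injective X := fun i j hij => by
    by_contra hne
    have h := sub_exp (x i) (x j)
    rw [show e (x i) * e (x i) = e (x j) * e (x j) from hij, sub_self] at h
    exact mul_ne_zero (h2e _ _) (hsinh _ _ fun h' => hne (hx h')) h.symm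
  have hYinj : Function.Injective Y := fun i j hij => by
    by_contra hne
    have h := sub_exp (u i) (u j)
    have hij' : e (u i) * e (u i) = e (u j) * e (u j) := by
      have : -(e (u i) * e (u i)) * p⁻¹ = -(e (u j) * e (u j)) * p⁻¹ := hij
      exact neg_injective (mul_right_cancel₀ (inv_ne_zero hp0) this)
    rw [hij', sub_self] at h
    exact mul_ne_zero (h2e _ _) (hsinh _ _ fun h' => hne (hu h')) h.symm
  have hXY : ∀ i a, X i - Y a =
      q⁻¹ * (2 * (e (x i) * e (u a)) * cosh (k * ((x i - u a : ℝ) + I * g / 2))) := fun i a => by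
    rw [← add_exp, hX, hY, hpq]
    field_simp
    ring
  have hsXY : ∀ i a, s * X i - Y a =
      (p * q)⁻¹ * (2 * (e (x i) * e (u a)) * cosh (k * ((x i - u a : ℝ) - I * g / 2))) :=
    fun i a => by
      rw [← add_exp', hX, hY, hs, hpq]
      field_simp
      ring
  have hxy : ∀ i a, X i ≠ Y a := fun i a h => by
    have h1 := hXY i a
    rw [h, sub_self] at h1
    exact mul_ne_zero (inv_ne_zero hq0) (mul_ne_zero (h2e _ _) (hcosh _).1) h1.symm
  have hsxy : ∀ i a, s * X i ≠ Y a := fun i a h => by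
    have h1 := hsXY i a
    rw [h, sub_self] at h1
    exact mul_ne_zero (inv_ne_zero (mul_ne_zero hp0 hq0)) (mul_ne_zero (h2e _ _) (hcosh _).2.1)
      h1.symm
  have key := kernel_identity_rational (inv_ne_zero (mul_ne_zero hp0 hp0)) hXinj hYinj hxy hsxy r
  have t1 : ∀ i a, cosh (k * ((x i - u a : ℝ) + I * g / 2)) /
      cosh (k * ((x i - u a : ℝ) - I * g / 2)) = p⁻¹ * ((X i - Y a) / (s * X i - Y a)) := by
    intro i a
    rw [hXY, hsXY]
    have := h2e (x i) (u a)
    have := (hcosh (x i - u a)).2.1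
    rw [← hk] at this
    generalize cosh (k * ((x i - u a : ℝ) - I * g / 2)) = T at *
    generalize cosh (k * ((x i - u a : ℝ) + I * g / 2)) = T'
    have := he0 (x i)
    have := he0 (u a)
    field_simp
  have t2 : ∀ i j, sinh (k * (x i - x j - I * g)) / sinh (k * (x i - x j)) =
      p * ((s * X i - X j) / (X i - X j)) := by
    intro i j
    have h1 : s * X i - X j = p⁻¹ * (2 * (e (x i) * e (x j)) * sinh (k * (x i - x j - I * g))) := by
      rw [← sub_exp', hX, hs]; field_simp
    have h2 : X i - X j = 2 * (e (x i) * e (x j)) * sinh (k * (x i - x j)) := sub_exp _ _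
    rw [h1, h2, ← mul_div_assoc, ← mul_assoc p, mul_inv_cancel₀ hp0, one_mul,
      mul_div_mul_left _ _ (h2e _ _)]
  have t3 : ∀ i j, sinh (k * (u j - u i - I * g)) / sinh (k * (u j - u i)) =
      p * ((Y i - s * Y j) / (Y i - Y j)) := by
    intro i j
    have h1 : Y i - s * Y j =
        (p * p)⁻¹ * (2 * (e (u j) * e (u i)) * sinh (k * (u j - u i - I * g))) := by
      rw [← sub_exp', hY, hs]; field_simp; ring
    have h2 : Y i - Y j = p⁻¹ * (2 * (e (u j) * e (u i)) * sinh (k * (u j - u i))) := by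
      rw [← sub_exp, hY]; ring
    rw [h1, h2, mul_inv, mul_assoc p⁻¹, mul_div_mul_left _ _ (inv_ne_zero hp0), ← mul_div_assoc,
      ← mul_assoc p, mul_inv_cancel₀ hp0, one_mul, mul_div_mul_left _ _ (h2e _ _)]
  have hcard : ∀ S ∈ Finset.powersetCard r (Finset.univ : Finset (Fin n)), ∀ c : ℂ,
      (∏ i ∈ S, ∏ j ∈ Sᶜ, c) = (c ^ (n - r)) ^ r ∧ (∏ i ∈ S, ∏ a : Fin n, c) = (c ^ n) ^ r := by
    intro S hS c
    have hc := (Finset.mem_powersetCard.1 hS).2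
    simp [Finset.card_compl, hc]
  have L : ∀ S ∈ Finset.powersetCard r (Finset.univ : Finset (Fin n)),
      (∏ i ∈ S, ∏ j ∈ Sᶜ, sinh (k * (x i - x j - I * g)) / sinh (k * (x i - x j))) *
      ∏ i ∈ S, ∏ a, cosh (k * ((x i - u a : ℝ) + I * g / 2)) /
        cosh (k * ((x i - u a : ℝ) - I * g / 2)) =
      ((p ^ (n - r)) ^ r * (p⁻¹ ^ n) ^ r) *
        ((∏ i ∈ S, ∏ j ∈ Sᶜ, (s * X i - X j) / (X i - X j)) *
          ∏ i ∈ S, ∏ a, (X i - Y a) / (s * X i - Y a)) := fun S hS => by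
    simp_rw [t1, t2, Finset.prod_mul_distrib]
    rw [(hcard S hS p).1, (hcard S hS p⁻¹).2]
    ring
  have R : ∀ S ∈ Finset.powersetCard r (Finset.univ : Finset (Fin n)),
      (∏ i ∈ S, ∏ j ∈ Sᶜ, sinh (k * (u j - u i - I * g)) / sinh (k * (u j - u i))) *
      ∏ i ∈ S, ∏ a, cosh (k * ((x a - u i : ℝ) + I * g / 2)) /
        cosh (k * ((x a - u i : ℝ) - I * g / 2)) =
      ((p ^ (n - r)) ^ r * (p⁻¹ ^ n) ^ r) *
        ((∏ i ∈ S, ∏ j ∈ Sᶜ, (Y i - s * Y j) / (Y i - Y j)) *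
          ∏ i ∈ S, ∏ a, (X a - Y i) / (s * X a - Y i)) := fun S hS => by
    simp_rw [t1, t3, Finset.prod_mul_distrib]
    rw [(hcard S hS p).1, (hcard S hS p⁻¹).2]
    ring
  rw [Finset.sum_congr rfl L, Finset.sum_congr rfl R, ← Finset.mul_sum, ← Finset.mul_sum, key]

/-- In a product over all pairs `i ≠ j`, the factors with `i ∈ S`, `j ∉ S` are multiplied by
`h i j`. -/
theorem prod_pairs_mul_ite {n : ℕ} (S : Finset (Fin n)) (f f' h : Fin n → Fin n → ℂ)
    (h1 : ∀ i ∈ S, ∀ j ∉ S, f' i j = f i j * h i j)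
    (h2 : ∀ i j, ¬ (i ∈ S ∧ j ∉ S) → f' i j = f i j) :
    ∏ i, ∏ j ∈ Finset.univ.erase i, f' i j =
      (∏ i, ∏ j ∈ Finset.univ.erase i, f i j) * ∏ i ∈ S, ∏ j ∈ Sᶜ, h i j := by
  have e : ∀ i, ∏ j ∈ Finset.univ.erase i, f' i j =
      (∏ j ∈ Finset.univ.erase i, f i j) * if i ∈ S then ∏ j ∈ Sᶜ, h i j else 1 := by
    intro i
    by_cases hi : i ∈ S
    · have hsub : Sᶜ ⊆ Finset.univ.erase i := fun j hj =>
        Finset.mem_erase.2 ⟨fun h => Finset.mem_compl.1 hj (h ▸ hi), Finset.mem_univ _⟩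
      rw [if_pos hi, ← Finset.prod_sdiff hsub, ← Finset.prod_sdiff hsub (f := fun j => f i j),
        mul_assoc, ← Finset.prod_mul_distrib]
      congr 1
      · exact Finset.prod_congr rfl fun j hj => h2 i j fun h =>
          (Finset.mem_sdiff.1 hj).2 (Finset.mem_compl.2 h.2)
      · exact Finset.prod_congr rfl fun j hj => h1 i hi j (Finset.mem_compl.1 hj)
    · rw [if_neg hi, mul_one]
      exact Finset.prod_congr rfl fun j _ => h2 i j fun h => hi h.1
  simp_rw [e, Finset.prod_mul_distrib]
  congr 1
  rw [Finset.prod_ite_mem, Finset.univ_inter]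

theorem ae_injective (n : ℕ) : ∀ᵐ u : Fin n → ℝ, Function.Injective u := by
  have h : ∀ i j : Fin n, i ≠ j → ∀ᵐ u : Fin n → ℝ, u i ≠ u j := by
    intro i j hij
    let L : (Fin n → ℝ) →ₗ[ℝ] ℝ := (LinearMap.proj i : (Fin n → ℝ) →ₗ[ℝ] ℝ) - LinearMap.proj j
    have hL : LinearMap.ker L ≠ ⊤ := fun htop => by
      have : Pi.single i (1 : ℝ) ∈ LinearMap.ker L := htop ▸ Submodule.mem_top
      rw [LinearMap.mem_ker] at this
      simp [L, hij.symm] at this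
    have h0 := Measure.addHaar_submodule (volume : Measure (Fin n → ℝ)) (LinearMap.ker L) hL
    rw [ae_iff]
    convert h0 using 2
    ext u
    simp [L, sub_eq_zero]
  have h' : ∀ᵐ u : Fin n → ℝ, ∀ i j : Fin n, i ≠ j → u i ≠ u j :=
    ae_all_iff.2 fun i => ae_all_iff.2 fun j => by
      by_cases hij : i = j
      · simp [hij]
      · filter_upwards [h i j hij] with u hu _ using hu
  filter_upwards [h'] with u hu i j hij
  by_contra hne
  exact hu i j hne hij

/-- The size of the kernel of the Baxter operator at complex points `z`, `y` over bounded
distance from `0` and from `u ∈ ℝⁿ`. The arguments `v i j` of the measure function are only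
required to be within bounded distance from `uᵢ - uⱼ`. -/
theorem exists_norm_kernel_le {ω₁ ω₂ g : ℂ} (hω₁ : 0 < ω₁.re) (hω₂ : 0 < ω₂.re)
    (hg : 0 < g.re) (hgω : g.re < ω₂.re) (lam : ℂ) (n : ℕ) {c : ℝ}
    (hc : 2 * c < (ω₁ + ω₂ - g).re) (R : ℝ) :
    ∃ C : ℝ, 0 ≤ C ∧ ∀ (z y : Fin n → ℂ) (v : Fin n → Fin n → ℂ) (u : Fin n → ℝ),
      (∀ i, |(z i).re| ≤ R) → (∀ i, |(z i).im| ≤ R) → (∀ j, |(y j).re - u j| ≤ R) →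
      (∀ j, |(y j).im| ≤ R) → (∀ i j, |(z i - y j).im| ≤ c) →
      (∀ i j, -ω₁.re ≤ (v i j).im ∧ (v i j).im ≤ 0) →
      (∀ i j, |(v i j).re - (u i - u j)| ≤ R) →
      ‖exp (2 * Real.pi * I * lam * ((∑ i, z i) - ∑ i, y i)) * kernelTuple ω₁ ω₂ g z y *
        ∏ i, ∏ j ∈ Finset.univ.erase i, mu ω₁ ω₂ g (v i j)‖ ≤ C * kernelSize ω₁ ω₂ g lam u := by
  obtain ⟨CK, hCK0, hCK⟩ := exists_norm_kernelK_le hω₁ hω₂ hg hc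
  obtain ⟨CM, hCM0, hCM⟩ := exists_norm_mu_le hω₁ hω₂ hg hgω
  set κ := Real.pi * (g / (ω₁ * ω₂)).re with hκ
  set E := Real.exp (2 * Real.pi * ((|lam.re| + |lam.im|) * (n * (2 * R)))) with hE
  set DK := CK * Real.exp (|-κ| * (2 * R)) with hDK
  set DM := CM * Real.exp (|κ| * R) with hDM
  refine ⟨E * (∏ _i : Fin n, ∏ _j : Fin n, DK) *
    ∏ i : Fin n, ∏ _j ∈ Finset.univ.erase i, DM, by positivity, ?_⟩
  intro z y v u hzr hzi hyr hyi him hv hvr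
  have hexp : ‖exp (2 * Real.pi * I * lam * ((∑ i, z i) - ∑ i, y i))‖ ≤
      E * Real.exp (2 * Real.pi * lam.im * ∑ i, u i) := by
    rw [norm_exp, hE, ← Real.exp_add]
    refine Real.exp_le_exp.2 ?_
    set D := (∑ i, z i) - ∑ i, y i with hD
    have e1 : (2 * Real.pi * I * lam * D).re = -(2 * Real.pi * (lam.re * D.im + lam.im * D.re)) := by
      have : 2 * Real.pi * I * lam * D = ((2 * Real.pi : ℝ) : ℂ) * (I * (lam * D)) := by
        push_cast; ring
      rw [this, re_ofReal_mul]; simp; ring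
    have d1 : |D.im| ≤ n * (2 * R) := by
      have : D.im = ∑ i, ((z i).im - (y i).im) := by
        rw [hD, sub_im, im_sum, im_sum, Finset.sum_sub_distrib]
      rw [this]
      refine (Finset.abs_sum_le_sum_abs _ _).trans ?_
      refine (Finset.sum_le_card_nsmul _ _ (2 * R) fun i _ => ?_).trans_eq (by simp)
      exact (abs_sub _ _).trans (by linarith [hzi i, hyi i])
    have d2 : |D.re + ∑ i, u i| ≤ n * (2 * R) := by
      have : D.re + ∑ i, u i = ∑ i, ((z i).re - ((y i).re - u i)) := by
        rw [hD, sub_re, re_sum, re_sum, Finset.sum_sub_distrib, Finset.sum_sub_distrib]; ring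
      rw [this]
      refine (Finset.abs_sum_le_sum_abs _ _).trans ?_
      refine (Finset.sum_le_card_nsmul _ _ (2 * R) fun i _ => ?_).trans_eq (by simp)
      exact (abs_sub _ _).trans (by linarith [hzr i, hyr i])
    rw [e1]
    have d3 : -(lam.re * D.im) ≤ |lam.re| * (n * (2 * R)) := by
      refine (neg_le_abs _).trans ?_
      rw [abs_mul]; gcongr
    have d4 : -(lam.im * (D.re + ∑ i, u i)) ≤ |lam.im| * (n * (2 * R)) := by
      refine (neg_le_abs _).trans ?_
      rw [abs_mul]; gcongr
    have := Real.pi_pos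
    have d5 : -(lam.re * D.im + lam.im * D.re) ≤
        (|lam.re| + |lam.im|) * (n * (2 * R)) + lam.im * ∑ i, u i := by linarith
    have d6 := mul_le_mul_of_nonneg_left d5 (show 0 ≤ 2 * Real.pi by positivity)
    linarith
  have hK : ‖kernelTuple ω₁ ω₂ g z y‖ ≤
      (∏ _i : Fin n, ∏ _j : Fin n, DK) * ∏ _i : Fin n, ∏ j : Fin n, Real.exp (-κ * |u j|) := by
    rw [kernelTuple, ← Finset.prod_mul_distrib, norm_prod]
    refine Finset.prod_le_prod (fun _ _ => norm_nonneg _) fun i _ => ?_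
    rw [← Finset.prod_mul_distrib, norm_prod]
    refine Finset.prod_le_prod (fun _ _ => norm_nonneg _) fun j _ => ?_
    refine (hCK _ (him i j)).trans ?_
    rw [hDK, mul_assoc, ← abs_neg (u j)]
    refine mul_le_mul_of_nonneg_left (exp_mul_abs_le ?_) hCK0.le
    have : (z i - y j).re - -u j = (z i).re - ((y j).re - u j) := by rw [sub_re]; ring
    rw [this]
    exact (abs_sub _ _).trans (by linarith [hzr i, hyr j])
  have hM : ‖∏ i, ∏ j ∈ Finset.univ.erase i, mu ω₁ ω₂ g (v i j)‖ ≤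
      (∏ i : Fin n, ∏ _j ∈ Finset.univ.erase i, DM) *
        ∏ i : Fin n, ∏ j : Fin n, Real.exp (κ * |u i - u j|) := by
    rw [← Finset.prod_mul_distrib, norm_prod]
    refine Finset.prod_le_prod (fun _ _ => norm_nonneg _) fun i _ => ?_
    have : ∏ j : Fin n, Real.exp (κ * |u i - u j|) =
        ∏ j ∈ Finset.univ.erase i, Real.exp (κ * |u i - u j|) := by
      rw [← Finset.mul_prod_erase Finset.univ _ (Finset.mem_univ i)]; simp
    rw [this, ← Finset.prod_mul_distrib, norm_prod]
    refine Finset.prod_le_prod (fun _ _ => norm_nonneg _) fun j _ => ?_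
    refine (hCM _ (hv i j).1 (hv i j).2).trans ?_
    rw [hDM, mul_assoc CM]
    exact mul_le_mul_of_nonneg_left (exp_mul_abs_le (hvr i j)) hCM0.le
  have hsize : kernelSize ω₁ ω₂ g lam u = Real.exp (2 * Real.pi * lam.im * ∑ i, u i) *
      (∏ _i : Fin n, ∏ j : Fin n, Real.exp (-κ * |u j|)) *
        ∏ i : Fin n, ∏ j : Fin n, Real.exp (κ * |u i - u j|) := by
    simp_rw [← Real.exp_sum, ← Real.exp_add, kernelSize, ← Finset.mul_sum]
    congr 1
    rw [← hκ, Finset.sum_const, Finset.card_univ, Fintype.card_fin, nsmul_eq_mul]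
    ring
  rw [norm_mul, norm_mul]
  calc _ ≤ (E * Real.exp (2 * Real.pi * lam.im * ∑ i, u i)) *
        ((∏ _i : Fin n, ∏ _j : Fin n, DK) * ∏ _i : Fin n, ∏ j : Fin n, Real.exp (-κ * |u j|)) *
        ((∏ i : Fin n, ∏ _j ∈ Finset.univ.erase i, DM) *
          ∏ i : Fin n, ∏ j : Fin n, Real.exp (κ * |u i - u j|)) := by
        gcongr
    _ = _ := by rw [hsize]; ring

/-! ### Moving the contours -/

/-- The integrand `exp (2πiλ (∑ zᵢ - ∑ yᵢ)) K(z, y) μ_S(y) Φ(y - iω₁ 1_S)` of the term of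
`Q_n(λ) M_r Φ` that belongs to `S`, as a holomorphic function of `y`. The coefficients of the
Macdonald operator are absorbed into `μ_S(y)`, the product of `μ(yᵢ - yⱼ)` with the argument
replaced by `yᵢ - yⱼ - iω₁` when `i ∈ S` and `j ∉ S`. -/
noncomputable def shiftedIntegrand (ω₁ ω₂ g lam : ℂ) {n : ℕ} (S : Finset (Fin n)) (Φ : (Fin n → ℂ) → ℂ)
    (z y : Fin n → ℂ) : ℂ :=
  exp (2 * Real.pi * I * lam * ((∑ i, z i) - ∑ i, y i)) * kernelTuple ω₁ ω₂ g z y *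
    (∏ i, ∏ j ∈ Finset.univ.erase i,
      mu ω₁ ω₂ g (y i - y j - if i ∈ S ∧ j ∉ S then I * ω₁ else 0)) * Φ (shift ω₁ S y)

/-- The direction in which the contour of the term that belongs to `S` is moved: the variables in
`S` go up and the other ones go down. -/
noncomputable def contourDir {n : ℕ} (S : Finset (Fin n)) (i : Fin n) : ℝ := if i ∈ S then 1 else -1

variable {ω₁ ω₂ g lam : ℂ} {n : ℕ} {Φ : (Fin n → ℂ) → ℂ}

theorem shiftedIntegrand_empty (z y : Fin n → ℂ) :
    shiftedIntegrand ω₁ ω₂ g lam ∅ Φ z y = baxterKernel ω₁ ω₂ g lam z y * Φ y := by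
  have h : shift ω₁ ∅ y = y := by ext; simp [shift]
  simp [shiftedIntegrand, baxterKernel, muTuple, h]

theorem differentiableAt_prod {ι E : Type*} [NormedAddCommGroup E] [NormedSpace ℂ E]
    {s : Finset ι} {f : ι → E → ℂ} {p : E} (h : ∀ i ∈ s, DifferentiableAt ℂ (f i) p) :
    DifferentiableAt ℂ (fun p => ∏ i ∈ s, f i p) p := by
  classical
  exact (HasFDerivAt.finsetProd fun i hi => (h i hi).hasFDerivAt).differentiableAt

theorem differentiableAt_exp_mul_kernelTuple (hω₁ : 0 < ω₁.re) (hω₂ : 0 < ω₂.re)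
    (hg : 0 < g.re) {E : Type*} [NormedAddCommGroup E] [NormedSpace ℂ E] {z y : E → Fin n → ℂ}
    {p : E} (hz : DifferentiableAt ℂ z p) (hy : DifferentiableAt ℂ y p)
    (him : ∀ i j, 2 * |(z p i - y p j).im| < (ω₁ + ω₂ - g).re) :
    DifferentiableAt ℂ (fun p => exp (2 * Real.pi * I * lam * ((∑ i, z p i) - ∑ i, y p i)) *
      kernelTuple ω₁ ω₂ g (z p) (y p)) p := by
  have hz' := differentiableAt_pi.1 hz
  have hy' := differentiableAt_pi.1 hy
  refine DifferentiableAt.mul ?_ ?_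
  · refine DifferentiableAt.cexp (DifferentiableAt.const_mul ?_ _)
    exact (DifferentiableAt.fun_sum fun i _ => hz' i).sub
      (DifferentiableAt.fun_sum fun i _ => hy' i)
  · simp only [kernelTuple]
    refine differentiableAt_prod fun i _ => ?_
    refine differentiableAt_prod fun j _ => ?_
    exact DifferentiableAt.comp (f := fun p => z p i - y p j) p
      (differentiableAt_kernelK hω₁ hω₂ hg (him i j)) ((hz' i).sub (hy' j))

theorem differentiable_shift (S : Finset (Fin n)) : Differentiable ℂ (shift ω₁ S) := by
  refine differentiable_pi.2 fun k => ?_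
  by_cases hk : k ∈ S
  · simp only [shift, hk, if_true]; fun_prop
  · simp only [shift, hk, if_false]; fun_prop

theorem differentiableAt_shiftedIntegrand (hω₁ : 0 < ω₁.re) (hω₂ : 0 < ω₂.re)
    (hg : 0 < g.re) (hgω : g.re < ω₂.re) {S : Finset (Fin n)} {z y : Fin n → ℂ}
    (him : ∀ i j, 2 * |(z i - y j).im| < (ω₁ + ω₂ - g).re)
    (hv : ∀ i j, -ω₁.re ≤ (y i - y j - if i ∈ S ∧ j ∉ S then I * ω₁ else 0).im ∧
      (y i - y j - if i ∈ S ∧ j ∉ S then I * ω₁ else 0).im ≤ 0)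
    (hΦ : DifferentiableAt ℂ Φ (shift ω₁ S y)) :
    DifferentiableAt ℂ (shiftedIntegrand ω₁ ω₂ g lam S Φ z) y := by
  refine DifferentiableAt.mul (DifferentiableAt.mul ?_ ?_) ?_
  · exact differentiableAt_exp_mul_kernelTuple hω₁ hω₂ hg (z := fun _ => z) (y := fun y => y)
      (differentiableAt_const _) differentiableAt_fun_id him
  · refine differentiableAt_prod fun i _ => ?_
    refine differentiableAt_prod fun j _ => ?_
    exact DifferentiableAt.comp
      (f := fun y : Fin n → ℂ => y i - y j - if i ∈ S ∧ j ∉ S then I * ω₁ else 0) y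
      (differentiableAt_mu hω₁ hω₂ hg hgω (hv i j).1 (hv i j).2) (by fun_prop)
  · exact DifferentiableAt.comp (f := shift ω₁ S) y hΦ (differentiable_shift S y)

theorem im_sub_sub_ite_mem (hω₁ : 0 < ω₁.re) {S : Finset (Fin n)} {s : ℂ} (hs0 : 0 ≤ s.im)
    (hs1 : s.im ≤ ω₁.re / 2) (u : Fin n → ℝ) (i j : Fin n) :
    -ω₁.re ≤ (((u i : ℂ) + s * contourDir S i) - ((u j : ℂ) + s * contourDir S j) -
      if i ∈ S ∧ j ∉ S then I * ω₁ else 0).im ∧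
    (((u i : ℂ) + s * contourDir S i) - ((u j : ℂ) + s * contourDir S j) -
      if i ∈ S ∧ j ∉ S then I * ω₁ else 0).im ≤ 0 := by
  by_cases hi : i ∈ S <;> by_cases hj : j ∈ S <;> simp [contourDir, hi, hj] <;>
    first | constructor <;> linarith | linarith

theorem abs_im_sub_le {s : ℂ} (hs0 : 0 ≤ s.im) (hs1 : s.im ≤ ω₁.re / 2)
    (S : Finset (Fin n)) (x u : Fin n → ℝ) (i j : Fin n) :
    |((toComplex x) i - ((u j : ℂ) + s * contourDir S j)).im| ≤ ω₁.re / 2 := by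
  by_cases hj : j ∈ S <;> simp [contourDir, hj, toComplex, abs_of_nonneg hs0, hs1]

theorem isOpen_abs_im_lt (n : ℕ) (a : ℝ) : IsOpen {z : Fin n → ℂ | ∀ i, |(z i).im| < a} := by
  simp only [Set.ofPred_forall]
  exact isOpen_iInter_of_finite fun i =>
    isOpen_lt (continuous_im.comp (continuous_apply i)).abs continuous_const

/-- On the contours of the term that belongs to `S` the imaginary parts of the arguments of `Φ`
stay in `[-Re ω₁, 0]`. -/
theorem abs_im_shift_le (hω₁ : 0 < ω₁.re) {S : Finset (Fin n)} {s : ℂ} (hs0 : 0 ≤ s.im)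
    (hs1 : s.im ≤ ω₁.re / 2) (u : Fin n → ℝ) (i : Fin n) :
    |(shift ω₁ S (fun i => (u i : ℂ) + s * contourDir S i) i).im| ≤ ω₁.re := by
  rw [abs_le]
  by_cases hi : i ∈ S <;> simp [contourDir, shift, hi] <;> constructor <;> linarith

/-- The term that belongs to `S` is integrable over `ℝⁿ`, and its contour can be moved by
`iω₁/2` in the direction `contourDir S`. -/
theorem integral_shiftedIntegrand (hω₁ : 0 < ω₁.re) (hω₂ : 0 < ω₂.re)
    (hg : 0 < g.re) (hgω : g.re < ω₂.re) (hΦ : Admissible ω₁ ω₂ g lam Φ) (S : Finset (Fin n))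
    (x : Fin n → ℝ) :
    Integrable (fun u : Fin n → ℝ =>
      shiftedIntegrand ω₁ ω₂ g lam S Φ (toComplex x) (toComplex u)) ∧
    Integrable (fun u : Fin n → ℝ => shiftedIntegrand ω₁ ω₂ g lam S Φ (toComplex x)
      (fun i => (u i : ℂ) + (I * ω₁ / 2) * contourDir S i)) ∧
    ∫ u : Fin n → ℝ, shiftedIntegrand ω₁ ω₂ g lam S Φ (toComplex x)
      (fun i => (u i : ℂ) + (I * ω₁ / 2) * contourDir S i) =
    ∫ u : Fin n → ℝ, shiftedIntegrand ω₁ ω₂ g lam S Φ (toComplex x) (toComplex u) := by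
  obtain ⟨ε, hε, hd, hB⟩ := hΦ
  obtain ⟨B, hBint, hBle⟩ := hB ω₁.re (by linarith)
  have hc : 2 * (ω₁.re / 2) < (ω₁ + ω₂ - g).re := by rw [sub_re, add_re]; linarith
  obtain ⟨C, hC0, hC⟩ := exists_norm_kernel_le hω₁ hω₂ hg hgω lam n hc
    ((∑ i, |x i|) + |ω₁.im| + ω₁.re)
  have hxsum : ∀ i, |x i| ≤ ∑ i, |x i| := fun i =>
    Finset.single_le_sum (f := fun i => |x i|) (fun _ _ => abs_nonneg _) (Finset.mem_univ i)
  have hx0 : 0 ≤ ∑ i, |x i| := Finset.sum_nonneg fun _ _ => abs_nonneg _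
  have him0 := abs_nonneg ω₁.im
  have hJ : ∀ (u : Fin n → ℝ) (s : ℂ), 0 ≤ s.im → s.im ≤ ω₁.re / 2 →
      DifferentiableAt ℂ (shiftedIntegrand ω₁ ω₂ g lam S Φ (toComplex x))
        (fun i => (u i : ℂ) + s * contourDir S i) := by
    intro u s hs0 hs1
    refine differentiableAt_shiftedIntegrand hω₁ hω₂ hg hgω
      (fun i j => (mul_le_mul_of_nonneg_left (abs_im_sub_le hs0 hs1 S x u i j)
        zero_le_two).trans_lt hc)
      (fun i j => im_sub_sub_ite_mem hω₁ hs0 hs1 u i j) ?_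
    refine hd.differentiableAt ((isOpen_abs_im_lt n _).mem_nhds fun i => ?_)
    exact (abs_im_shift_le hω₁ hs0 hs1 u i).trans_lt (by linarith)
  -- the real parts of the arguments of `Φ` are `u + a`
  set a : Fin n → ℝ := fun i => if i ∈ S then ω₁.im else 0 with ha
  have hint : Integrable (fun u : Fin n → ℝ => C * (kernelSize ω₁ ω₂ g lam (u + a) * B (u + a))) :=
    (hBint.comp_add_right a).const_mul C
  have hbd : ∀ (u : Fin n → ℝ) (t : ℝ), 0 ≤ t → t ≤ ω₁.re / 2 →
      ‖shiftedIntegrand ω₁ ω₂ g lam S Φ (toComplex x)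
        (fun i => (u i : ℂ) + (t * I : ℂ) * contourDir S i)‖ ≤
        C * (kernelSize ω₁ ω₂ g lam (u + a) * B (u + a)) := by
    intro u t ht0 ht1
    have hs0 : 0 ≤ (t * I : ℂ).im := by simpa using ht0
    have hs1 : (t * I : ℂ).im ≤ ω₁.re / 2 := by simpa using ht1
    rw [shiftedIntegrand, norm_mul, ← mul_assoc]
    refine mul_le_mul ?_ ?_ (norm_nonneg _) (mul_nonneg hC0 (Real.exp_pos _).le)
    · refine hC _ _ _ (u + a) (fun i => ?_) (fun i => ?_) (fun i => ?_) (fun i => ?_)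
        (fun i j => abs_im_sub_le hs0 hs1 S x u i j)
        (fun i j => im_sub_sub_ite_mem hω₁ hs0 hs1 u i j) (fun i j => ?_)
      · simp only [toComplex, ofReal_re]; linarith [hxsum i]
      · simp only [toComplex, ofReal_im, abs_zero]; linarith
      · by_cases hi : i ∈ S <;> simp [ha, hi, contourDir] <;> linarith
      · by_cases hi : i ∈ S <;> simp [hi, contourDir, abs_of_nonneg ht0] <;> linarith
      · have h2 : |((((u i : ℂ) + (t * I : ℂ) * contourDir S i) -
            ((u j : ℂ) + (t * I : ℂ) * contourDir S j) -
            if i ∈ S ∧ j ∉ S then I * ω₁ else 0).re - ((u + a) i - (u + a) j))| ≤ |ω₁.im| := by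
          by_cases hi : i ∈ S <;> by_cases hj : j ∈ S <;> simp [ha, hi, hj, contourDir]
          all_goals (ring_nf; simp)
        linarith
    · have e : shift ω₁ S (fun i => (u i : ℂ) + (t * I : ℂ) * contourDir S i) =
          fun i => ((u + a) i : ℂ) +
            I * ((shift ω₁ S (fun i => (u i : ℂ) + (t * I : ℂ) * contourDir S i) i).im : ℂ) := by
        ext i
        apply Complex.ext
        · by_cases hi : i ∈ S <;> simp [shift, ha, hi, contourDir]
        · simp
      rw [e]
      exact hBle _ _ fun i => abs_im_shift_le hω₁ hs0 hs1 u i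
  have h1 := integral_shift_contour (half_pos hω₁).le hJ hint hbd (s := I * ω₁ / 2) (by simp)
  have h0 := integral_shift_contour le_rfl
    (fun u s hs0 hs1 => hJ u s hs0 (hs1.trans (half_pos hω₁).le)) hint
    (fun u t ht0 ht1 => hbd u t ht0 (ht1.trans (half_pos hω₁).le)) (s := 0) rfl
  refine ⟨?_, h1.1, h1.2⟩
  have h0' := h0.1
  simp only [zero_mul, add_zero] at h0'
  exact h0'

/-! ### The integrands on the moved contours -/

/-- The sum over `S` of the integrands with absorbed coefficients is the integrand of
`Q_n(λ) M_r Φ`. -/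
theorem baxterKernel_mul_macdonald (hω₁ : 0 < ω₁.re) (hω₂ : 0 < ω₂.re)
    (hg : 0 < g.re) (hgω : g.re < ω₂.re) (r : ℕ) (z : Fin n → ℂ) {u : Fin n → ℝ}
    (hu : Function.Injective u) :
    baxterKernel ω₁ ω₂ g lam z (toComplex u) * macdonald ω₁ ω₂ g r Φ (toComplex u) =
      ∑ S ∈ Finset.powersetCard r (Finset.univ : Finset (Fin n)),
        shiftedIntegrand ω₁ ω₂ g lam S Φ z (toComplex u) := by
  rw [macdonald, Finset.mul_sum]
  refine Finset.sum_congr rfl fun S _ => ?_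
  rw [shiftedIntegrand, prod_pairs_mul_ite S
    (fun i j => mu ω₁ ω₂ g (toComplex u i - toComplex u j)) _
    (fun i j => sinh (Real.pi / ω₂ * (toComplex u i - toComplex u j - I * g)) /
      sinh (Real.pi / ω₂ * (toComplex u i - toComplex u j)))]
  · rw [baxterKernel, muTuple]; ring
  · intro i hi j hj
    have h := mu_mul_sinh_div_sinh hω₁ hω₂ hg hgω (v := u i - u j)
      (sub_ne_zero.2 fun h => hj (hu h ▸ hi))
    rw [ofReal_sub] at h
    simpa only [toComplex, hi, hj, not_false_eq_true, and_self, if_true] using h.symm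
  · intro i j h
    simp only [h, if_false, sub_zero]

/-- The factor of the integrands on the shifted contours that depends on the set `S` only through
its cardinality `r`. -/
noncomputable def shiftedFactor (ω₁ ω₂ g lam : ℂ) {n : ℕ} (Φ : (Fin n → ℂ) → ℂ) (r : ℕ)
    (x u : Fin n → ℝ) : ℂ :=
  exp (2 * Real.pi * I * lam * ((∑ i, (x i : ℂ)) - (∑ i, (u i : ℂ)) + (n - 2 * r) * (I * ω₁ / 2))) *
    kernelTuple ω₁ ω₂ g (toComplex x) (fun i => (u i : ℂ) - I * ω₁ / 2) *
    muTuple ω₁ ω₂ g (toComplex u) * Φ (fun i => (u i : ℂ) - I * ω₁ / 2)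

theorem kernelK_sub_sub (hω₁ : 0 < ω₁.re) (hω₂ : 0 < ω₂.re)
    (hg : 0 < g.re) (hgω : g.re < ω₂.re) (a b : ℝ) :
    kernelK ω₁ ω₂ g ((a : ℂ) - b - I * ω₁ / 2) = kernelK ω₁ ω₂ g ((a : ℂ) - (b - I * ω₁ / 2)) *
      (cosh (Real.pi / ω₂ * ((a - b : ℝ) + I * g / 2)) /
        cosh (Real.pi / ω₂ * ((a - b : ℝ) - I * g / 2))) := by
  rw [sub_sub_eq_add_sub, add_sub_right_comm, ← ofReal_sub]
  exact (kernelK_sub_eq hω₁ hω₂ hg hgω (a - b)).2.2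

/-- On its moved contour, the integrand that belongs to `S` is the common factor times the
coefficient of the kernel function identity in the variables `u`. -/
theorem shiftedIntegrand_contourDir (hω₁ : 0 < ω₁.re) (hω₂ : 0 < ω₂.re)
    (hg : 0 < g.re) (hgω : g.re < ω₂.re) (S : Finset (Fin n)) (x : Fin n → ℝ) {u : Fin n → ℝ}
    (hu : Function.Injective u) :
    shiftedIntegrand ω₁ ω₂ g lam S Φ (toComplex x)
        (fun i => (u i : ℂ) + (I * ω₁ / 2) * contourDir S i) =
      shiftedFactor ω₁ ω₂ g lam Φ S.card x u *
        ((∏ i ∈ S, ∏ j ∈ Sᶜ, sinh (Real.pi / ω₂ * (u j - u i - I * g)) /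
          sinh (Real.pi / ω₂ * (u j - u i))) *
        ∏ i ∈ S, ∏ a, cosh (Real.pi / ω₂ * ((x a - u i : ℝ) + I * g / 2)) /
          cosh (Real.pi / ω₂ * ((x a - u i : ℝ) - I * g / 2))) := by
  have hS : shift ω₁ S (fun i => (u i : ℂ) + (I * ω₁ / 2) * contourDir S i) =
      fun i => (u i : ℂ) - I * ω₁ / 2 := by
    ext i
    by_cases hi : i ∈ S <;> simp [shift, contourDir, hi] <;> ring
  have hE : (∑ i, toComplex x i) - ∑ i, ((u i : ℂ) + (I * ω₁ / 2) * contourDir S i) =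
      (∑ i, (x i : ℂ)) - (∑ i, (u i : ℂ)) + (n - 2 * S.card) * (I * ω₁ / 2) := by
    have h1 : ∀ i, ((contourDir S i : ℝ) : ℂ) = 2 * (if i ∈ S then 1 else 0) - 1 := fun i => by
      by_cases hi : i ∈ S <;> simp [contourDir, hi]; norm_num
    rw [Finset.sum_add_distrib, ← Finset.mul_sum]
    simp_rw [h1]
    rw [Finset.sum_sub_distrib, ← Finset.mul_sum]
    simp [toComplex]
    ring
  have hK : kernelTuple ω₁ ω₂ g (toComplex x)
        (fun i => (u i : ℂ) + (I * ω₁ / 2) * contourDir S i) =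
      kernelTuple ω₁ ω₂ g (toComplex x) (fun i => (u i : ℂ) - I * ω₁ / 2) *
        ∏ i ∈ S, ∏ a, cosh (Real.pi / ω₂ * ((x a - u i : ℝ) + I * g / 2)) /
          cosh (Real.pi / ω₂ * ((x a - u i : ℝ) - I * g / 2)) := by
    rw [kernelTuple, kernelTuple, Finset.prod_comm, Finset.prod_comm (s := Finset.univ)
      (f := fun i j => kernelK ω₁ ω₂ g (toComplex x i - ((u j : ℂ) - I * ω₁ / 2))),
      ← Finset.univ_inter S, ← Finset.prod_ite_mem, ← Finset.prod_mul_distrib]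
    refine Finset.prod_congr rfl fun j _ => ?_
    by_cases hj : j ∈ S
    · rw [Finset.univ_inter, if_pos hj, ← Finset.prod_mul_distrib]
      refine Finset.prod_congr rfl fun a _ => ?_
      rw [toComplex, ← kernelK_sub_sub hω₁ hω₂ hg hgω]
      congr 1
      simp [contourDir, hj]; ring
    · rw [Finset.univ_inter, if_neg hj, mul_one]
      refine Finset.prod_congr rfl fun a _ => ?_
      congr 1
      simp [contourDir, hj]; ring
  rw [shiftedIntegrand, hE, hS, hK, shiftedFactor, prod_pairs_mul_ite Sᶜ
    (fun i j => mu ω₁ ω₂ g (toComplex u i - toComplex u j)) _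
    (fun i j => sinh (Real.pi / ω₂ * (u i - u j - I * g)) /
      sinh (Real.pi / ω₂ * (u i - u j))), compl_compl,
    Finset.prod_comm (s := Sᶜ), muTuple]
  · ring
  · intro i hi j hj
    have hi' := Finset.mem_compl.1 hi
    have hj' : j ∈ S := by simpa using hj
    have h := mu_mul_sinh_div_sinh hω₁ hω₂ hg hgω (v := u i - u j)
      (sub_ne_zero.2 fun h => hi' (hu h ▸ hj'))
    rw [ofReal_sub] at h
    rw [toComplex, toComplex, h]
    congr 1
    simp [contourDir, hi', hj']; ring
  · intro i j h
    congr 1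
    by_cases hi : i ∈ S <;> by_cases hj : j ∈ S
    · simp [toComplex, contourDir, hi, hj]
    · simp [toComplex, contourDir, hi, hj]; ring
    · exact absurd ⟨Finset.mem_compl.2 hi, by simpa using hj⟩ h
    · simp [toComplex, contourDir, hi, hj]

/-- On `ℝⁿ - iω₁/2`, the integrand of the continuation of `Q_n(λ) Φ` at the point `x - iω₁ 1_S`
is the common factor times a product of the ratios of hyperbolic cosines. -/
theorem shiftedIntegrand_empty_shift (hω₁ : 0 < ω₁.re) (hω₂ : 0 < ω₂.re)
    (hg : 0 < g.re) (hgω : g.re < ω₂.re) (S : Finset (Fin n)) (x u : Fin n → ℝ) :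
    shiftedIntegrand ω₁ ω₂ g lam ∅ Φ (shift ω₁ S (toComplex x))
        (fun i => (u i : ℂ) + (I * ω₁ / 2) * contourDir ∅ i) =
      shiftedFactor ω₁ ω₂ g lam Φ S.card x u *
        ∏ i ∈ S, ∏ a, cosh (Real.pi / ω₂ * ((x i - u a : ℝ) + I * g / 2)) /
          cosh (Real.pi / ω₂ * ((x i - u a : ℝ) - I * g / 2)) := by
  have hy : (fun i => (u i : ℂ) + (I * ω₁ / 2) * contourDir ∅ i) =
      fun i => (u i : ℂ) - I * ω₁ / 2 := by
    ext i; simp [contourDir]; ring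
  have hE : (∑ i, shift ω₁ S (toComplex x) i) - ∑ i, ((u i : ℂ) - I * ω₁ / 2) =
      (∑ i, (x i : ℂ)) - (∑ i, (u i : ℂ)) + (n - 2 * S.card) * (I * ω₁ / 2) := by
    have h1 : ∀ i, shift ω₁ S (toComplex x) i = x i - I * ω₁ * (if i ∈ S then 1 else 0) :=
      fun i => by by_cases hi : i ∈ S <;> simp [shift, toComplex, hi]
    simp_rw [h1]
    rw [Finset.sum_sub_distrib, ← Finset.mul_sum, Finset.sum_sub_distrib]
    simp
    ring
  have hK : kernelTuple ω₁ ω₂ g (shift ω₁ S (toComplex x)) (fun i => (u i : ℂ) - I * ω₁ / 2) =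
      kernelTuple ω₁ ω₂ g (toComplex x) (fun i => (u i : ℂ) - I * ω₁ / 2) *
        ∏ i ∈ S, ∏ a, cosh (Real.pi / ω₂ * ((x i - u a : ℝ) + I * g / 2)) /
          cosh (Real.pi / ω₂ * ((x i - u a : ℝ) - I * g / 2)) := by
    rw [kernelTuple, kernelTuple, ← Finset.univ_inter S, ← Finset.prod_ite_mem,
      ← Finset.prod_mul_distrib]
    refine Finset.prod_congr rfl fun i _ => ?_
    by_cases hi : i ∈ S
    · rw [Finset.univ_inter, if_pos hi, ← Finset.prod_mul_distrib]
      refine Finset.prod_congr rfl fun a _ => ?_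
      rw [toComplex, ← kernelK_sub_sub hω₁ hω₂ hg hgω]
      congr 1
      simp [shift, toComplex, hi]; ring
    · rw [Finset.univ_inter, if_neg hi, mul_one]
      refine Finset.prod_congr rfl fun a _ => ?_
      simp [shift, hi]
  have hM : muTuple ω₁ ω₂ g (fun i => (u i : ℂ) - I * ω₁ / 2) =
      muTuple ω₁ ω₂ g (toComplex u) := by
    simp [muTuple, toComplex]
  rw [hy, shiftedIntegrand_empty, baxterKernel, hE, hK, hM, shiftedFactor]
  ring

/-- The difference operators in `z` and in `y` act in the same way under the integral, once the
contours are moved: the kernel function identity. -/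
theorem sum_shiftedIntegrand_eq (hω₁ : 0 < ω₁.re) (hω₂ : 0 < ω₂.re)
    (hg : 0 < g.re) (hgω : g.re < ω₂.re) (r : ℕ) {x u : Fin n → ℝ} (hx : Function.Injective x)
    (hu : Function.Injective u) :
    ∑ S ∈ Finset.powersetCard r (Finset.univ : Finset (Fin n)),
      (∏ i ∈ S, ∏ j ∈ Sᶜ, sinh (Real.pi / ω₂ * (x i - x j - I * g)) /
        sinh (Real.pi / ω₂ * (x i - x j))) *
      shiftedIntegrand ω₁ ω₂ g lam ∅ Φ (shift ω₁ S (toComplex x))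
        (fun i => (u i : ℂ) + (I * ω₁ / 2) * contourDir ∅ i) =
    ∑ S ∈ Finset.powersetCard r (Finset.univ : Finset (Fin n)),
      shiftedIntegrand ω₁ ω₂ g lam S Φ (toComplex x)
        (fun i => (u i : ℂ) + (I * ω₁ / 2) * contourDir S i) := by
  have h := congrArg (shiftedFactor ω₁ ω₂ g lam Φ r x u * ·)
    (kernel_identity_hyperbolic hω₁ hω₂ hg hgω hx hu r)
  simp only [Finset.mul_sum] at h
  convert h using 1
  · refine Finset.sum_congr rfl fun S hS => ?_
    rw [shiftedIntegrand_empty_shift hω₁ hω₂ hg hgω, (Finset.mem_powersetCard.1 hS).2]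
    ring
  · refine Finset.sum_congr rfl fun S hS => ?_
    rw [shiftedIntegrand_contourDir hω₁ hω₂ hg hgω _ _ hu, (Finset.mem_powersetCard.1 hS).2]

/-! ### Analytic continuation and commutation -/

theorem isOpen_polystrip (n : ℕ) (a b : ℝ) :
    IsOpen {z : Fin n → ℂ | ∀ i, a < (z i).im ∧ (z i).im < b} := by
  simp only [Set.ofPred_forall]
  exact isOpen_iInter_of_finite fun i =>
    (isOpen_lt continuous_const (continuous_im.comp (continuous_apply i))).inter
      (isOpen_lt (continuous_im.comp (continuous_apply i)) continuous_const)

/-- The contour `ℝⁿ - iω₁/2` is in the middle of the polystrip, which leaves a margin of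
`Re (ω₂ - g) / 4` to the poles of the kernel, at `|Im (zᵢ - yⱼ)| = Re (ω₁ + ω₂ - g) / 2`. -/
theorem abs_im_sub_contour_le {z : Fin n → ℂ}
    (hz : ∀ i, -ω₁.re - (ω₂.re - g.re) / 4 < (z i).im ∧ (z i).im < (ω₂.re - g.re) / 4)
    (u : Fin n → ℝ) (i j : Fin n) :
    |(z i - ((u j : ℂ) + (I * ω₁ / 2) * contourDir ∅ j)).im| ≤
      ω₁.re / 2 + (ω₂.re - g.re) / 4 := by
  have h := hz i
  rw [abs_le]
  simp [contourDir]
  constructor <;> linarith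

theorem differentiableAt_shiftedIntegrand_empty (hω₁ : 0 < ω₁.re) (hω₂ : 0 < ω₂.re)
    (hg : 0 < g.re) (hgω : g.re < ω₂.re) (hΦ : Admissible ω₁ ω₂ g lam Φ) {z : Fin n → ℂ}
    (hz : ∀ i, -ω₁.re - (ω₂.re - g.re) / 4 < (z i).im ∧ (z i).im < (ω₂.re - g.re) / 4)
    (u : Fin n → ℝ) :
    DifferentiableAt ℂ (shiftedIntegrand ω₁ ω₂ g lam ∅ Φ z)
      (fun i => (u i : ℂ) + (I * ω₁ / 2) * contourDir ∅ i) := by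
  obtain ⟨ε, hε, hd, -⟩ := hΦ
  have hs : (I * ω₁ / 2).im = ω₁.re / 2 := by simp
  refine differentiableAt_shiftedIntegrand hω₁ hω₂ hg hgω (fun i j => ?_)
    (fun i j => im_sub_sub_ite_mem hω₁ (by rw [hs]; linarith) hs.le u i j) ?_
  · have := abs_im_sub_contour_le hz u i j
    rw [sub_re, add_re]; linarith
  · refine hd.differentiableAt ((isOpen_abs_im_lt n _).mem_nhds fun i => ?_)
    exact (abs_im_shift_le hω₁ (by rw [hs]; linarith) hs.le u i).trans_lt (by linarith)

theorem continuous_shiftedIntegrand_empty (hω₁ : 0 < ω₁.re) (hω₂ : 0 < ω₂.re)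
    (hg : 0 < g.re) (hgω : g.re < ω₂.re) (hΦ : Admissible ω₁ ω₂ g lam Φ) {z : Fin n → ℂ}
    (hz : ∀ i, -ω₁.re - (ω₂.re - g.re) / 4 < (z i).im ∧ (z i).im < (ω₂.re - g.re) / 4) :
    Continuous (fun u : Fin n → ℝ => shiftedIntegrand ω₁ ω₂ g lam ∅ Φ z
      (fun i => (u i : ℂ) + (I * ω₁ / 2) * contourDir ∅ i)) :=
  continuous_iff_continuousAt.2 fun u => ContinuousAt.comp
    (f := fun (u : Fin n → ℝ) i => (u i : ℂ) + (I * ω₁ / 2) * contourDir ∅ i)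
    (differentiableAt_shiftedIntegrand_empty hω₁ hω₂ hg hgω hΦ hz u).continuousAt
    (continuous_pi fun i =>
      (continuous_ofReal.comp (continuous_apply i)).add continuous_const).continuousAt

/-- A majorant of the integrand over `ℝⁿ - iω₁/2` that is uniform in `z` on bounded parts of the
polystrip of the continuation. -/
theorem exists_norm_shiftedIntegrand_empty_le (hω₁ : 0 < ω₁.re) (hω₂ : 0 < ω₂.re)
    (hg : 0 < g.re) (hgω : g.re < ω₂.re) (hΦ : Admissible ω₁ ω₂ g lam Φ) (R : ℝ) :
    ∃ b : (Fin n → ℝ) → ℝ, Integrable b ∧ ∀ z : Fin n → ℂ,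
      (∀ i, -ω₁.re - (ω₂.re - g.re) / 4 < (z i).im ∧ (z i).im < (ω₂.re - g.re) / 4) →
      (∀ i, |(z i).re| ≤ R) → ∀ u : Fin n → ℝ,
      ‖shiftedIntegrand ω₁ ω₂ g lam ∅ Φ z
        (fun i => (u i : ℂ) + (I * ω₁ / 2) * contourDir ∅ i)‖ ≤ b u := by
  obtain ⟨ε, hε, hd, hB⟩ := hΦ
  obtain ⟨B, hBint, hBle⟩ := hB ω₁.re (by linarith)
  have hc : 2 * (ω₁.re / 2 + (ω₂.re - g.re) / 4) < (ω₁ + ω₂ - g).re := by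
    rw [sub_re, add_re]; linarith
  obtain ⟨C, hC0, hC⟩ := exists_norm_kernel_le hω₁ hω₂ hg hgω lam n hc
    (|R| + ω₁.re + (ω₂.re - g.re) / 4)
  have hR0 := abs_nonneg R
  have hs : (I * ω₁ / 2).im = ω₁.re / 2 := by simp
  set a : Fin n → ℝ := fun _ => ω₁.im / 2 with ha
  refine ⟨fun u => C * (kernelSize ω₁ ω₂ g lam (u + a) * B (u + a)),
    (hBint.comp_add_right a).const_mul C, fun z hz hzR u => ?_⟩
  change _ ≤ C * (kernelSize ω₁ ω₂ g lam (u + a) * B (u + a))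
  rw [shiftedIntegrand, norm_mul, ← mul_assoc]
  refine mul_le_mul ?_ ?_ (norm_nonneg _) (mul_nonneg hC0 (Real.exp_pos _).le)
  · refine hC _ _ _ (u + a) (fun i => ?_) (fun i => ?_) (fun i => ?_) (fun i => ?_)
      (fun i j => abs_im_sub_contour_le hz u i j)
      (fun i j => im_sub_sub_ite_mem hω₁ (by rw [hs]; linarith) hs.le u i j) (fun i j => ?_)
    · have := le_abs_self R
      linarith [hzR i]
    · have := hz i
      rw [abs_le]; constructor <;> linarith
    · simp [ha, contourDir, neg_div]; linarith
    · simp [contourDir, abs_of_pos (half_pos hω₁)]; linarith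
    · simp [ha, contourDir]; linarith
  · have e : shift ω₁ ∅ (fun i => (u i : ℂ) + (I * ω₁ / 2) * contourDir ∅ i) =
        fun i => ((u + a) i : ℂ) + I * ((-(ω₁.re / 2) : ℝ) : ℂ) := by
      ext i
      apply Complex.ext <;> simp [shift, ha, contourDir, neg_div]
    rw [e]
    exact hBle _ _ fun i => by rw [abs_neg, abs_of_pos (half_pos hω₁)]; linarith

theorem integrable_shiftedIntegrand_empty (hω₁ : 0 < ω₁.re) (hω₂ : 0 < ω₂.re)
    (hg : 0 < g.re) (hgω : g.re < ω₂.re) (hΦ : Admissible ω₁ ω₂ g lam Φ) {z : Fin n → ℂ}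
    (hz : ∀ i, -ω₁.re - (ω₂.re - g.re) / 4 < (z i).im ∧ (z i).im < (ω₂.re - g.re) / 4) :
    Integrable (fun u : Fin n → ℝ => shiftedIntegrand ω₁ ω₂ g lam ∅ Φ z
      (fun i => (u i : ℂ) + (I * ω₁ / 2) * contourDir ∅ i)) := by
  obtain ⟨b, hb, hbd⟩ := exists_norm_shiftedIntegrand_empty_le hω₁ hω₂ hg hgω hΦ ‖z‖
  refine hb.mono' (continuous_shiftedIntegrand_empty hω₁ hω₂ hg hgω hΦ hz).aestronglyMeasurable
    (Filter.Eventually.of_forall fun u => hbd z hz (fun i => ?_) u)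
  exact (abs_re_le_norm _).trans (norm_le_pi_norm z i)

/-- The function `Q_n(λ) Φ` is continued by the integral over the plane `ℝⁿ - iω₁/2`: there the
arguments `zᵢ - yⱼ` of the kernel stay off the poles as long as `-Re ω₁ - δ < Im zᵢ < δ`. -/
theorem isContinuation_baxterQ (hω₁ : 0 < ω₁.re) (hω₂ : 0 < ω₂.re)
    (hg : 0 < g.re) (hgω : g.re < ω₂.re) (hΦ : Admissible ω₁ ω₂ g lam Φ) :
    IsContinuation ω₁ (baxterQ ω₁ ω₂ g lam (fun y => Φ (toComplex y)))
      (fun z => ∫ u : Fin n → ℝ, shiftedIntegrand ω₁ ω₂ g lam ∅ Φ z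
        (fun i => (u i : ℂ) + (I * ω₁ / 2) * contourDir ∅ i)) := by
  refine ⟨(ω₂.re - g.re) / 4, by linarith, fun z₀ hz₀ => ?_, fun x => ?_⟩
  · obtain ⟨r, hr, hball⟩ := Metric.isOpen_iff.1 (isOpen_polystrip n _ _) z₀ hz₀
    obtain ⟨b, hb, hbd⟩ := exists_norm_shiftedIntegrand_empty_le hω₁ hω₂ hg hgω hΦ (‖z₀‖ + r)
    refine (hasFDerivAt_integral_of_holomorphic hr hb (fun z hz => ?_)
      (Filter.Eventually.of_forall fun u z hz => ?_)
      (Filter.Eventually.of_forall fun u z hz => ?_)).2.differentiableAt.differentiableWithinAt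
    · exact (continuous_shiftedIntegrand_empty hω₁ hω₂ hg hgω hΦ
        (hball hz)).aestronglyMeasurable
    · refine hbd z (hball hz) (fun i => ?_) u
      have h1 := norm_sub_norm_le z z₀
      have h2 := mem_ball_iff_norm.1 hz
      exact (abs_re_le_norm _).trans ((norm_le_pi_norm z i).trans (by linarith))
    · refine DifferentiableAt.differentiableWithinAt ?_
      simp only [shiftedIntegrand]
      refine (DifferentiableAt.mul_const ?_ _).mul_const _
      refine differentiableAt_exp_mul_kernelTuple hω₁ hω₂ hg (z := fun z => z)
        (y := fun _ i => (u i : ℂ) + (I * ω₁ / 2) * contourDir ∅ i)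
        differentiableAt_fun_id (differentiableAt_const _) fun i j => ?_
      have := abs_im_sub_contour_le (hball hz) u i j
      rw [sub_re, add_re]; linarith
  · rw [baxterQ]
    simp_rw [← shiftedIntegrand_empty]
    exact (integral_shiftedIntegrand hω₁ hω₂ hg hgω hΦ ∅ x).2.2

theorem eqOn_strip_of_eq_real {f h : ℂ → ℂ} {a b : ℝ} (ha : a < 0) (hb : 0 < b)
    (hf : DifferentiableOn ℂ f {s | a < s.im ∧ s.im < b})
    (hh : DifferentiableOn ℂ h {s | a < s.im ∧ s.im < b}) (hfh : ∀ t : ℝ, f t = h t) :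
    Set.EqOn f h {s | a < s.im ∧ s.im < b} := by
  have ho : IsOpen {s : ℂ | a < s.im ∧ s.im < b} :=
    (isOpen_lt continuous_const continuous_im).inter (isOpen_lt continuous_im continuous_const)
  have hc : IsPreconnected {s : ℂ | a < s.im ∧ s.im < b} :=
    ((convex_halfSpace_im_gt a).inter (convex_halfSpace_im_lt b)).isPreconnected
  refine (hf.analyticOnNhd ho).eqOn_of_preconnected_of_frequently_eq (hh.analyticOnNhd ho) hc
    (z₀ := 0) (by simpa using ⟨ha, hb⟩) ?_
  have ht : Filter.Tendsto (fun t : ℝ => (t : ℂ)) (nhdsWithin 0 {0}ᶜ) (nhdsWithin 0 {0}ᶜ) := by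
    refine tendsto_nhdsWithin_iff.2 ⟨?_, ?_⟩
    · have := (continuous_ofReal.tendsto (0 : ℝ)).mono_left
        (nhdsWithin_le_nhds (s := ({0}ᶜ : Set ℝ)))
      simpa using this
    · filter_upwards [self_mem_nhdsWithin] with t ht
      simpa using ht
  exact ht.frequently (Filter.Eventually.frequently (Filter.Eventually.of_forall hfh))

/-- Two continuations agree at the points at which the Macdonald operators evaluate them: such a
point lies on the complex line through a point of `ℝⁿ` in a real direction, and the identity
theorem applies on that line. -/
theorem IsContinuation.eq_shift (hω₁ : 0 < ω₁.re) {f : (Fin n → ℝ) → ℂ} {F G : (Fin n → ℂ) → ℂ}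
    (hF : IsContinuation ω₁ f F) (hG : IsContinuation ω₁ f G) (S : Finset (Fin n))
    (x : Fin n → ℝ) : F (shift ω₁ S (toComplex x)) = G (shift ω₁ S (toComplex x)) := by
  obtain ⟨δ₁, hδ₁, hF, hFf⟩ := hF
  obtain ⟨δ₂, hδ₂, hG, hGf⟩ := hG
  let e : ℂ → Fin n → ℂ := fun s i => (x i : ℂ) + s * (if i ∈ S then 1 else 0)
  have he : Differentiable ℂ e := differentiable_pi.2 fun i => by fun_prop
  have hreal : ∀ t : ℝ, e t = toComplex fun i => x i + t * (if i ∈ S then 1 else 0) := fun t => by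
    ext i; by_cases hi : i ∈ S <;> simp [e, toComplex, hi]
  have hm : 0 < min δ₁ δ₂ := lt_min hδ₁ hδ₂
  have hmaps : ∀ δ : ℝ, 0 < δ → min δ₁ δ₂ ≤ δ → Set.MapsTo e
      {s | -ω₁.re - min δ₁ δ₂ < s.im ∧ s.im < min δ₁ δ₂}
      {z | ∀ i, -ω₁.re - δ < (z i).im ∧ (z i).im < δ} := by
    intro δ hδ hle s hs i
    have h1 := hs.1
    have h2 := hs.2
    by_cases hi : i ∈ S <;> simp [e, hi] <;> constructor <;> linarith
  have h := eqOn_strip_of_eq_real (f := fun s => F (e s)) (h := fun s => G (e s))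
    (a := -ω₁.re - min δ₁ δ₂) (b := min δ₁ δ₂) (by linarith) hm
    (hF.comp he.differentiableOn (hmaps δ₁ hδ₁ (min_le_left _ _)))
    (hG.comp he.differentiableOn (hmaps δ₂ hδ₂ (min_le_right _ _)))
    (fun t => by simp only [hreal, hFf, hGf])
  have hs : shift ω₁ S (toComplex x) = e (-(I * ω₁)) := by
    ext i
    by_cases hi : i ∈ S <;> simp [shift, toComplex, e, hi, sub_eq_add_neg]
  have him : (-(I * ω₁)).im = -ω₁.re := by simp
  rw [hs]
  exact h ⟨by rw [him]; linarith, by rw [him]; linarith⟩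

theorem baxterKernel_mul_macdonald_ae (hω₁ : 0 < ω₁.re) (hω₂ : 0 < ω₂.re)
    (hg : 0 < g.re) (hgω : g.re < ω₂.re) (r : ℕ) (x : Fin n → ℝ) :
    (fun u : Fin n → ℝ => ∑ S ∈ Finset.powersetCard r (Finset.univ : Finset (Fin n)),
        shiftedIntegrand ω₁ ω₂ g lam S Φ (toComplex x) (toComplex u)) =ᵐ[volume]
    fun u : Fin n → ℝ => baxterKernel ω₁ ω₂ g lam (toComplex x) (toComplex u) *
      macdonald ω₁ ω₂ g r Φ (toComplex u) := by
  filter_upwards [ae_injective n] with u hu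
  exact (baxterKernel_mul_macdonald hω₁ hω₂ hg hgω r _ hu).symm

theorem macdonald_eq_baxterQ_macdonald (hω₁ : 0 < ω₁.re) (hω₂ : 0 < ω₂.re)
    (hg : 0 < g.re) (hgω : g.re < ω₂.re) (hΦ : Admissible ω₁ ω₂ g lam Φ) (r : ℕ)
    {F : (Fin n → ℂ) → ℂ}
    (hF : IsContinuation ω₁ (baxterQ ω₁ ω₂ g lam (fun y => Φ (toComplex y))) F)
    {x : Fin n → ℝ} (hx : Function.Injective x) :
    macdonald ω₁ ω₂ g r F (toComplex x) =
      baxterQ ω₁ ω₂ g lam (fun y => macdonald ω₁ ω₂ g r Φ (toComplex y)) x := by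
  have hshift : ∀ S : Finset (Fin n), ∀ i,
      -ω₁.re - (ω₂.re - g.re) / 4 < (shift ω₁ S (toComplex x) i).im ∧
        (shift ω₁ S (toComplex x) i).im < (ω₂.re - g.re) / 4 := fun S i => by
    by_cases hi : i ∈ S <;> simp [shift, toComplex, hi] <;> constructor <;> linarith
  have hJ := integral_shiftedIntegrand hω₁ hω₂ hg hgω hΦ
  rw [macdonald, baxterQ]
  simp_rw [hF.eq_shift hω₁ (isContinuation_baxterQ hω₁ hω₂ hg hgω hΦ), ← integral_const_mul]
  rw [← integral_congr_ae (baxterKernel_mul_macdonald_ae hω₁ hω₂ hg hgω r x),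
    ← integral_finsetSum _ fun S _ =>
      (integrable_shiftedIntegrand_empty hω₁ hω₂ hg hgω hΦ (hshift S)).const_mul _,
    integral_finsetSum _ fun S _ => (hJ S x).1]
  simp_rw [← (hJ _ x).2.2]
  rw [← integral_finsetSum _ fun S _ => (hJ S x).2.1]
  refine integral_congr_ae ?_
  filter_upwards [ae_injective n] with u hu
  exact sum_shiftedIntegrand_eq hω₁ hω₂ hg hgω r hx hu

end RuijsenaarsBaxter

theorem theorem1 (ω₁ ω₂ g : ℂ) (hω₁ : 0 < ω₁.re) (hω₂ : 0 < ω₂.re)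
    (hg : 0 < g.re) (hgω : g.re < ω₂.re) (lam : ℂ) (n : ℕ) (Φ : (Fin n → ℂ) → ℂ)
    (hΦ : RuijsenaarsBaxter.Admissible ω₁ ω₂ g lam Φ) :
    -- the integral `Q_n(λ) Φ` converges absolutely on `ℝⁿ`
    (∀ x : Fin n → ℝ, MeasureTheory.Integrable (fun y : Fin n → ℝ =>
      RuijsenaarsBaxter.baxterKernel ω₁ ω₂ g lam
        (RuijsenaarsBaxter.toComplex x) (RuijsenaarsBaxter.toComplex y) *
      Φ (RuijsenaarsBaxter.toComplex y))) ∧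
    -- `Q_n(λ) Φ` continues analytically, so that `M_r` can be applied to it
    (∃ F : (Fin n → ℂ) → ℂ, RuijsenaarsBaxter.IsContinuation ω₁
      (RuijsenaarsBaxter.baxterQ ω₁ ω₂ g lam
        (fun y => Φ (RuijsenaarsBaxter.toComplex y))) F) ∧
    ∀ r : ℕ, 1 ≤ r → r ≤ n →
      -- the integral `Q_n(λ) M_r Φ` converges absolutely on `ℝⁿ`
      (∀ x : Fin n → ℝ, MeasureTheory.Integrable (fun y : Fin n → ℝ =>
        RuijsenaarsBaxter.baxterKernel ω₁ ω₂ g lam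
          (RuijsenaarsBaxter.toComplex x) (RuijsenaarsBaxter.toComplex y) *
        RuijsenaarsBaxter.macdonald ω₁ ω₂ g r Φ (RuijsenaarsBaxter.toComplex y))) ∧
      -- `M_r Q_n(λ) Φ = Q_n(λ) M_r Φ`
      ∀ F : (Fin n → ℂ) → ℂ, RuijsenaarsBaxter.IsContinuation ω₁
          (RuijsenaarsBaxter.baxterQ ω₁ ω₂ g lam
            (fun y => Φ (RuijsenaarsBaxter.toComplex y))) F →
        ∀ x : Fin n → ℝ, Function.Injective x →
          RuijsenaarsBaxter.macdonald ω₁ ω₂ g r F (RuijsenaarsBaxter.toComplex x) =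
          RuijsenaarsBaxter.baxterQ ω₁ ω₂ g lam
            (fun y => RuijsenaarsBaxter.macdonald ω₁ ω₂ g r Φ
              (RuijsenaarsBaxter.toComplex y)) x := by
  refine ⟨fun x => ?_, ⟨_, RuijsenaarsBaxter.isContinuation_baxterQ hω₁ hω₂ hg hgω hΦ⟩,
    fun r _ _ => ⟨fun x => ?_, fun F hF x hx =>
      RuijsenaarsBaxter.macdonald_eq_baxterQ_macdonald hω₁ hω₂ hg hgω hΦ r hF hx⟩⟩
  · simp_rw [← RuijsenaarsBaxter.shiftedIntegrand_empty]
    exact (RuijsenaarsBaxter.integral_shiftedIntegrand hω₁ hω₂ hg hgω hΦ ∅ x).1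
  · refine MeasureTheory.Integrable.congr ?_
      (RuijsenaarsBaxter.baxterKernel_mul_macdonald_ae hω₁ hω₂ hg hgω r x)
    exact MeasureTheory.integrable_finsetSum _ fun S _ =>
      (RuijsenaarsBaxter.integral_shiftedIntegrand hω₁ hω₂ hg hgω hΦ S x).1
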